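/- **Setting.** Let $d\ge 1$. Cubes in $\mathbb R^d$ are products of half-open intervals $[a_i,a_i+\ell)$ of equal length $\ell=\ell(Q)$. A *dyadic grid* $\mathcal D$ is a collection of cubes such that $Q\cap Q'\in\{\emptyset,Q,Q'\}$ for all $Q,Q'\in\mathcal D$, the $2^d$ children of each $Q\in\mathcal D$ (obtained by halving its edges) belong to $\mathcal D$, and for each $Q\in\mathcal D$ the cubes of $\mathcal D$ of the same size as $Q$ partition $\mathbb R^d$. A *generalized Haar function* on $Q$ is a linear combination of $\mathbf 1_Q$ and of the indicators of the children of $Q$. Functions are real- or complex-valued. A *(generalized) Haar shift* $\mathbb S$ of parameters $(m,n)\in\mathbb N^2$ is given by a dyadic grid $\mathcal D$ and a formal series $$\mathbb S f=\sum_{Q\in\mathcal D}\mathbb S_Qf,\qquad \mathbb S_Q f(x)=\sum_{\substack{Q',R'\in\mathcal D,\ Q',R'\subset Q\\ \ell(Q')=2^{-m}\ell(Q),\ \ell(R')=2^{-n}\ell(Q)}}\frac{\langle f,h^{Q'}_{R'}\rangle}{|Q|}\,h^{R'}_{Q'}(x),$$ where $h^{Q'}_{R'}$ and $h^{R'}_{Q'}$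 are generalized Haar functions on $R'$ and on $Q'$ respectively, with $\|h^{Q'}_{R'}\|_\infty\|h^{R'}_{Q'}\|_\infty\le 1$. Its *complexity* is $\kappa=\max(m,n)$. Put $$\mathbb S_\epsilon f(x)=\sum_{Q\in\mathcal D,\ \ell(Q)\ge\epsilon}\mathbb S_Qf(x),\qquad \mathbb S_\natural f(x)=\sup_{\epsilon>0}|\mathbb S_\epsilon f(x)|.$$ $\mathbb S$ is *$L^2$-bounded with norm at most $N$* if there is a bounded linear operator $T$ on $L^2(\mathbb R^d)$ with $\|T\|\le N$ such that $\langle \mathbb S_\epsilon f,g\rangle\to\langle Tf,g\rangle$ as $\epsilon\to0$ for all bounded, compactly supported measurable $f,g$. A *weight* is a locally integrable function $w\ge 0$ on $\mathbb R^d$; write $w(Q)=\int_Q w\,dx$ and also $w$ for the measure $w\,dx$. For $1<p<\infty$ and $p'=p/(p-1)$, with suprema over all cubes $Q$ in $\mathbb R^d$, let $$[w,\sigma]_{A_p}=\sup_Q\Bigl[\frac{w(Q)}{|Q|}\Bigr]^{1/p}\Bigl[\frac{\sigma(Q)}{|Q|}\Bigr]^{1/p'},\qquad \|w\|_{A_\infty}=\sup_Q\frac1{w(Q)}\int_Q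 M(w\mathbf 1_Q)\,dx,$$ where $Mg(x)=\sup_{t>0}(2t)^{-d}\int_{[-t,t]^d}|g(x+y)|\,dy$, and with the conventions $0/0=0$ and $0\cdot\infty=0$. **Theorem.** Let $d\ge1$, $1<p<\infty$ and $N\in\mathbb R$. There are constants $A,c$, depending only on $d,p,N$ (and on whether the scalars are real or complex), such that for every Haar shift $\mathbb S$ which is $L^2$-bounded with norm at most $N$, with complexity denoted by $\kappa$, every pair of weights $(w,\sigma)$ and every $f\in L^p(\sigma)$, $$\|\mathbb S_\natural(\sigma f)\|_{L^p(w)}\le A e^{c\kappa}\,[w,\sigma]_{A_p}\bigl(\|w\|_{A_\infty}^{1/p'}+\|\sigma\|_{A_\infty}^{1/p}\bigr)\|f\|_{L^p(\sigma)}.$$ Moreover, if $[w,\sigma]_{A_p}$, $\|w\|_{A_\infty}$ and $\|\sigma\|_{A_\infty}$ are finite, then for $w$-almost every $x$ and all $\epsilon>0$ the series defining $\mathbb S_\epsilon(\sigma f)(x)$ converges absolutely. (When a characteristic is infinite, a divergent series $\mathbb S_\epsilon(\sigma f)(x)$ is read as $0$.) -/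

import Mathlib

open MeasureTheory Filter Topology
open scoped ENNReal

noncomputable section

/-! Cubes and dyadic grids in `ℝ^d`, realised as `Fin d → ℝ` with Lebesgue measure `volume`. -/

/-- An axis-parallel cube in `ℝ^d`, given by its lower corner and its (positive) side length. -/
structure Cube (d : ℕ) where
  corner : Fin d → ℝ
  side : ℝ
  side_pos : 0 < side

namespace Cube

variable {d : ℕ}

/-- The points of the cube: a product of half-open intervals `[aᵢ, aᵢ + ℓ)`. -/
def toSet (Q : Cube d) : Set (Fin d → ℝ) :=
  {x | ∀ i, x i ∈ Set.Ico (Q.corner i) (Q.corner i + Q.side)}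

/-- The `2^d` children of a cube: halve every edge and choose a half in every coordinate. -/
def child (Q : Cube d) (e : Fin d → Bool) : Cube d where
  corner := fun i => Q.corner i + if e i then Q.side / 2 else 0
  side := Q.side / 2
  side_pos := half_pos Q.side_pos

end Cube

/-- A dyadic grid: a nested family of cubes which contains the children of each of its cubes and
in which the cubes of the same size as a given member partition `ℝ^d`. -/
structure IsDyadicGrid {d : ℕ} (D : Set (Cube d)) : Prop where
  nested : ∀ Q ∈ D, ∀ Q' ∈ D, Q.toSet ∩ Q'.toSet = ∅ ∨
    Q.toSet ∩ Q'.toSet = Q.toSet ∨ Q.toSet ∩ Q'.toSet = Q'.toSet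
  child_mem : ∀ Q ∈ D, ∀ e : Fin d → Bool, Q.child e ∈ D
  partition : ∀ Q ∈ D, ∀ x : Fin d → ℝ, ∃! Q' : Cube d, Q' ∈ D ∧ Q'.side = Q.side ∧ x ∈ Q'.toSet

/-- The (finitely many) cubes `Q' ∈ D` with `Q' ⊆ Q` and `ℓ(Q') = 2^{-m} ℓ(Q)`. -/
def subcubes {d : ℕ} (D : Set (Cube d)) (m : ℕ) (Q : Cube d) : Set (Cube d) :=
  {Q' | Q' ∈ D ∧ Q'.toSet ⊆ Q.toSet ∧ Q'.side = Q.side / 2 ^ m}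

/-- A generalized Haar function on `Q`: a linear combination of the indicator of `Q` and of the
indicators of the children of `Q`. -/
def IsGeneralizedHaar {𝕜 : Type*} [RCLike 𝕜] {d : ℕ} (Q : Cube d) (h : (Fin d → ℝ) → 𝕜) : Prop :=
  ∃ (a : 𝕜) (b : (Fin d → Bool) → 𝕜), ∀ x,
    h x = Q.toSet.indicator (fun _ => a) x + ∑ e, (Q.child e).toSet.indicator (fun _ => b e) x

/-! Haar shifts and their maximal truncations. -/

/-- The data of a (generalized) Haar shift of parameters `(m, n)`. For `Q'` and `R'` occurring
below a common cube `Q` of the grid, `inner Q' R'` is the function `h^{Q'}_{R'}` (a generalized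
Haar function on `R'`, paired with the input) and `outer Q' R'` is the function `h^{R'}_{Q'}`
(a generalized Haar function on `Q'`, carrying the output). The cube `Q` is determined
by `Q'`, hence is not an index. -/
structure HaarShift (𝕜 : Type*) [RCLike 𝕜] (d : ℕ) where
  grid : Set (Cube d)
  isDyadicGrid : IsDyadicGrid grid
  m : ℕ
  n : ℕ
  inner : Cube d → Cube d → (Fin d → ℝ) → 𝕜
  outer : Cube d → Cube d → (Fin d → ℝ) → 𝕜
  inner_haar : ∀ Q ∈ grid, ∀ Q' ∈ subcubes grid m Q, ∀ R' ∈ subcubes grid n Q,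
    IsGeneralizedHaar R' (inner Q' R')
  outer_haar : ∀ Q ∈ grid, ∀ Q' ∈ subcubes grid m Q, ∀ R' ∈ subcubes grid n Q,
    IsGeneralizedHaar Q' (outer Q' R')
  normalized : ∀ Q ∈ grid, ∀ Q' ∈ subcubes grid m Q, ∀ R' ∈ subcubes grid n Q,
    (⨆ x, ‖inner Q' R' x‖ₑ) * (⨆ x, ‖outer Q' R' x‖ₑ) ≤ 1

namespace HaarShift

variable {𝕜 : Type*} [RCLike 𝕜] {d : ℕ}

/-- The complexity `κ = max (m, n)`. -/
def complexity (S : HaarShift 𝕜 d) : ℕ := max S.m S.n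

/-- The term of the shift at the cube `Q`,
`∑_{Q', R'} |Q|⁻¹ ⟨f, h^{Q'}_{R'}⟩ h^{R'}_{Q'}(x) = |Q|⁻¹ ∫_Q f(y) s_Q(x, y) dy`,
where `s_Q(x, y) = ∑_{Q', R'} h^{R'}_{Q'}(x) conj (h^{Q'}_{R'}(y))`; the sums are finite. -/
def component (S : HaarShift 𝕜 d) (Q : Cube d) (f : (Fin d → ℝ) → 𝕜) (x : Fin d → ℝ) : 𝕜 :=
  ∑ᶠ Q' ∈ subcubes S.grid S.m Q, ∑ᶠ R' ∈ subcubes S.grid S.n Q,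
    (∫ y, f y * starRingEnd 𝕜 (S.inner Q' R' y)) / ((Q.side ^ d : ℝ) : 𝕜) * S.outer Q' R' x

/-- The cubes of the grid of side length at least `ε`. -/
def largeCubes (S : HaarShift 𝕜 d) (ε : ℝ) : Set (Cube d) := {Q | Q ∈ S.grid ∧ ε ≤ Q.side}

/-- The truncation `S_ε f (x)`: the sum over the cubes `Q` of the grid with `ℓ(Q) ≥ ε`. -/
def truncation (S : HaarShift 𝕜 d) (ε : ℝ) (f : (Fin d → ℝ) → 𝕜) (x : Fin d → ℝ) : 𝕜 :=
  ∑' Q : S.largeCubes ε, S.component Q f x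

/-- The maximal truncation `S_♮ f (x) = sup_{ε > 0} |S_ε f (x)|`. -/
def maximalTruncation (S : HaarShift 𝕜 d) (f : (Fin d → ℝ) → 𝕜) (x : Fin d → ℝ) : ℝ≥0∞ :=
  ⨆ (ε : ℝ) (_ : 0 < ε), ‖S.truncation ε f x‖ₑ

/-- The series of the shift defines the bounded operator `T` on `L²(ℝ^d)`: for bounded, compactly
supported `f` and `g`, `⟨S_ε f, g⟩ → ⟨T f, g⟩` as `ε → 0`. (No upper truncation is
needed: for such `f` the sum over large cubes converges absolutely.) -/
def Represents (S : HaarShift 𝕜 d)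
    (T : Lp 𝕜 2 (volume : Measure (Fin d → ℝ)) →L[𝕜] Lp 𝕜 2 (volume : Measure (Fin d → ℝ))) :
    Prop :=
  ∀ (f g : (Fin d → ℝ) → 𝕜) (hf : MemLp f 2 volume),
    MemLp f ∞ volume → HasCompactSupport f → MemLp g ∞ volume → HasCompactSupport g →
    Tendsto (fun ε : ℝ => ∫ x, S.truncation ε f x * starRingEnd 𝕜 (g x)) (𝓝[>] 0)
      (𝓝 (∫ x, T (hf.toLp f) x * starRingEnd 𝕜 (g x)))

end HaarShift

/-! Weights and their characteristics. -/

/-- A weight: a nonnegative locally integrable function on `ℝ^d`. -/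
structure IsWeight {d : ℕ} (w : (Fin d → ℝ) → ℝ) : Prop where
  locallyIntegrable : LocallyIntegrable w volume
  nonneg : ∀ᵐ x, 0 ≤ w x

/-- The measure `w dx`. -/
def weightMeasure {d : ℕ} (w : (Fin d → ℝ) → ℝ) : Measure (Fin d → ℝ) :=
  volume.withDensity fun x => ENNReal.ofReal (w x)

/-- The maximal function over centred cubes,
`M g (x) = sup_{t > 0} (2t)^{-d} ∫_{[-t, t]^d} g (x + y) dy`, for nonnegative `g`. -/
def cubeMaximal {d : ℕ} (g : (Fin d → ℝ) → ℝ≥0∞) (x : Fin d → ℝ) : ℝ≥0∞ :=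
  ⨆ (t : ℝ) (_ : 0 < t),
    (∫⁻ y in Set.Icc (fun i => x i - t) (fun i => x i + t), g y) / ENNReal.ofReal ((2 * t) ^ d)

/-- The characteristic `‖w‖_{A_∞} = sup_Q w(Q)⁻¹ ∫_Q M (w 1_Q) dx`, over all cubes `Q`; a cube with
`w(Q) = 0` contributes `0 / 0 = 0`. -/
def aInfty {d : ℕ} (w : (Fin d → ℝ) → ℝ) : ℝ≥0∞ :=
  ⨆ Q : Cube d,
    (∫⁻ x in Q.toSet, cubeMaximal (Q.toSet.indicator fun y => ENNReal.ofReal (w y)) x) /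
      weightMeasure w Q.toSet

/-- The two-weight characteristic
`[w, σ]_{A_p} = sup_Q (w(Q)/|Q|)^{1/p} (σ(Q)/|Q|)^{1/p'}`, over all cubes `Q`. -/
def twoWeightAp {d : ℕ} (p : ℝ) (w σ : (Fin d → ℝ) → ℝ) : ℝ≥0∞ :=
  ⨆ Q : Cube d,
    (weightMeasure w Q.toSet / volume Q.toSet) ^ (1 / p) *
      (weightMeasure σ Q.toSet / volume Q.toSet) ^ (1 / p.conjExponent)

end

/-!
The proof is by sparse domination, entirely inside the dyadic grid of the shift.

*Sparse operators.* For a finite sparse family of cubes `𝒮`, the operator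
`h ↦ ∑_{Q ∈ 𝒮} 1_Q |Q|⁻¹ ∫_Q h dσ` is bounded from `L^p(σ)` to `L^p(w)` by a constant times
`[w, σ]_{A_p} (‖w‖_{A_∞}^{1/p'} + ‖σ‖_{A_∞}^{1/p})` (`sparseOp_bound`). By duality this is an
estimate for the form `∑_Q F_Q G_Q σ(Q) w(Q) / |Q|`, where `F_Q` and `G_Q` are weighted averages.
The cubes are sorted by the dyadic size of the local characteristic `[w, σ]_Q`, and each class is
regrouped around the cubes at which the running maximum of `F` or of `G` jumps to a new power of two
(`sum_form_le`). Below such a cube the sum of `σ w / |Q|` is controlled by Hölder's inequality and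
sparseness (`sum_subset_le`); along the record cubes of `F` one has the Carleson embedding
`sum_record_le`, and the `A_∞` characteristics enter through the Carleson condition
`carleson_of_isSparse`.

*The shift on bounded functions.* If `f` is bounded and supported in a cube `Q₀` of the grid, then
comparing `T f` with `T (f 1_Q)` on a small cube inside `Q` gives a Cotlar type inequality for the
partial sums of the shift (`HaarShift.enorm_partialSum_le_of_bounded`).

*Weak type and sparse domination.* The Calderón–Zygmund decomposition
(`HaarShift.exists_goodPart`) and the Cotlar inequality show that on at least half of a cube `Q` all
partial sums are at most `C ⟨|F|⟩_Q` (`HaarShift.volume_exceptional_le`). The constant `C` is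
exponential in the complexity. Selecting the maximal cubes on which this fails, and iterating, yields
a sparse family which dominates the partial sums (`HaarShift.exists_sparse_domination`).

*Large cubes.* The cubes of the grid that contain a given cube `Q₀` form a chain, and a chain is
itself sparse. Hence the sum of the averages over all ancestors of `Q₀`, which dominates the part of
the shift coming from cubes larger than `Q₀`, obeys the same bound
(`HaarShift.SparseBound.tailAvg_rpow_mul_le`). This gives the absolute convergence and the estimate
on `Q₀` uniformly in `Q₀`; it extends by monotone convergence to the union of the ancestors of `Q₀`,
and by summation over these disjoint unions to the whole space.
-/

/-! ### Geometry of cubes -/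

namespace Cube

variable {d : ℕ}

lemma toSet_eq_pi (Q : Cube d) :
    Q.toSet = Set.univ.pi fun i => Set.Ico (Q.corner i) (Q.corner i + Q.side) := by
  ext x; simp [toSet]

lemma measurableSet_toSet (Q : Cube d) : MeasurableSet Q.toSet := by
  rw [toSet_eq_pi]
  exact MeasurableSet.univ_pi fun i => measurableSet_Ico

lemma volume_toSet (Q : Cube d) : volume Q.toSet = ENNReal.ofReal Q.side ^ d := by
  rw [toSet_eq_pi, volume_pi_pi]
  simp [Real.volume_Ico]

lemma corner_mem (Q : Cube d) : Q.corner ∈ Q.toSet := by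
  intro i
  have := Q.side_pos
  simp [this]

lemma volume_ne_zero (Q : Cube d) : volume Q.toSet ≠ 0 := by
  rw [volume_toSet]
  exact pow_ne_zero _ (by simpa using Q.side_pos)

lemma volume_ne_top (Q : Cube d) : volume Q.toSet ≠ ∞ := by
  rw [volume_toSet]
  exact ENNReal.pow_ne_top ENNReal.ofReal_ne_top

lemma subset_Icc (Q : Cube d) :
    Q.toSet ⊆ Set.Icc Q.corner (fun i => Q.corner i + Q.side) := by
  intro x hx
  exact ⟨fun i => (hx i).1, fun i => (hx i).2.le⟩

lemma corner_le_and_le_of_subset {Q Q' : Cube d} (h : Q.toSet ⊆ Q'.toSet) (i : Fin d) :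
    Q'.corner i ≤ Q.corner i ∧ Q.corner i + Q.side ≤ Q'.corner i + Q'.side := by
  refine ⟨(h Q.corner_mem i).1, ?_⟩
  by_contra! hlt
  -- test the inclusion at a point of `Q` whose `i`-th coordinate is almost maximal
  have hs := Q.side_pos
  set t := max (Q.corner i) (Q'.corner i + Q'.side) with ht
  have hmem : Function.update Q.corner i t ∈ Q.toSet := by
    intro j
    by_cases hj : j = i
    · subst hj
      simp only [Function.update_self, Set.mem_Ico]
      exact ⟨le_max_left _ _, max_lt (by linarith) hlt⟩
    · simp [Function.update_of_ne hj, hs]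
  have := (h hmem i).2
  simp only [Function.update_self] at this
  exact absurd (le_max_right (Q.corner i) (Q'.corner i + Q'.side)) (not_le.2 this)

lemma side_le_of_subset (hd : 0 < d) {Q Q' : Cube d} (h : Q.toSet ⊆ Q'.toSet) :
    Q.side ≤ Q'.side := by
  have := corner_le_and_le_of_subset h ⟨0, hd⟩
  linarith

lemma eq_of_toSet_eq (hd : 0 < d) {Q Q' : Cube d} (h : Q.toSet = Q'.toSet) : Q = Q' := by
  have h1 := corner_le_and_le_of_subset h.subset
  have h2 := corner_le_and_le_of_subset h.symm.subset
  have hs : Q.side = Q'.side :=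
    le_antisymm (side_le_of_subset hd h.subset) (side_le_of_subset hd h.symm.subset)
  have hc : Q.corner = Q'.corner := funext fun i => le_antisymm (h2 i).1 (h1 i).1
  cases Q; cases Q'; simp_all

lemma child_subset (Q : Cube d) (e : Fin d → Bool) : (Q.child e).toSet ⊆ Q.toSet := by
  intro x hx i
  have := hx i
  have hs := Q.side_pos
  simp only [child, Set.mem_Ico] at this ⊢
  split_ifs at this <;> constructor <;> linarith

lemma exists_mem_child (Q : Cube d) {x : Fin d → ℝ} (hx : x ∈ Q.toSet) :
    ∃ e, x ∈ (Q.child e).toSet := by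
  refine ⟨fun i => decide (Q.corner i + Q.side / 2 ≤ x i), fun i => ?_⟩
  have := hx i
  simp only [child, Set.mem_Ico, decide_eq_true_eq] at this ⊢
  split_ifs with h <;> constructor <;> linarith

@[simp] lemma child_side (Q : Cube d) (e : Fin d → Bool) : (Q.child e).side = Q.side / 2 := rfl

end Cube

/-! ### Dyadic grids -/

namespace IsDyadicGrid

variable {d : ℕ} {D : Set (Cube d)}

lemma eq_of_mem_of_side_eq (h : IsDyadicGrid D) {Q Q' : Cube d} (hQ : Q ∈ D) (hQ' : Q' ∈ D)
    (hs : Q.side = Q'.side) {x : Fin d → ℝ} (hx : x ∈ Q.toSet) (hx' : x ∈ Q'.toSet) : Q = Q' :=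
  (h.partition Q hQ x).unique ⟨hQ, rfl, hx⟩ ⟨hQ', hs.symm, hx'⟩

lemma subset_of_side_le (hd : 0 < d) (h : IsDyadicGrid D) {Q Q' : Cube d} (hQ : Q ∈ D)
    (hQ' : Q' ∈ D) (hs : Q.side ≤ Q'.side) {x : Fin d → ℝ} (hx : x ∈ Q.toSet)
    (hx' : x ∈ Q'.toSet) : Q.toSet ⊆ Q'.toSet := by
  rcases h.nested Q hQ Q' hQ' with h0 | h0 | h0
  · exact absurd (show x ∈ Q.toSet ∩ Q'.toSet from ⟨hx, hx'⟩) (by simp [h0])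
  · exact Set.inter_eq_left.1 h0
  · have hsub := Set.inter_eq_right.1 h0
    have := le_antisymm hs (Cube.side_le_of_subset hd hsub)
    rw [h.eq_of_mem_of_side_eq hQ hQ' this hx hx']

lemma side_lt_of_ssubset (hd : 0 < d) (h : IsDyadicGrid D) {Q Q' : Cube d} (hQ : Q ∈ D)
    (hQ' : Q' ∈ D) (hs : Q.toSet ⊂ Q'.toSet) : Q.side < Q'.side := by
  refine lt_of_le_of_ne (Cube.side_le_of_subset hd hs.subset) fun he => ?_
  rw [h.eq_of_mem_of_side_eq hQ hQ' he Q.corner_mem (hs.subset Q.corner_mem)] at hs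
  exact hs.ne rfl

/-- Consecutive scales of a grid differ by a factor at least two: a cube strictly between a cube
and one of its children would contain two neighbouring children. -/
lemma side_le_half (hd : 0 < d) (h : IsDyadicGrid D) {Q Q' : Cube d} (hQ : Q ∈ D)
    (hQ' : Q' ∈ D) {x : Fin d → ℝ} (hx : x ∈ Q.toSet) (hx' : x ∈ Q'.toSet)
    (hs : Q.side < Q'.side) : Q.side ≤ Q'.side / 2 := by
  by_contra! hlt
  have hsub := h.subset_of_side_le hd hQ hQ' hs.le hx hx'
  obtain ⟨e, he⟩ := Q'.exists_mem_child hx'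
  have hC := h.child_mem Q' hQ' e
  have hCQ : (Q'.child e).toSet ⊆ Q.toSet :=
    h.subset_of_side_le hd hC hQ (by simpa using hlt.le) he hx
  have key : ∀ e', (Q'.child e').toSet ⊆ Q.toSet → ∀ i,
      Q.corner i ≤ (Q'.child e').corner i ∧
        (Q'.child e').corner i + Q'.side / 2 ≤ Q.corner i + Q.side := by
    intro e' h' i
    simpa using Cube.corner_le_and_le_of_subset h' i
  obtain ⟨y, hyQ, hyC⟩ : ∃ y ∈ Q.toSet, y ∉ (Q'.child e).toSet := by
    by_contra! hcon
    have := Cube.side_le_of_subset hd (show Q.toSet ⊆ (Q'.child e).toSet from hcon)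
    simp at this; linarith
  obtain ⟨e', he'⟩ := Q'.exists_mem_child (hsub hyQ)
  have hCQ' : (Q'.child e').toSet ⊆ Q.toSet :=
    h.subset_of_side_le hd (h.child_mem Q' hQ' e') hQ (by simpa using hlt.le) he' hyQ
  obtain ⟨i, hi⟩ : ∃ i, e i ≠ e' i := by
    by_contra! hcon
    exact hyC ((funext hcon : e = e') ▸ he')
  have k1 := key e hCQ i
  have k2 := key e' hCQ' i
  simp only [Cube.child] at k1 k2
  cases h1 : e i <;> cases h2 : e' i <;> simp_all <;> linarith

lemma exists_subcubes (hd : 0 < d) (h : IsDyadicGrid D) {Q Q' : Cube d} (hQ : Q ∈ D)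
    (hQ' : Q' ∈ D) {x : Fin d → ℝ} (hx : x ∈ Q.toSet) (hx' : x ∈ Q'.toSet)
    (hs : Q.side ≤ Q'.side) : ∃ k, Q ∈ subcubes D k Q' := by
  have key : ∀ n : ℕ, ∀ R ∈ D, x ∈ R.toSet → Q.side ≤ R.side → R.side / 2 ^ n < Q.side →
      ∃ k, Q.side = R.side / 2 ^ k := by
    intro n
    induction n with
    | zero => intro R _ _ h1 h2; simp at h2; linarith
    | succ n ih =>
      intro R hR hxR h1 h2
      rcases h1.eq_or_lt with he | hlt
      · exact ⟨0, by simp [he]⟩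
      · have h3 := h.side_le_half hd hQ hR hx hxR hlt
        obtain ⟨e, he⟩ := R.exists_mem_child hxR
        obtain ⟨k, hk⟩ := ih _ (h.child_mem R hR e) he (by simpa using h3)
          (by rw [pow_succ] at h2; rw [Cube.child_side, div_div, mul_comm]; exact h2)
        exact ⟨k + 1, by rw [hk, Cube.child_side, div_div, pow_succ, mul_comm]⟩
  obtain ⟨n, hn⟩ := pow_unbounded_of_one_lt (Q'.side / Q.side) (one_lt_two (α := ℝ))
  obtain ⟨k, hk⟩ := key n Q' hQ' hx' hs (by
    rw [div_lt_iff₀ Q.side_pos] at hn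
    rw [div_lt_iff₀ (by positivity), mul_comm]; exact hn)
  exact ⟨k, hQ, h.subset_of_side_le hd hQ hQ' hs hx hx', hk⟩

lemma exists_subcubes_mem (h : IsDyadicGrid D) {Q : Cube d} (hQ : Q ∈ D)
    {x : Fin d → ℝ} (hx : x ∈ Q.toSet) (k : ℕ) : ∃ R ∈ subcubes D k Q, x ∈ R.toSet := by
  induction k with
  | zero => exact ⟨Q, ⟨hQ, subset_rfl, by simp⟩, hx⟩
  | succ k ih =>
    obtain ⟨R, hR, hxR⟩ := ih
    obtain ⟨e, he⟩ := R.exists_mem_child hxR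
    exact ⟨R.child e, ⟨h.child_mem R hR.1 e, (R.child_subset e).trans hR.2.1, by
      rw [Cube.child_side, hR.2.2, pow_succ, div_div]⟩, he⟩

lemma subcubes_eq (h : IsDyadicGrid D) {Q R R' : Cube d} {k : ℕ} (hR : R ∈ subcubes D k Q)
    (hR' : R' ∈ subcubes D k Q) {x : Fin d → ℝ} (hx : x ∈ R.toSet) (hx' : x ∈ R'.toSet) :
    R = R' :=
  h.eq_of_mem_of_side_eq hR.1 hR'.1 (hR.2.2.trans hR'.2.2.symm) hx hx'

lemma subcubes_succ_subset (h : IsDyadicGrid D) {Q R : Cube d} (hQ : Q ∈ D) {k : ℕ}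
    (hR : R ∈ subcubes D (k + 1) Q) : ∃ R' ∈ subcubes D k Q, ∃ e, R = R'.child e := by
  obtain ⟨R', hR', hx⟩ := h.exists_subcubes_mem hQ (hR.2.1 R.corner_mem) k
  obtain ⟨e, he⟩ := R'.exists_mem_child hx
  refine ⟨R', hR', e, h.eq_of_mem_of_side_eq hR.1 (h.child_mem _ hR'.1 e) ?_ R.corner_mem he⟩
  rw [Cube.child_side, hR.2.2, hR'.2.2, pow_succ, div_div]

lemma finite_subcubes (h : IsDyadicGrid D) {Q : Cube d} (hQ : Q ∈ D) (k : ℕ) :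
    (subcubes D k Q).Finite := by
  induction k with
  | zero =>
    refine (Set.finite_singleton Q).subset fun R hR => ?_
    exact h.eq_of_mem_of_side_eq hR.1 hQ (by simpa using hR.2.2) R.corner_mem
      (hR.2.1 R.corner_mem)
  | succ k ih =>
    refine (Set.Finite.biUnion ih fun R _ => Set.finite_range R.child).subset fun R hR => ?_
    obtain ⟨R', hR', e, rfl⟩ := h.subcubes_succ_subset hQ hR
    exact Set.mem_biUnion hR' ⟨e, rfl⟩

lemma subcubes_trans {Q R P : Cube d} {j k : ℕ} (hR : R ∈ subcubes D j Q)
    (hP : P ∈ subcubes D k R) : P ∈ subcubes D (j + k) Q :=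
  ⟨hP.1, hP.2.1.trans hR.2.1, by rw [hP.2.2, hR.2.2, pow_add, div_div]⟩

lemma self_mem_subcubes {Q : Cube d} (hQ : Q ∈ D) : Q ∈ subcubes D 0 Q :=
  ⟨hQ, subset_rfl, by simp⟩

lemma subcubes_of_le (hd : 0 < d) (h : IsDyadicGrid D) {Q R P : Cube d} {j k : ℕ}
    (hR : R ∈ subcubes D j Q) (hP : P ∈ subcubes D (j + k) Q) {x : Fin d → ℝ}
    (hxR : x ∈ R.toSet) (hxP : x ∈ P.toSet) : P ∈ subcubes D k R := by
  have hs : P.side = R.side / 2 ^ k := by rw [hP.2.2, hR.2.2, pow_add, div_div]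
  refine ⟨hP.1, h.subset_of_side_le hd hP.1 hR.1 ?_ hxP hxR, hs⟩
  rw [hs]
  exact div_le_self R.side_pos.le (one_le_pow₀ (by norm_num))

lemma subcubes_index_unique {Q R : Cube d} {j k : ℕ} (hj : R ∈ subcubes D j Q)
    (hk : R ∈ subcubes D k Q) : j = k := by
  have h1 := hj.2.2.symm.trans hk.2.2
  have hq := Q.side_pos
  rw [div_eq_div_iff (by positivity) (by positivity)] at h1
  have := mul_left_cancel₀ hq.ne' h1
  exact (pow_right_injective₀ (by norm_num : (0:ℝ) < 2) (by norm_num) this).symm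

lemma volume_subcubes {Q R : Cube d} {k : ℕ} (hR : R ∈ subcubes D k Q) :
    volume Q.toSet = (2 ^ (k * d) : ℝ≥0∞) * volume R.toSet := by
  have h2 : Q.side = 2 ^ k * R.side := by rw [hR.2.2]; field_simp
  rw [Cube.volume_toSet, Cube.volume_toSet, h2, ENNReal.ofReal_mul (by positivity), mul_pow,
    ENNReal.ofReal_pow (by norm_num), ← pow_mul]
  simp

lemma countable_of_side_eq (h : IsDyadicGrid D) (s : ℝ) : {Q | Q ∈ D ∧ Q.side = s}.Countable := by
  refine Set.PairwiseDisjoint.countable_of_nonempty_interior (s := Cube.toSet) ?_ ?_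
  · intro Q hQ Q' hQ' hne
    refine Set.disjoint_left.2 fun x hx hx' => hne ?_
    exact h.eq_of_mem_of_side_eq hQ.1 hQ'.1 (hQ.2.trans hQ'.2.symm) hx hx'
  · intro Q _
    refine ⟨fun i => Q.corner i + Q.side / 2, mem_interior.2
      ⟨Set.univ.pi fun i => Set.Ioo (Q.corner i) (Q.corner i + Q.side), ?_, ?_, ?_⟩⟩
    · rw [Cube.toSet_eq_pi]
      exact Set.pi_mono fun i _ => Set.Ioo_subset_Ico_self
    · exact isOpen_set_pi Set.finite_univ fun i _ => isOpen_Ioo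
    · have := Q.side_pos
      simp [this]

end IsDyadicGrid

/-! ### Sums over finite nested families -/

/-- A finite family of cubes any two of which are disjoint or comparable. -/
def IsNested {d : ℕ} (𝒮 : Finset (Cube d)) : Prop :=
  ∀ Q ∈ 𝒮, ∀ Q' ∈ 𝒮, ∀ x, x ∈ Q.toSet → x ∈ Q'.toSet →
    Q.toSet ⊆ Q'.toSet ∨ Q'.toSet ⊆ Q.toSet

lemma IsNested.mono {d : ℕ} {𝒮 𝒯 : Finset (Cube d)} (h : IsNested 𝒮) (hT : 𝒯 ⊆ 𝒮) :
    IsNested 𝒯 := fun Q hQ Q' hQ' => h Q (hT hQ) Q' (hT hQ')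

lemma IsDyadicGrid.isNested {d : ℕ} {D : Set (Cube d)} (hd : 0 < d) (h : IsDyadicGrid D)
    {𝒮 : Finset (Cube d)} (h𝒮 : ∀ Q ∈ 𝒮, Q ∈ D) : IsNested 𝒮 := by
  intro Q hQ Q' hQ' x hx hx'
  rcases le_total Q.side Q'.side with hs | hs
  · exact Or.inl (h.subset_of_side_le hd (h𝒮 Q hQ) (h𝒮 Q' hQ') hs hx hx')
  · exact Or.inr (h.subset_of_side_le hd (h𝒮 Q' hQ') (h𝒮 Q hQ) hs hx' hx)

open Classical in
/-- Sparseness: inside each cube of the family, the strictly smaller ones cover at most half of the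
volume. -/
def IsSparse {d : ℕ} (𝒮 : Finset (Cube d)) : Prop :=
  ∀ Q ∈ 𝒮, 2 * volume (⋃ Q' ∈ 𝒮.filter (fun Q' => Q'.toSet ⊂ Q.toSet), Q'.toSet) ≤
    volume Q.toSet

open Classical in
lemma IsSparse.mono {d : ℕ} {𝒮 𝒯 : Finset (Cube d)} (h : IsSparse 𝒮) (hT : 𝒯 ⊆ 𝒮) :
    IsSparse 𝒯 := by
  intro Q hQ
  refine le_trans ?_ (h Q (hT hQ))
  gcongr 2 * volume ?_
  exact Set.biUnion_subset_biUnion_left fun P hP =>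
    Finset.mem_filter.2 ⟨hT (Finset.mem_filter.1 hP).1, (Finset.mem_filter.1 hP).2⟩

/-- Hölder's inequality for three finite sequences. -/
lemma sum_rpow_mul_le {ι : Type*} (𝒯 : Finset ι) (v w s : ι → ℝ) {η a b : ℝ}
    (hη : 0 < η) (ha : 0 < a) (hb : 0 < b) (hab : η + a + b = 1)
    (hv : ∀ i ∈ 𝒯, 0 < v i) (hw : ∀ i ∈ 𝒯, 0 < w i) (hs : ∀ i ∈ 𝒯, 0 < s i) :
    ∑ i ∈ 𝒯, v i ^ η * w i ^ a * s i ^ b ≤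
      (∑ i ∈ 𝒯, v i) ^ η * (∑ i ∈ 𝒯, w i) ^ a * (∑ i ∈ 𝒯, s i) ^ b := by
  rcases 𝒯.eq_empty_or_nonempty with rfl | hne
  · simp [Real.zero_rpow hη.ne']
  set X := ∑ i ∈ 𝒯, v i
  set Y := ∑ i ∈ 𝒯, w i
  set Z := ∑ i ∈ 𝒯, s i
  have hX : 0 < X := Finset.sum_pos hv hne
  have hY : 0 < Y := Finset.sum_pos hw hne
  have hZ : 0 < Z := Finset.sum_pos hs hne
  have key : ∀ i ∈ 𝒯, v i ^ η * w i ^ a * s i ^ b ≤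
      X ^ η * Y ^ a * Z ^ b * (η * (v i / X) + a * (w i / Y) + b * (s i / Z)) := by
    intro i hi
    have h1 := hv i hi
    have h2 := hw i hi
    have h3 := hs i hi
    have := Real.geom_mean_le_arith_mean3_weighted hη.le ha.le hb.le
      (div_pos h1 hX).le (div_pos h2 hY).le (div_pos h3 hZ).le hab
    rw [Real.div_rpow h1.le hX.le, Real.div_rpow h2.le hY.le, Real.div_rpow h3.le hZ.le] at this
    calc v i ^ η * w i ^ a * s i ^ b
        = X ^ η * Y ^ a * Z ^ b * (v i ^ η / X ^ η * (w i ^ a / Y ^ a) * (s i ^ b / Z ^ b)) := by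
          field_simp
      _ ≤ _ := by gcongr
  refine (Finset.sum_le_sum key).trans ?_
  rw [← Finset.mul_sum, Finset.sum_add_distrib, Finset.sum_add_distrib, ← Finset.mul_sum,
    ← Finset.mul_sum, ← Finset.mul_sum, ← Finset.sum_div, ← Finset.sum_div, ← Finset.sum_div,
    div_self hX.ne', div_self hY.ne', div_self hZ.ne', mul_one, mul_one, mul_one, hab, mul_one]

open Classical in
/-- In a nested family whose members lose a fixed proportion of the volume `v` from one generation
to the next, the quantity `v ^ η * w ^ a * s ^ b` with `η + a + b = 1` sums like a geometric
series. -/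
lemma sum_subset_le {d : ℕ} (𝒮 : Finset (Cube d)) (hn : IsNested 𝒮)
    (v w s : Cube d → ℝ) {η a b : ℝ} (hη : 0 < η) (ha : 0 < a) (hb : 0 < b) (hab : η + a + b = 1)
    (hv : ∀ i ∈ 𝒮, 0 < v i) (hw : ∀ i ∈ 𝒮, 0 < w i) (hs : ∀ i ∈ 𝒮, 0 < s i)
    (hvs : ∀ G ∈ 𝒮, ∀ 𝒯 ⊆ 𝒮, (∀ Q ∈ 𝒯, Q.toSet ⊂ G.toSet) →
      (𝒯 : Set (Cube d)).PairwiseDisjoint Cube.toSet → ∑ Q ∈ 𝒯, v Q ≤ v G / 2)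
    (hws : ∀ G ∈ 𝒮, ∀ 𝒯 ⊆ 𝒮, (∀ Q ∈ 𝒯, Q.toSet ⊂ G.toSet) →
      (𝒯 : Set (Cube d)).PairwiseDisjoint Cube.toSet → ∑ Q ∈ 𝒯, w Q ≤ w G)
    (hss : ∀ G ∈ 𝒮, ∀ 𝒯 ⊆ 𝒮, (∀ Q ∈ 𝒯, Q.toSet ⊂ G.toSet) →
      (𝒯 : Set (Cube d)).PairwiseDisjoint Cube.toSet → ∑ Q ∈ 𝒯, s Q ≤ s G)
    (hd : 0 < d) (G : Cube d) (hG : G ∈ 𝒮) :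
    ∑ Q ∈ 𝒮.filter (fun Q => Q.toSet ⊆ G.toSet), v Q ^ η * w Q ^ a * s Q ^ b ≤
      (1 - (1 / 2) ^ η)⁻¹ * (v G ^ η * w G ^ a * s G ^ b) := by
  set r : ℝ := (1 / 2) ^ η with hr
  have hr1 : r < 1 := Real.rpow_lt_one (by norm_num) (by norm_num) hη
  set φ : Cube d → ℝ := fun Q => v Q ^ η * w Q ^ a * s Q ^ b with hφ
  have hφpos : ∀ Q ∈ 𝒮, 0 < φ Q := fun Q hQ => by
    have := hv Q hQ; have := hw Q hQ; have := hs Q hQ; positivity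
  have hC : 0 < (1 - r)⁻¹ := by rw [inv_pos]; linarith
  induction hN : (𝒮.filter (fun Q => Q.toSet ⊂ G.toSet)).card using Nat.strong_induction_on
    generalizing G with
  | _ N ih =>
  set T := 𝒮.filter (fun Q => Q.toSet ⊂ G.toSet) with hT
  set M := T.filter (fun P => ∀ P' ∈ T, P.toSet ⊆ P'.toSet → P = P') with hM
  have hMS : M ⊆ 𝒮 := (Finset.filter_subset _ _).trans (Finset.filter_subset _ _)
  have hMG : ∀ Q ∈ M, Q.toSet ⊂ G.toSet := fun Q hQ =>
    (Finset.mem_filter.1 (Finset.mem_filter.1 hQ).1).2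
  have hMd : (M : Set (Cube d)).PairwiseDisjoint Cube.toSet := by
    intro P hP P' hP' hne
    refine Set.disjoint_left.2 fun x hx hx' => hne ?_
    have h1 := Finset.mem_filter.1 hP
    have h2 := Finset.mem_filter.1 hP'
    rcases hn P (hMS hP) P' (hMS hP') x hx hx' with h | h
    · exact h1.2 P' h2.1 h
    · exact (h2.2 P h1.1 h).symm
  have hcover : T ⊆ M.biUnion fun P => 𝒮.filter (fun Q => Q.toSet ⊆ P.toSet) := by
    intro Q hQ
    obtain ⟨P, hP, hmax⟩ := Finset.exists_max_image
      (T.filter fun P => Q.toSet ⊆ P.toSet) Cube.side ⟨Q, by simp [hQ]⟩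
    rw [Finset.mem_filter] at hP
    refine Finset.mem_biUnion.2 ⟨P, Finset.mem_filter.2 ⟨hP.1, fun P' hP' hsub => ?_⟩,
      Finset.mem_filter.2 ⟨(Finset.mem_filter.1 hQ).1, hP.2⟩⟩
    have hle := hmax P' (Finset.mem_filter.2 ⟨hP', hP.2.trans hsub⟩)
    refine Cube.eq_of_toSet_eq hd (subset_antisymm hsub ?_)
    intro x hx
    have hc := Cube.corner_le_and_le_of_subset hsub
    intro i
    have := hx i
    have h1 := (hc i)
    have h2 : P'.side = P.side := le_antisymm hle (Cube.side_le_of_subset hd hsub)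
    constructor <;> linarith [this.1, this.2]
  have hstep : ∑ Q ∈ T, φ Q ≤ (1 - r)⁻¹ * (r * φ G) := by
    calc ∑ Q ∈ T, φ Q
        ≤ ∑ Q ∈ M.biUnion fun P => 𝒮.filter (fun Q => Q.toSet ⊆ P.toSet), φ Q := by
          refine Finset.sum_le_sum_of_subset_of_nonneg hcover fun Q hQ _ => ?_
          obtain ⟨P, -, hP⟩ := Finset.mem_biUnion.1 hQ
          exact (hφpos Q (Finset.mem_filter.1 hP).1).le
      _ ≤ ∑ P ∈ M, ∑ Q ∈ 𝒮.filter (fun Q => Q.toSet ⊆ P.toSet), φ Q := by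
          rw [Finset.sum_biUnion]
          intro P hP P' hP' hne
          refine Finset.disjoint_left.2 fun Q hQ hQ' => ?_
          refine Set.disjoint_left.1 (hMd hP hP' hne)
            ((Finset.mem_filter.1 hQ).2 Q.corner_mem) ((Finset.mem_filter.1 hQ').2 Q.corner_mem)
      _ ≤ ∑ P ∈ M, (1 - r)⁻¹ * φ P := by
          refine Finset.sum_le_sum fun P hP => ?_
          refine ih _ ?_ P (hMS hP) rfl
          rw [← hN]
          refine Finset.card_lt_card (Finset.ssubset_iff_subset_ne.2 ⟨fun Q hQ => ?_, fun he => ?_⟩)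
          · rw [Finset.mem_filter] at hQ ⊢
            exact ⟨hQ.1, hQ.2.trans (hMG P hP)⟩
          · have : P ∈ T := (Finset.mem_filter.1 hP).1
            rw [← he] at this
            exact (Finset.mem_filter.1 this).2.ne rfl
      _ = (1 - r)⁻¹ * ∑ P ∈ M, φ P := by rw [Finset.mul_sum]
      _ ≤ (1 - r)⁻¹ * ((v G / 2) ^ η * w G ^ a * s G ^ b) := by
          gcongr
          refine (sum_rpow_mul_le M v w s hη ha hb hab (fun i hi => hv i (hMS hi))
            (fun i hi => hw i (hMS hi)) (fun i hi => hs i (hMS hi))).trans ?_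
          have h1 : 0 ≤ ∑ i ∈ M, v i := Finset.sum_nonneg fun i hi => (hv i (hMS hi)).le
          have h2 : 0 ≤ ∑ i ∈ M, w i := Finset.sum_nonneg fun i hi => (hw i (hMS hi)).le
          have h3 : 0 ≤ ∑ i ∈ M, s i := Finset.sum_nonneg fun i hi => (hs i (hMS hi)).le
          have h4 := hv G hG
          have h5 := hw G hG
          have h6 := hs G hG
          gcongr
          · exact hvs G hG M hMS hMG hMd
          · exact hws G hG M hMS hMG hMd
          · exact hss G hG M hMS hMG hMd
      _ = (1 - r)⁻¹ * (r * φ G) := by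
          rw [hφ, hr, div_eq_mul_one_div (v G) 2,
            Real.mul_rpow (hv G hG).le (by norm_num)]
          ring
  have hfil : 𝒮.filter (fun Q => Q.toSet ⊆ G.toSet) ⊆ insert G T := by
    intro Q hQ
    rw [Finset.mem_filter] at hQ
    rw [Finset.mem_insert, hT, Finset.mem_filter]
    by_cases h : Q.toSet = G.toSet
    · exact Or.inl (Cube.eq_of_toSet_eq hd h)
    · exact Or.inr ⟨hQ.1, LE.le.ssubset_of_ne hQ.2 h⟩
  calc ∑ Q ∈ 𝒮.filter (fun Q => Q.toSet ⊆ G.toSet), φ Q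
      ≤ ∑ Q ∈ insert G T, φ Q := by
        refine Finset.sum_le_sum_of_subset_of_nonneg hfil fun Q hQ _ => ?_
        rcases Finset.mem_insert.1 hQ with rfl | hQ
        · exact (hφpos _ hG).le
        · exact (hφpos Q (Finset.mem_filter.1 hQ).1).le
    _ ≤ φ G + ∑ Q ∈ T, φ Q := by
        rw [Finset.sum_insert (by simp [hT])]
    _ ≤ φ G + (1 - r)⁻¹ * (r * φ G) := by gcongr
    _ = (1 - r)⁻¹ * φ G := by
        have : (1 - r) ≠ 0 := by linarith
        field_simp
        ring

open Classical in
/-- The bilinear estimate behind the sparse bound. With `i` and `j` the running maxima of the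
dyadic levels of `F` and `G` along chains, the cubes at which `(i, j)` changes are new records for
`F` or for `G`. Over the records of `F` the sum of `F` against `s` is at most `Cf` without loss, and
only the sum of `G` against `w` costs the Carleson constant `Aw`; over the records of `G` the roles
are exchanged, which is why `As` and `Aw` enter additively. -/
lemma sum_mul_mul_le {d : ℕ} (hd : 0 < d) (𝒮 : Finset (Cube d)) (hn : IsNested 𝒮)
    (v w s F G : Cube d → ℝ) {α β B As Aw Cf Cg : ℝ} (hα : 0 < α) (hβ : 0 < β) (hαβ : α + β = 1)
    (hv : ∀ Q ∈ 𝒮, 0 < v Q) (hw : ∀ Q ∈ 𝒮, 0 < w Q) (hs : ∀ Q ∈ 𝒮, 0 < s Q)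
    (hFp : ∀ Q ∈ 𝒮, 0 < F Q) (hGp : ∀ Q ∈ 𝒮, 0 < G Q)
    (hB0 : 0 ≤ B) (hAs0 : 0 ≤ As) (hAw0 : 0 ≤ Aw) (hCf0 : 0 ≤ Cf) (hCg0 : 0 ≤ Cg)
    (hB : ∀ H ∈ 𝒮, ∑ Q ∈ 𝒮.filter (fun Q => Q.toSet ⊆ H.toSet), s Q * w Q / v Q ≤
      B * (s H ^ α * w H ^ β))
    (hsA : ∀ H ∈ 𝒮, ∑ Q ∈ 𝒮.filter (fun Q => Q.toSet ⊆ H.toSet), s Q ≤ As * s H)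
    (hwA : ∀ H ∈ 𝒮, ∑ Q ∈ 𝒮.filter (fun Q => Q.toSet ⊆ H.toSet), w Q ≤ Aw * w H)
    (hF : ∀ 𝒯 ⊆ 𝒮, (∀ Q ∈ 𝒯, ∀ Q' ∈ 𝒯, Q.toSet ⊂ Q'.toSet →
      ⌊Real.logb 2 (F Q')⌋ < ⌊Real.logb 2 (F Q)⌋) → ∑ Q ∈ 𝒯, F Q ^ α⁻¹ * s Q ≤ Cf)
    (hG : ∀ 𝒯 ⊆ 𝒮, (∀ Q ∈ 𝒯, ∀ Q' ∈ 𝒯, Q.toSet ⊂ Q'.toSet →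
      ⌊Real.logb 2 (G Q')⌋ < ⌊Real.logb 2 (G Q)⌋) → ∑ Q ∈ 𝒯, G Q ^ β⁻¹ * w Q ≤ Cg) :
    ∑ Q ∈ 𝒮, F Q * G Q * (s Q * w Q / v Q) ≤
      4 * B * (As ^ α + Aw ^ β) * (Cf ^ α * Cg ^ β) := by
  -- the running maximum of a level function along the chain of larger cubes
  have hmax : ∀ lev : Cube d → ℤ, ∃ i : Cube d → ℤ, ∀ Q ∈ 𝒮,
      (∃ Q' ∈ 𝒮, Q.toSet ⊆ Q'.toSet ∧ lev Q' = i Q) ∧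
        ∀ Q' ∈ 𝒮, Q.toSet ⊆ Q'.toSet → lev Q' ≤ i Q := by
    intro lev
    have : ∀ Q, ∃ z : ℤ, Q ∈ 𝒮 → (∃ Q' ∈ 𝒮, Q.toSet ⊆ Q'.toSet ∧ lev Q' = z) ∧
        ∀ Q' ∈ 𝒮, Q.toSet ⊆ Q'.toSet → lev Q' ≤ z := by
      intro Q
      by_cases hQ : Q ∈ 𝒮
      · obtain ⟨P, hP, hm⟩ := Finset.exists_max_image
          (𝒮.filter fun P => Q.toSet ⊆ P.toSet) lev ⟨Q, by simp [hQ]⟩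
        rw [Finset.mem_filter] at hP
        exact ⟨lev P, fun _ => ⟨⟨P, hP.1, hP.2, rfl⟩, fun Q' h1 h2 =>
          hm Q' (Finset.mem_filter.2 ⟨h1, h2⟩)⟩⟩
      · exact ⟨0, fun h => absurd h hQ⟩
    choose i hi using this
    exact ⟨i, hi⟩
  have hmono : ∀ {lev i : Cube d → ℤ}, (∀ Q ∈ 𝒮,
      (∃ Q' ∈ 𝒮, Q.toSet ⊆ Q'.toSet ∧ lev Q' = i Q) ∧
        ∀ Q' ∈ 𝒮, Q.toSet ⊆ Q'.toSet → lev Q' ≤ i Q) →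
      ∀ Q ∈ 𝒮, ∀ Q' ∈ 𝒮, Q.toSet ⊆ Q'.toSet → i Q' ≤ i Q := by
    intro lev i hi Q hQ Q' hQ' hsub
    obtain ⟨P, hP, hsP, he⟩ := (hi Q' hQ').1
    rw [← he]
    exact (hi Q hQ).2 P hP (hsub.trans hsP)
  -- every cube lies below a largest cube with the same value of a given function
  have htop : ∀ {X : Type} (i : Cube d → X), ∀ Q ∈ 𝒮, ∃ H ∈ 𝒮, Q.toSet ⊆ H.toSet ∧ i H = i Q ∧
      ∀ H' ∈ 𝒮, H.toSet ⊂ H'.toSet → i H' ≠ i H := by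
    intro X i Q hQ
    obtain ⟨P, hP, hm⟩ := Finset.exists_max_image
      (𝒮.filter fun P => Q.toSet ⊆ P.toSet ∧ i P = i Q) Cube.side ⟨Q, by simp [hQ]⟩
    rw [Finset.mem_filter] at hP
    refine ⟨P, hP.1, hP.2.1, hP.2.2, fun H' hH' hss he => ?_⟩
    have hle := hm H' (Finset.mem_filter.2 ⟨hH', hP.2.1.trans hss.subset, he.trans hP.2.2⟩)
    refine hss.2 fun x hx k => ?_
    have hc := Cube.corner_le_and_le_of_subset hss.subset k
    have h2 : H'.side = P.side := le_antisymm hle (Cube.side_le_of_subset hd hss.subset)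
    have := hx k
    constructor <;> linarith [this.1, this.2]
  -- records: the level at a record is attained at the record itself
  have hrec : ∀ {lev i : Cube d → ℤ}, (∀ Q ∈ 𝒮,
      (∃ Q' ∈ 𝒮, Q.toSet ⊆ Q'.toSet ∧ lev Q' = i Q) ∧
        ∀ Q' ∈ 𝒮, Q.toSet ⊆ Q'.toSet → lev Q' ≤ i Q) →
      ∀ H ∈ 𝒮, (∀ H' ∈ 𝒮, H.toSet ⊂ H'.toSet → i H' ≠ i H) → lev H = i H := by
    intro lev i hi H hH hr
    obtain ⟨P, hP, hsP, he⟩ := (hi H hH).1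
    by_cases hPH : P.toSet = H.toSet
    · rw [← Cube.eq_of_toSet_eq hd hPH]; rw [he, Cube.eq_of_toSet_eq hd hPH]
    · exfalso
      refine hr P hP (LE.le.ssubset_of_ne hsP (Ne.symm hPH)) (le_antisymm ?_ ?_)
      · exact hmono hi H hH P hP hsP
      · rw [← he]; exact (hi P hP).2 P hP subset_rfl
  obtain ⟨i, hi⟩ := hmax fun Q => ⌊Real.logb 2 (F Q)⌋
  obtain ⟨j, hj⟩ := hmax fun Q => ⌊Real.logb 2 (G Q)⌋
  have hlow : ∀ x : ℝ, 0 < x → (2 : ℝ) ^ ((⌊Real.logb 2 x⌋ : ℤ) : ℝ) ≤ x := by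
    intro x hx
    calc (2 : ℝ) ^ ((⌊Real.logb 2 x⌋ : ℤ) : ℝ) ≤ 2 ^ Real.logb 2 x :=
          Real.rpow_le_rpow_of_exponent_le (by norm_num) (Int.floor_le _)
      _ = x := Real.rpow_logb (by norm_num) (by norm_num) hx
  have hupp : ∀ (x : ℝ) (z : ℤ), 0 < x → ⌊Real.logb 2 x⌋ ≤ z → x ≤ 2 * (2 : ℝ) ^ (z : ℝ) := by
    intro x z hx hz
    have hz' : (⌊Real.logb 2 x⌋ : ℝ) ≤ z := by exact_mod_cast hz
    calc x = 2 ^ Real.logb 2 x := (Real.rpow_logb (by norm_num) (by norm_num) hx).symm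
      _ ≤ 2 ^ (1 + (z : ℝ)) := by
          refine Real.rpow_le_rpow_of_exponent_le (by norm_num) ?_
          linarith [Int.lt_floor_add_one (Real.logb 2 x)]
      _ = _ := by rw [Real.rpow_add (by norm_num), Real.rpow_one]
  set f' : Cube d → ℝ := fun Q => (2 : ℝ) ^ (i Q : ℝ) with hf'
  set g' : Cube d → ℝ := fun Q => (2 : ℝ) ^ (j Q : ℝ) with hg'
  have hf0 : ∀ Q, 0 < f' Q := fun Q => by positivity
  have hg0 : ∀ Q, 0 < g' Q := fun Q => by positivity
  set 𝒢 := 𝒮.filter fun H => ∀ H' ∈ 𝒮, H.toSet ⊂ H'.toSet → (i H', j H') ≠ (i H, j H) with h𝒢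
  set 𝒢f := 𝒮.filter fun H => ∀ H' ∈ 𝒮, H.toSet ⊂ H'.toSet → i H' ≠ i H with h𝒢f
  set 𝒢g := 𝒮.filter fun H => ∀ H' ∈ 𝒮, H.toSet ⊂ H'.toSet → j H' ≠ j H with h𝒢g
  have hsub : 𝒢 ⊆ 𝒢f ∪ 𝒢g := by
    intro H hH
    rw [h𝒢, Finset.mem_filter] at hH
    rw [Finset.mem_union, h𝒢f, h𝒢g, Finset.mem_filter, Finset.mem_filter]
    by_contra! hcon
    obtain ⟨P, hP, hHP, hiP⟩ := hcon.1 hH.1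
    obtain ⟨P', hP', hHP', hjP'⟩ := hcon.2 hH.1
    have hc := H.corner_mem
    rcases hn P hP P' hP' _ (hHP.subset hc) (hHP'.subset hc) with h | h
    · refine hH.2 P hP hHP (Prod.ext hiP (le_antisymm (hmono hj H hH.1 P hP hHP.subset) ?_))
      exact hjP' ▸ hmono hj P hP P' hP' h
    · refine hH.2 P' hP' hHP' (Prod.ext (le_antisymm (hmono hi H hH.1 P' hP' hHP'.subset) ?_) hjP')
      exact hiP ▸ hmono hi P' hP' P hP h
  -- summing a function over all cubes by grouping below the cubes where the label changes
  have hgroup : ∀ {X : Type} (k : Cube d → X) (c t : Cube d → ℝ),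
      (∀ Q ∈ 𝒮, ∀ Q' ∈ 𝒮, k Q = k Q' → c Q = c Q') → (∀ Q ∈ 𝒮, 0 ≤ c Q) → (∀ Q ∈ 𝒮, 0 ≤ t Q) →
      ∑ Q ∈ 𝒮, c Q * t Q ≤
        ∑ H ∈ 𝒮.filter (fun H => ∀ H' ∈ 𝒮, H.toSet ⊂ H'.toSet → k H' ≠ k H),
          c H * ∑ Q ∈ 𝒮.filter (fun Q => Q.toSet ⊆ H.toSet), t Q := by
    intro X k c t hc hc0 ht0
    set 𝒰 := 𝒮.filter (fun H => ∀ H' ∈ 𝒮, H.toSet ⊂ H'.toSet → k H' ≠ k H)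
    have h1 : ∀ Q ∈ 𝒮, c Q * t Q ≤ ∑ H ∈ 𝒰, if Q.toSet ⊆ H.toSet then c H * t Q else 0 := by
      intro Q hQ
      obtain ⟨H, hH, hQH, hk, hr⟩ := htop k Q hQ
      have hHU : H ∈ 𝒰 := Finset.mem_filter.2 ⟨hH, hr⟩
      refine le_trans ?_ (Finset.single_le_sum (f := fun H =>
        if Q.toSet ⊆ H.toSet then c H * t Q else 0) (fun H' hH' => ?_) hHU)
      · simp only [hQH, if_true]
        rw [hc Q hQ H hH hk.symm]
      · have h2 := hc0 H' (Finset.mem_filter.1 hH').1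
        have h3 := ht0 Q hQ
        split_ifs
        · positivity
        · exact le_rfl
    refine (Finset.sum_le_sum h1).trans ?_
    rw [Finset.sum_comm]
    refine Finset.sum_le_sum fun H _ => ?_
    rw [Finset.mul_sum, Finset.sum_filter]
  -- Carleson embedding for one function with labels from its own records
  have hcarl : ∀ (z : Cube d → ℤ) (t : Cube d → ℝ) (a A C : ℝ), 0 < a → 0 ≤ A →
      (∀ Q ∈ 𝒮, 0 < t Q) →
      (∀ H ∈ 𝒮, ∑ Q ∈ 𝒮.filter (fun Q => Q.toSet ⊆ H.toSet), t Q ≤ A * t H) →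
      (∑ H ∈ 𝒮.filter (fun H => ∀ H' ∈ 𝒮, H.toSet ⊂ H'.toSet → z H' ≠ z H),
        ((2 : ℝ) ^ (z H : ℝ)) ^ a⁻¹ * t H ≤ C) →
      ∑ Q ∈ 𝒮, ((2 : ℝ) ^ (z Q : ℝ)) ^ a⁻¹ * t Q ≤ A * C := by
    intro z t a A C _ hA ht hAt hC
    have h1 := hgroup z (fun Q => ((2 : ℝ) ^ (z Q : ℝ)) ^ a⁻¹) t
      (fun Q _ Q' _ h => by simp only [h]) (fun Q _ => by positivity) (fun Q hQ => (ht Q hQ).le)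
    refine le_trans ?_ (mul_le_mul_of_nonneg_left hC hA)
    refine le_trans (h1.trans_eq (by congr!)) (?_ : ∑ H ∈ 𝒮.filter (fun H => ∀ H' ∈ 𝒮,
      H.toSet ⊂ H'.toSet → z H' ≠ z H), ((2 : ℝ) ^ (z H : ℝ)) ^ a⁻¹ *
        ∑ Q ∈ 𝒮.filter (fun Q => Q.toSet ⊆ H.toSet), t Q ≤ _)
    rw [Finset.mul_sum]
    refine Finset.sum_le_sum fun H hH => ?_
    have := hAt H (Finset.mem_filter.1 hH).1
    calc ((2 : ℝ) ^ (z H : ℝ)) ^ a⁻¹ * ∑ Q ∈ 𝒮.filter (fun Q => Q.toSet ⊆ H.toSet), t Q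
        ≤ ((2 : ℝ) ^ (z H : ℝ)) ^ a⁻¹ * (A * t H) := by gcongr
      _ = _ := by ring
  have hrecsum : ∀ {lev z : Cube d → ℤ} {t Φ : Cube d → ℝ} {a C : ℝ}, 0 < a →
      (∀ Q ∈ 𝒮, 0 < t Q) → (∀ Q ∈ 𝒮, 0 < Φ Q) → (∀ Q, lev Q = ⌊Real.logb 2 (Φ Q)⌋) →
      (∀ Q ∈ 𝒮, (∃ Q' ∈ 𝒮, Q.toSet ⊆ Q'.toSet ∧ lev Q' = z Q) ∧
        ∀ Q' ∈ 𝒮, Q.toSet ⊆ Q'.toSet → lev Q' ≤ z Q) →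
      (∀ 𝒯 ⊆ 𝒮, (∀ Q ∈ 𝒯, ∀ Q' ∈ 𝒯, Q.toSet ⊂ Q'.toSet →
        ⌊Real.logb 2 (Φ Q')⌋ < ⌊Real.logb 2 (Φ Q)⌋) → ∑ Q ∈ 𝒯, Φ Q ^ a⁻¹ * t Q ≤ C) →
      ∑ H ∈ 𝒮.filter (fun H => ∀ H' ∈ 𝒮, H.toSet ⊂ H'.toSet → z H' ≠ z H),
        ((2 : ℝ) ^ (z H : ℝ)) ^ a⁻¹ * t H ≤ C := by
    intro lev z t Φ a C ha ht hΦ hlev hz hC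
    set 𝒰 := 𝒮.filter (fun H => ∀ H' ∈ 𝒮, H.toSet ⊂ H'.toSet → z H' ≠ z H)
    have hU : ∀ Q ∈ 𝒰, Q ∈ 𝒮 := fun Q hQ => (Finset.mem_filter.1 hQ).1
    have hU' : ∀ Q ∈ 𝒰, lev Q = z Q := fun Q hQ =>
      hrec hz Q (hU Q hQ) (Finset.mem_filter.1 hQ).2
    refine le_trans (Finset.sum_le_sum fun H hH => ?_) (hC 𝒰 hU fun Q hQ Q' hQ' hss => ?_)
    · have h1 := ht H (hU H hH)
      have h2 := hΦ H (hU H hH)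
      gcongr
      rw [← hU' H hH, hlev]
      exact hlow _ h2
    · rw [← hlev, ← hlev, hU' Q hQ, hU' Q' hQ']
      exact lt_of_le_of_ne (hmono hz Q (hU Q hQ) Q' (hU Q' hQ') hss.subset)
        ((Finset.mem_filter.1 hQ).2 Q' (hU Q' hQ') hss)
  have hfrec : ∑ H ∈ 𝒢f, f' H ^ α⁻¹ * s H ≤ Cf :=
    hrecsum (lev := fun Q => ⌊Real.logb 2 (F Q)⌋) (z := i) (t := s) (Φ := F) hα hs hFp
      (fun _ => rfl) hi hF
  have hgrec : ∑ H ∈ 𝒢g, g' H ^ β⁻¹ * w H ≤ Cg :=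
    hrecsum (lev := fun Q => ⌊Real.logb 2 (G Q)⌋) (z := j) (t := w) (Φ := G) hβ hw hGp
      (fun _ => rfl) hj hG
  have hfall : ∑ Q ∈ 𝒮, f' Q ^ α⁻¹ * s Q ≤ As * Cf := hcarl i s α As Cf hα hAs0 hs hsA hfrec
  have hgall : ∑ Q ∈ 𝒮, g' Q ^ β⁻¹ * w Q ≤ Aw * Cg := hcarl j w β Aw Cg hβ hAw0 hw hwA hgrec
  have hconj : α⁻¹.HolderConjugate β⁻¹ := by
    rw [Real.holderConjugate_iff]
    refine ⟨(one_lt_inv₀ hα).2 (by linarith), by simpa using hαβ⟩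
  have hholder : ∀ 𝒯 ⊆ 𝒮, ∀ X Y : ℝ, ∑ Q ∈ 𝒯, f' Q ^ α⁻¹ * s Q ≤ X →
      ∑ Q ∈ 𝒯, g' Q ^ β⁻¹ * w Q ≤ Y →
      ∑ H ∈ 𝒯, f' H * g' H * (s H ^ α * w H ^ β) ≤ X ^ α * Y ^ β := by
    intro 𝒯 h𝒯 X Y hX hY
    have hs' : ∀ Q ∈ 𝒯, 0 < s Q := fun Q hQ => hs Q (h𝒯 hQ)
    have hw' : ∀ Q ∈ 𝒯, 0 < w Q := fun Q hQ => hw Q (h𝒯 hQ)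
    have := Real.inner_le_Lp_mul_Lq_of_nonneg 𝒯 hconj (f := fun H => f' H * s H ^ α)
      (g := fun H => g' H * w H ^ β)
      (fun Q hQ => by have := hs' Q hQ; have := hf0 Q; positivity)
      (fun Q hQ => by have := hw' Q hQ; have := hg0 Q; positivity)
    have e1 : ∑ Q ∈ 𝒯, (f' Q * s Q ^ α) ^ α⁻¹ = ∑ Q ∈ 𝒯, f' Q ^ α⁻¹ * s Q := by
      refine Finset.sum_congr rfl fun Q hQ => ?_
      rw [Real.mul_rpow (hf0 Q).le (by have := hs' Q hQ; positivity),
        Real.rpow_rpow_inv (hs' Q hQ).le hα.ne']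
    have e2 : ∑ Q ∈ 𝒯, (g' Q * w Q ^ β) ^ β⁻¹ = ∑ Q ∈ 𝒯, g' Q ^ β⁻¹ * w Q := by
      refine Finset.sum_congr rfl fun Q hQ => ?_
      rw [Real.mul_rpow (hg0 Q).le (by have := hw' Q hQ; positivity),
        Real.rpow_rpow_inv (hw' Q hQ).le hβ.ne']
    rw [e1, e2] at this
    simp only [one_div, inv_inv] at this
    calc ∑ H ∈ 𝒯, f' H * g' H * (s H ^ α * w H ^ β)
        = ∑ H ∈ 𝒯, f' H * s H ^ α * (g' H * w H ^ β) :=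
          Finset.sum_congr rfl fun Q _ => by ring
      _ ≤ _ := this
      _ ≤ _ := by
          have h1 : 0 ≤ ∑ Q ∈ 𝒯, f' Q ^ α⁻¹ * s Q := Finset.sum_nonneg fun Q hQ => by
            have := hs' Q hQ; have := hf0 Q; positivity
          have h2 : 0 ≤ ∑ Q ∈ 𝒯, g' Q ^ β⁻¹ * w Q := Finset.sum_nonneg fun Q hQ => by
            have := hw' Q hQ; have := hg0 Q; positivity
          have h3 : 0 ≤ X := h1.trans hX
          gcongr
  have hmon : ∀ 𝒯 ⊆ 𝒮, ∀ t : Cube d → ℝ, (∀ Q ∈ 𝒮, 0 ≤ t Q) →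
      ∑ Q ∈ 𝒯, t Q ≤ ∑ Q ∈ 𝒮, t Q := fun 𝒯 h𝒯 t ht =>
    Finset.sum_le_sum_of_subset_of_nonneg h𝒯 fun Q hQ _ => ht Q hQ
  calc ∑ Q ∈ 𝒮, F Q * G Q * (s Q * w Q / v Q)
      ≤ ∑ Q ∈ 𝒮, 4 * (f' Q * g' Q * (s Q * w Q / v Q)) := by
        refine Finset.sum_le_sum fun Q hQ => ?_
        have h1 := hs Q hQ
        have h2 := hw Q hQ
        have h3 := hv Q hQ
        have h4 := hupp (F Q) (i Q) (hFp Q hQ) ((hi Q hQ).2 Q hQ subset_rfl)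
        have h5 := hupp (G Q) (j Q) (hGp Q hQ) ((hj Q hQ).2 Q hQ subset_rfl)
        calc F Q * G Q * (s Q * w Q / v Q) ≤ (2 * f' Q) * (2 * g' Q) * (s Q * w Q / v Q) := by
              have := hGp Q hQ
              have := hf0 Q
              gcongr
          _ = _ := by ring
    _ = 4 * ∑ Q ∈ 𝒮, f' Q * g' Q * (s Q * w Q / v Q) := by rw [Finset.mul_sum]
    _ ≤ 4 * ∑ H ∈ 𝒢, f' H * g' H * ∑ Q ∈ 𝒮.filter (fun Q => Q.toSet ⊆ H.toSet),
          s Q * w Q / v Q := by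
        gcongr
        refine (hgroup (fun Q => (i Q, j Q)) (fun Q => f' Q * g' Q)
          (fun Q => s Q * w Q / v Q) ?_ ?_ ?_).trans_eq (by rw [h𝒢]; congr!)
        · intro Q _ Q' _ h
          simp only [Prod.mk.injEq] at h
          simp only [hf', hg', h.1, h.2]
        · intro Q _; exact (mul_pos (hf0 Q) (hg0 Q)).le
        · intro Q hQ
          have h1 := hs Q hQ
          have h2 := hw Q hQ
          have h3 := hv Q hQ
          positivity
    _ ≤ 4 * ∑ H ∈ 𝒢, f' H * g' H * (B * (s H ^ α * w H ^ β)) := by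
        gcongr with H hH
        exact hB H (Finset.mem_filter.1 hH).1
    _ = 4 * B * ∑ H ∈ 𝒢, f' H * g' H * (s H ^ α * w H ^ β) := by
        rw [Finset.mul_sum, Finset.mul_sum]
        exact Finset.sum_congr rfl fun Q _ => by ring
    _ ≤ 4 * B * (∑ H ∈ 𝒢f, f' H * g' H * (s H ^ α * w H ^ β) +
          ∑ H ∈ 𝒢g, f' H * g' H * (s H ^ α * w H ^ β)) := by
        have hnn : ∀ H ∈ 𝒢f ∪ 𝒢g, 0 ≤ f' H * g' H * (s H ^ α * w H ^ β) := by
          intro H hH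
          have hH' : H ∈ 𝒮 := by
            rcases Finset.mem_union.1 hH with h | h <;> exact (Finset.mem_filter.1 h).1
          have h1 := hs H hH'
          have h2 := hw H hH'
          have h3 := hf0 H
          have h4 := hg0 H
          positivity
        gcongr
        refine (Finset.sum_le_sum_of_subset_of_nonneg hsub fun Q hQ _ => hnn Q hQ).trans ?_
        rw [← Finset.sum_union_inter]
        refine le_add_of_nonneg_right (Finset.sum_nonneg fun Q hQ => hnn Q ?_)
        exact Finset.mem_union_left _ (Finset.mem_inter.1 hQ).1
    _ ≤ 4 * B * (Cf ^ α * (Aw * Cg) ^ β + (As * Cf) ^ α * Cg ^ β) := by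
        gcongr
        · refine hholder 𝒢f (Finset.filter_subset _ _) _ _ hfrec (le_trans ?_ hgall)
          exact hmon _ (Finset.filter_subset _ _) _ fun Q hQ => by
            have := hw Q hQ; have := hg0 Q; positivity
        · refine hholder 𝒢g (Finset.filter_subset _ _) _ _ (le_trans ?_ hfall) hgrec
          exact hmon _ (Finset.filter_subset _ _) _ fun Q hQ => by
            have := hs Q hQ; have := hf0 Q; positivity
    _ = 4 * B * (As ^ α + Aw ^ β) * (Cf ^ α * Cg ^ β) := by
        rw [Real.mul_rpow hAs0 hCf0, Real.mul_rpow hAw0 hCg0]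
        ring

open Classical in
/-- The bilinear sparse form under a two-weight condition with constant `K`. The family is
split according to the size of the local characteristic; where that is about `κ`, one has
`s * w / v ≲ κ ^ (1 + η) * v ^ η * w ^ a * s ^ b` with `η + a + b = 1`, which sums geometrically. -/
lemma sum_form_le {d : ℕ} (hd : 0 < d) (𝒮 : Finset (Cube d)) (hn : IsNested 𝒮)
    (v w s F G : Cube d → ℝ) {α β K As Aw Cf Cg : ℝ} (hα : 0 < α) (hβ : 0 < β) (hαβ : α + β = 1)
    (hv : ∀ Q ∈ 𝒮, 0 < v Q) (hw : ∀ Q ∈ 𝒮, 0 < w Q) (hs : ∀ Q ∈ 𝒮, 0 < s Q)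
    (hFp : ∀ Q ∈ 𝒮, 0 < F Q) (hGp : ∀ Q ∈ 𝒮, 0 < G Q)
    (hK0 : 0 ≤ K) (hAs0 : 0 ≤ As) (hAw0 : 0 ≤ Aw) (hCf0 : 0 ≤ Cf) (hCg0 : 0 ≤ Cg)
    (hK : ∀ Q ∈ 𝒮, (w Q / v Q) ^ α * (s Q / v Q) ^ β ≤ K)
    (hvs : ∀ G ∈ 𝒮, ∀ 𝒯 ⊆ 𝒮, (∀ Q ∈ 𝒯, Q.toSet ⊂ G.toSet) →
      (𝒯 : Set (Cube d)).PairwiseDisjoint Cube.toSet → ∑ Q ∈ 𝒯, v Q ≤ v G / 2)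
    (hws : ∀ G ∈ 𝒮, ∀ 𝒯 ⊆ 𝒮, (∀ Q ∈ 𝒯, Q.toSet ⊂ G.toSet) →
      (𝒯 : Set (Cube d)).PairwiseDisjoint Cube.toSet → ∑ Q ∈ 𝒯, w Q ≤ w G)
    (hss : ∀ G ∈ 𝒮, ∀ 𝒯 ⊆ 𝒮, (∀ Q ∈ 𝒯, Q.toSet ⊂ G.toSet) →
      (𝒯 : Set (Cube d)).PairwiseDisjoint Cube.toSet → ∑ Q ∈ 𝒯, s Q ≤ s G)
    (hsA : ∀ H ∈ 𝒮, ∑ Q ∈ 𝒮.filter (fun Q => Q.toSet ⊆ H.toSet), s Q ≤ As * s H)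
    (hwA : ∀ H ∈ 𝒮, ∑ Q ∈ 𝒮.filter (fun Q => Q.toSet ⊆ H.toSet), w Q ≤ Aw * w H)
    (hF : ∀ 𝒯 ⊆ 𝒮, (∀ Q ∈ 𝒯, ∀ Q' ∈ 𝒯, Q.toSet ⊂ Q'.toSet →
      ⌊Real.logb 2 (F Q')⌋ < ⌊Real.logb 2 (F Q)⌋) → ∑ Q ∈ 𝒯, F Q ^ α⁻¹ * s Q ≤ Cf)
    (hG : ∀ 𝒯 ⊆ 𝒮, (∀ Q ∈ 𝒯, ∀ Q' ∈ 𝒯, Q.toSet ⊂ Q'.toSet →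
      ⌊Real.logb 2 (G Q')⌋ < ⌊Real.logb 2 (G Q)⌋) → ∑ Q ∈ 𝒯, G Q ^ β⁻¹ * w Q ≤ Cg) :
    ∑ Q ∈ 𝒮, F Q * G Q * (s Q * w Q / v Q) ≤
      16 * (1 - (1 / 2) ^ (α * β))⁻¹ * K * (As ^ α + Aw ^ β) * (Cf ^ α * Cg ^ β) := by
  set η := α * β with hη
  have hη0 : 0 < η := mul_pos hα hβ
  have hα1 : α < 1 := by linarith
  have hβ1 : β < 1 := by linarith
  have hη1 : η ≤ 1 := by nlinarith
  -- the exponents for which `s w / v = k ^ (1 + η) v ^ η w ^ a s ^ b` with `η + a + b = 1`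
  set a := β - α * η with ha
  set b := α - β * η with hb
  have ha0 : 0 < a := by
    have : a = β * (1 - α * α) := by rw [ha, hη]; ring
    rw [this]; exact mul_pos hβ (by nlinarith)
  have hb0 : 0 < b := by
    have : b = α * (1 - β * β) := by rw [hb, hη]; ring
    rw [this]; exact mul_pos hα (by nlinarith)
  have hsum : η + a + b = 1 := by
    rw [ha, hb]; linear_combination (1 - η) * hαβ
  have hr1 : (1 / 2 : ℝ) ^ η < 1 := Real.rpow_lt_one (by norm_num) (by norm_num) hη0
  set C1 : ℝ := (1 - (1 / 2) ^ η)⁻¹ with hC1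
  have hC10 : 0 < C1 := by rw [hC1, inv_pos]; linarith
  set k : Cube d → ℝ := fun Q => (w Q / v Q) ^ α * (s Q / v Q) ^ β with hk
  have hk0 : ∀ Q ∈ 𝒮, 0 < k Q := fun Q hQ => by
    have := hv Q hQ; have := hw Q hQ; have := hs Q hQ; positivity
  have hid1 : ∀ Q ∈ 𝒮, s Q * w Q / v Q = k Q ^ (1 + η) * (v Q ^ η * w Q ^ a * s Q ^ b) := by
    intro Q hQ
    have h1 := hv Q hQ
    have h2 := hw Q hQ
    have h3 := hs Q hQ
    have e : Real.log (s Q * w Q / v Q) =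
        Real.log (k Q ^ (1 + η) * (v Q ^ η * w Q ^ a * s Q ^ b)) := by
      rw [Real.log_div (by positivity) (by positivity), Real.log_mul (by positivity)
        (by positivity), Real.log_mul (Real.rpow_pos_of_pos (hk0 Q hQ) _).ne' (by positivity),
        Real.log_rpow (hk0 Q hQ), hk, Real.log_mul (by positivity) (by positivity),
        Real.log_mul (by positivity) (by positivity), Real.log_mul (by positivity)
        (by positivity), Real.log_rpow (by positivity), Real.log_rpow (by positivity),
        Real.log_rpow h1, Real.log_rpow h2, Real.log_rpow h3,
        Real.log_div (by positivity) (by positivity),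
        Real.log_div (by positivity) (by positivity), ha, hb]
      have hβ' : β = 1 - α := by linarith
      rw [hη, hβ']
      ring
    exact Real.log_injOn_pos (Set.mem_Ioi.2 (by positivity))
      (Set.mem_Ioi.2 (by have := hk0 Q hQ; positivity)) e
  have hid2 : ∀ Q ∈ 𝒮, v Q ^ η * w Q ^ a * s Q ^ b * k Q ^ η = s Q ^ α * w Q ^ β := by
    intro Q hQ
    have h1 := hv Q hQ
    have h2 := hw Q hQ
    have h3 := hs Q hQ
    have h4 := hk0 Q hQ
    refine Real.log_injOn_pos (Set.mem_Ioi.2 (by positivity)) (Set.mem_Ioi.2 (by positivity)) ?_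
    rw [Real.log_mul (by positivity) (by positivity), Real.log_rpow h4, hk,
      Real.log_mul (by positivity) (by positivity), Real.log_mul (by positivity) (by positivity),
      Real.log_mul (by positivity) (by positivity), Real.log_mul (by positivity) (by positivity),
      Real.log_rpow h1, Real.log_rpow h2, Real.log_rpow h3, Real.log_rpow h2, Real.log_rpow h3,
      Real.log_rpow (by positivity), Real.log_rpow (by positivity), Real.log_div (by positivity) (by positivity),
      Real.log_div (by positivity) (by positivity), ha, hb]
    have hβ' : β = 1 - α := by linarith
    rw [hη, hβ']
    ring
  set Z := (As ^ α + Aw ^ β) * (Cf ^ α * Cg ^ β) with hZ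
  have hZ0 : 0 ≤ Z := by positivity
  have hlevel : ∀ κ : ℝ, 0 < κ → ∀ 𝒰 ⊆ 𝒮, (∀ Q ∈ 𝒰, κ / 2 ≤ k Q ∧ k Q ≤ κ) →
      ∑ Q ∈ 𝒰, F Q * G Q * (s Q * w Q / v Q) ≤ 8 * C1 * κ * Z := by
    intro κ hκ 𝒰 h𝒰 hkU
    have hfs : ∀ H : Cube d, 𝒰.filter (fun Q => Q.toSet ⊆ H.toSet) ⊆
        𝒮.filter (fun Q => Q.toSet ⊆ H.toSet) := fun H => Finset.filter_subset_filter _ h𝒰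
    have h2η : (2 : ℝ) ^ η ≤ 2 := by
      calc (2 : ℝ) ^ η ≤ 2 ^ (1 : ℝ) := Real.rpow_le_rpow_of_exponent_le (by norm_num) hη1
        _ = 2 := Real.rpow_one 2
    have := sum_mul_mul_le hd 𝒰 (hn.mono h𝒰) v w s F G (B := 2 * C1 * κ) hα hβ hαβ
      (fun Q hQ => hv Q (h𝒰 hQ)) (fun Q hQ => hw Q (h𝒰 hQ)) (fun Q hQ => hs Q (h𝒰 hQ))
      (fun Q hQ => hFp Q (h𝒰 hQ)) (fun Q hQ => hGp Q (h𝒰 hQ)) (by positivity) hAs0 hAw0 hCf0 hCg0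
      ?_ (fun H hH => (Finset.sum_le_sum_of_subset_of_nonneg (hfs H)
        fun Q hQ _ => (hs Q (Finset.mem_filter.1 hQ).1).le).trans (hsA H (h𝒰 hH)))
      (fun H hH => (Finset.sum_le_sum_of_subset_of_nonneg (hfs H)
        fun Q hQ _ => (hw Q (Finset.mem_filter.1 hQ).1).le).trans (hwA H (h𝒰 hH)))
      (fun 𝒯 h𝒯 => hF 𝒯 (h𝒯.trans h𝒰)) (fun 𝒯 h𝒯 => hG 𝒯 (h𝒯.trans h𝒰))
    · refine this.trans_eq ?_
      rw [hZ]; ring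
    · intro H hH
      have hHS := h𝒰 hH
      have h1 := hv H hHS
      have h2 := hw H hHS
      have h3 := hs H hHS
      have h4 := hk0 H hHS
      have hsl := sum_subset_le 𝒰 (hn.mono h𝒰) v w s hη0 ha0 hb0 hsum
        (fun Q hQ => hv Q (h𝒰 hQ)) (fun Q hQ => hw Q (h𝒰 hQ)) (fun Q hQ => hs Q (h𝒰 hQ))
        (fun G hG 𝒯 h𝒯 => hvs G (h𝒰 hG) 𝒯 (h𝒯.trans h𝒰))
        (fun G hG 𝒯 h𝒯 => hws G (h𝒰 hG) 𝒯 (h𝒯.trans h𝒰))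
        (fun G hG 𝒯 h𝒯 => hss G (h𝒰 hG) 𝒯 (h𝒯.trans h𝒰)) hd H hH
      calc ∑ Q ∈ 𝒰.filter (fun Q => Q.toSet ⊆ H.toSet), s Q * w Q / v Q
          ≤ ∑ Q ∈ 𝒰.filter (fun Q => Q.toSet ⊆ H.toSet),
              κ ^ (1 + η) * (v Q ^ η * w Q ^ a * s Q ^ b) := by
            refine Finset.sum_le_sum fun Q hQ => ?_
            have hQ' := (Finset.mem_filter.1 hQ).1
            rw [hid1 Q (h𝒰 hQ')]
            have h1 := hv Q (h𝒰 hQ')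
            have h2 := hw Q (h𝒰 hQ')
            have h3 := hs Q (h𝒰 hQ')
            have h4 := hk0 Q (h𝒰 hQ')
            have h5 := (hkU Q hQ').2
            gcongr
        _ ≤ κ ^ (1 + η) * (C1 * (v H ^ η * w H ^ a * s H ^ b)) := by
            rw [← Finset.mul_sum]
            gcongr
        _ = C1 * κ * (v H ^ η * w H ^ a * s H ^ b * κ ^ η) := by
            rw [Real.rpow_add hκ, Real.rpow_one]; ring
        _ ≤ C1 * κ * (v H ^ η * w H ^ a * s H ^ b * (2 * k H ^ η)) := by
            gcongr
            calc κ ^ η ≤ (2 * k H) ^ η := by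
                  have := (hkU H hH).1
                  gcongr; linarith
              _ = 2 ^ η * k H ^ η := Real.mul_rpow (by norm_num) h4.le
              _ ≤ 2 * k H ^ η := by gcongr
        _ = 2 * C1 * κ * (s H ^ α * w H ^ β) := by rw [← hid2 H hHS]; ring
  rcases 𝒮.eq_empty_or_nonempty with rfl | ⟨Q0, hQ0⟩
  · simp only [Finset.sum_empty]; positivity
  have hKpos : 0 < K := (hk0 Q0 hQ0).trans_le (hK Q0 hQ0)
  set lab : Cube d → ℕ := fun Q => ⌊Real.logb 2 (K / k Q)⌋₊ with hlab
  have hlabk : ∀ Q ∈ 𝒮, K * (1 / 2) ^ lab Q / 2 ≤ k Q ∧ k Q ≤ K * (1 / 2) ^ lab Q := by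
    intro Q hQ
    have h1 := hk0 Q hQ
    have h2 : 1 ≤ K / k Q := (one_le_div h1).2 (hK Q hQ)
    have h3 : 0 ≤ Real.logb 2 (K / k Q) := Real.logb_nonneg (by norm_num) h2
    have h4 : (2 : ℝ) ^ Real.logb 2 (K / k Q) = K / k Q :=
      Real.rpow_logb (by norm_num) (by norm_num) (by positivity)
    have h5 : (2 : ℝ) ^ lab Q ≤ K / k Q := by
      rw [← h4, ← Real.rpow_natCast]
      exact Real.rpow_le_rpow_of_exponent_le (by norm_num) (Nat.floor_le h3)
    have h6 : K / k Q ≤ 2 ^ (lab Q + 1) := by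
      rw [← h4, ← Real.rpow_natCast]
      refine Real.rpow_le_rpow_of_exponent_le (by norm_num) ?_
      push_cast
      exact (Nat.lt_floor_add_one _).le
    rw [le_div_iff₀ h1] at h5
    rw [div_le_iff₀ h1, pow_succ] at h6
    have h7 : (1 / 2 : ℝ) ^ lab Q * 2 ^ lab Q = 1 := by rw [← mul_pow]; norm_num
    have h8 : (0 : ℝ) < (1 / 2) ^ lab Q := by positivity
    constructor
    · nlinarith [mul_le_mul_of_nonneg_left h6 h8.le]
    · nlinarith [mul_le_mul_of_nonneg_left h5 h8.le]
  calc ∑ Q ∈ 𝒮, F Q * G Q * (s Q * w Q / v Q)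
      = ∑ l ∈ 𝒮.image lab, ∑ Q ∈ 𝒮.filter (fun Q => lab Q = l),
          F Q * G Q * (s Q * w Q / v Q) :=
        (Finset.sum_fiberwise_of_maps_to (fun Q hQ => Finset.mem_image_of_mem lab hQ) _).symm
    _ ≤ ∑ l ∈ 𝒮.image lab, 8 * C1 * K * Z * (1 / 2) ^ l := by
        refine Finset.sum_le_sum fun l _ => ?_
        refine (hlevel (K * (1 / 2) ^ l) (by positivity) _ (Finset.filter_subset _ _)
          fun Q hQ => ?_).trans_eq (by ring)
        rw [Finset.mem_filter] at hQ
        rw [← hQ.2]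
        exact hlabk Q hQ.1
    _ = 8 * C1 * K * Z * ∑ l ∈ 𝒮.image lab, (1 / 2) ^ l := by rw [Finset.mul_sum]
    _ ≤ 8 * C1 * K * Z * 2 := by
        gcongr
        refine (Summable.sum_le_tsum _ (fun _ _ => by positivity)
          summable_geometric_two).trans_eq tsum_geometric_two
    _ = _ := by rw [hZ]; ring

/-- The constant of the Carleson embedding theorem for record families. -/
noncomputable def recordConst (q : ℝ) : ℝ := 2 * (4 ^ (q - 1) * (1 - (1 / 2) ^ (q - 1))⁻¹)

lemma recordConst_pos {q : ℝ} (hq : 1 < q) : 0 < recordConst q := by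
  have : (1 / 2 : ℝ) ^ (q - 1) < 1 :=
    Real.rpow_lt_one (by norm_num) (by norm_num) (by linarith)
  have h2 : 0 < (1 - (1 / 2 : ℝ) ^ (q - 1))⁻¹ := by rw [inv_pos]; linarith
  unfold recordConst
  positivity

/-- Geometric summation over positive numbers with distinct dyadic levels. -/
lemma sum_rpow_le_of_injOn {ι : Type*} (𝒯 : Finset ι) (F : ι → ℝ) {γ t : ℝ} (hγ : 0 < γ)
    (ht : 0 ≤ t) (hF : ∀ i ∈ 𝒯, 0 < F i) (hFt : ∀ i ∈ 𝒯, F i ≤ 2 * t)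
    (hinj : Set.InjOn (fun i => ⌊Real.logb 2 (F i)⌋) 𝒯) :
    ∑ i ∈ 𝒯, F i ^ γ ≤ 4 ^ γ * (1 - (1 / 2) ^ γ)⁻¹ * t ^ γ := by
  set r : ℝ := (1 / 2) ^ γ with hr
  have hr1 : r < 1 := Real.rpow_lt_one (by norm_num) (by norm_num) hγ
  have hr0 : 0 < r := by positivity
  have hC : 0 < (1 - r)⁻¹ := by rw [inv_pos]; linarith
  rcases 𝒯.eq_empty_or_nonempty with rfl | hne
  · simp only [Finset.sum_empty]; positivity
  obtain ⟨P, hP, hmax⟩ := Finset.exists_max_image 𝒯 (fun i => ⌊Real.logb 2 (F i)⌋) hne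
  set L := ⌊Real.logb 2 (F P)⌋ with hL
  set n : ι → ℕ := fun i => (L - ⌊Real.logb 2 (F i)⌋).toNat with hn
  have hnc : ∀ i ∈ 𝒯, (n i : ℝ) = L - ⌊Real.logb 2 (F i)⌋ := by
    intro i hi
    have h1 : ((n i : ℤ)) = L - ⌊Real.logb 2 (F i)⌋ := Int.toNat_of_nonneg (by
      have := hmax i hi
      omega)
    exact_mod_cast h1
  have hLP : (2 : ℝ) ^ (L : ℝ) ≤ 2 * t := by
    refine le_trans ?_ (hFt P hP)
    calc (2 : ℝ) ^ (L : ℝ) ≤ 2 ^ Real.logb 2 (F P) :=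
          Real.rpow_le_rpow_of_exponent_le (by norm_num) (Int.floor_le _)
      _ = F P := Real.rpow_logb (by norm_num) (by norm_num) (hF P hP)
  have hterm : ∀ i ∈ 𝒯, F i ^ γ ≤ 4 ^ γ * t ^ γ * r ^ n i := by
    intro i hi
    have h0 := hF i hi
    have h1 : F i ≤ 4 * t * (1 / 2) ^ (n i : ℝ) := by
      calc F i = 2 ^ Real.logb 2 (F i) := (Real.rpow_logb (by norm_num) (by norm_num) h0).symm
        _ ≤ 2 ^ (1 + (L : ℝ) - n i) := by
            refine Real.rpow_le_rpow_of_exponent_le (by norm_num) ?_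
            rw [hnc i hi]
            linarith [Int.lt_floor_add_one (Real.logb 2 (F i))]
        _ = 2 * 2 ^ (L : ℝ) * (1 / 2) ^ (n i : ℝ) := by
            rw [Real.rpow_sub (by norm_num), Real.rpow_add (by norm_num), Real.rpow_one,
              Real.div_rpow (by norm_num) (by norm_num), Real.one_rpow]
            ring
        _ ≤ 2 * (2 * t) * (1 / 2) ^ (n i : ℝ) := by gcongr
        _ = _ := by ring
    calc F i ^ γ ≤ (4 * t * (1 / 2) ^ (n i : ℝ)) ^ γ := by gcongr
      _ = 4 ^ γ * t ^ γ * r ^ n i := by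
          rw [Real.mul_rpow (by positivity) (by positivity), Real.mul_rpow (by norm_num) ht,
            ← Real.rpow_mul (by norm_num), mul_comm (n i : ℝ), Real.rpow_mul (by norm_num),
            Real.rpow_natCast]
  calc ∑ i ∈ 𝒯, F i ^ γ ≤ ∑ i ∈ 𝒯, 4 ^ γ * t ^ γ * r ^ n i := Finset.sum_le_sum hterm
    _ = 4 ^ γ * t ^ γ * ∑ l ∈ 𝒯.image n, r ^ l := by
        rw [← Finset.mul_sum, Finset.sum_image]
        intro i hi j hj hij
        refine hinj hi hj ?_
        have h1 := hnc i hi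
        have h2 := hnc j hj
        have hij' : (n i : ℝ) = n j := by exact_mod_cast hij
        have : ((⌊Real.logb 2 (F i)⌋ : ℤ) : ℝ) = ⌊Real.logb 2 (F j)⌋ := by linarith
        exact_mod_cast this
    _ ≤ 4 ^ γ * t ^ γ * (1 - r)⁻¹ := by
        gcongr
        rw [← tsum_geometric_of_lt_one hr0.le hr1]
        exact Summable.sum_le_tsum _ (fun _ _ => by positivity)
          (summable_geometric_of_lt_one hr0.le hr1)
    _ = _ := by ring

open Classical in
/-- Carleson embedding for a family along which the levels of the averages of `g` strictly
increase: only the part of `g` exceeding half of the average matters on each cube, and the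
averages at a point are summed as a geometric series. -/
lemma sum_record_le {d : ℕ} {q : ℝ} (hq : 1 < q) (w : Measure (Fin d → ℝ))
    (𝒯 : Finset (Cube d)) (hn : IsNested 𝒯) (g : (Fin d → ℝ) → ℝ≥0∞) (hg : Measurable g)
    (hw0 : ∀ Q ∈ 𝒯, w Q.toSet ≠ 0) (hwt : ∀ Q ∈ 𝒯, w Q.toSet ≠ ∞)
    (F : Cube d → ℝ) (hFp : ∀ Q ∈ 𝒯, 0 < F Q)
    (hF : ∀ Q ∈ 𝒯, ENNReal.ofReal (F Q) = (∫⁻ x in Q.toSet, g x ∂w) / w Q.toSet)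
    (hrec : ∀ Q ∈ 𝒯, ∀ Q' ∈ 𝒯, Q.toSet ⊂ Q'.toSet →
      ⌊Real.logb 2 (F Q')⌋ < ⌊Real.logb 2 (F Q)⌋) (hd : 0 < d) :
    ∑ Q ∈ 𝒯, ENNReal.ofReal (F Q ^ q) * w Q.toSet ≤
      ENNReal.ofReal (recordConst q) * ∫⁻ x, g x ^ q ∂w := by
  set γ := q - 1 with hγ
  have hγ0 : 0 < γ := by linarith
  set φ : Cube d → ℝ≥0∞ := fun Q => ENNReal.ofReal (F Q) with hφ
  -- the set where `g` exceeds half of its average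
  set U : Cube d → Set (Fin d → ℝ) := fun Q => Q.toSet ∩ {x | φ Q ≤ 2 * g x} with hU
  have hUm : ∀ Q, MeasurableSet (U Q) := fun Q =>
    Q.measurableSet_toSet.inter (measurableSet_le measurable_const (hg.const_mul 2))
  have hhalf : ∀ Q ∈ 𝒯, φ Q * w Q.toSet ≤ 2 * ∫⁻ x in U Q, g x ∂w := by
    intro Q hQ
    have h1 : φ Q * w Q.toSet = ∫⁻ x in Q.toSet, g x ∂w := by
      rw [hφ]; simp only; rw [hF Q hQ, ENNReal.div_mul_cancel (hw0 Q hQ) (hwt Q hQ)]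
    have h2 : ∫⁻ x in Q.toSet, g x ∂w ≤ φ Q / 2 * w Q.toSet + ∫⁻ x in U Q, g x ∂w := by
      calc ∫⁻ x in Q.toSet, g x ∂w
          ≤ ∫⁻ x in Q.toSet, (φ Q / 2 + (U Q).indicator g x) ∂w := by
            refine setLIntegral_mono' Q.measurableSet_toSet fun x hx => ?_
            by_cases hxU : x ∈ U Q
            · rw [Set.indicator_of_mem hxU]; exact le_add_self
            · refine le_add_right ?_
              have : ¬ φ Q ≤ 2 * g x := fun h => hxU ⟨hx, h⟩
              rw [not_le] at this
              rw [ENNReal.le_div_iff_mul_le (by simp) (by simp), mul_comm]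
              exact this.le
        _ = φ Q / 2 * w Q.toSet + ∫⁻ x in U Q, g x ∂w := by
            rw [lintegral_add_left measurable_const, setLIntegral_const,
              lintegral_indicator (hUm Q), Measure.restrict_restrict (hUm Q)]
            congr 3
            exact Set.inter_eq_left.2 Set.inter_subset_left
    rw [← h1] at h2
    have hfin : φ Q / 2 * w Q.toSet ≠ ∞ :=
      ENNReal.mul_ne_top (ENNReal.div_ne_top ENNReal.ofReal_ne_top (by simp)) (hwt Q hQ)
    have h3 : φ Q * w Q.toSet = φ Q / 2 * w Q.toSet + φ Q / 2 * w Q.toSet := by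
      rw [← add_mul, ENNReal.add_halves]
    rw [h3] at h2
    have h4 := (ENNReal.add_le_add_iff_left hfin).1 h2
    rw [h3, two_mul]
    exact add_le_add h4 h4
  have hpt : ∀ x, ∑ Q ∈ 𝒯, (U Q).indicator (fun x => ENNReal.ofReal (F Q ^ γ) * g x) x ≤
      ENNReal.ofReal (4 ^ γ * (1 - (1 / 2) ^ γ)⁻¹) * g x ^ q := by
    intro x
    have hr1 : (1 / 2 : ℝ) ^ γ < 1 := Real.rpow_lt_one (by norm_num) (by norm_num) hγ0
    have hC : 0 < 4 ^ γ * (1 - (1 / 2 : ℝ) ^ γ)⁻¹ := by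
      have : 0 < (1 - (1 / 2 : ℝ) ^ γ)⁻¹ := by rw [inv_pos]; linarith
      positivity
    by_cases hgx : g x = ∞
    · rw [hgx, ENNReal.top_rpow_of_pos (by linarith), ENNReal.mul_top (by simpa using hC)]
      exact le_top
    set 𝒰 := 𝒯.filter fun Q => x ∈ U Q with h𝒰
    have h1 : ∑ Q ∈ 𝒯, (U Q).indicator (fun x => ENNReal.ofReal (F Q ^ γ) * g x) x =
        (∑ Q ∈ 𝒰, ENNReal.ofReal (F Q ^ γ)) * g x := by
      rw [Finset.sum_mul, h𝒰, Finset.sum_filter]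
      exact Finset.sum_congr rfl fun Q _ => Set.indicator_apply _ _ _
    have hs := sum_rpow_le_of_injOn 𝒰 F hγ0 (t := (g x).toReal) ENNReal.toReal_nonneg
      (fun Q hQ => hFp Q (Finset.mem_filter.1 hQ).1) (fun Q hQ => by
        have h2 := (Finset.mem_filter.1 hQ).2.2
        simp only [Set.mem_ofPred_eq] at h2
        have := ENNReal.toReal_mono (ENNReal.mul_ne_top (by simp) hgx) h2
        rw [hφ] at this
        simpa [ENNReal.toReal_ofReal (hFp Q (Finset.mem_filter.1 hQ).1).le] using this) (by
        intro Q hQ Q' hQ' he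
        have h1 := Finset.mem_filter.1 hQ
        have h2 := Finset.mem_filter.1 hQ'
        by_contra hne
        have hne' : Q.toSet ≠ Q'.toSet := fun h => hne (Cube.eq_of_toSet_eq hd h)
        rcases hn Q h1.1 Q' h2.1 x h1.2.1 h2.2.1 with h | h
        · exact (hrec Q h1.1 Q' h2.1 (LE.le.ssubset_of_ne h hne')).ne' he
        · exact (hrec Q' h2.1 Q h1.1 (LE.le.ssubset_of_ne h hne'.symm)).ne he)
    rw [h1, ← ENNReal.ofReal_sum_of_nonneg (fun Q hQ => by
      have := hFp Q (Finset.mem_filter.1 hQ).1; positivity)]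
    calc ENNReal.ofReal (∑ Q ∈ 𝒰, F Q ^ γ) * g x
        ≤ ENNReal.ofReal (4 ^ γ * (1 - (1 / 2) ^ γ)⁻¹ * (g x).toReal ^ γ) * g x := by
          gcongr
      _ = ENNReal.ofReal (4 ^ γ * (1 - (1 / 2) ^ γ)⁻¹) * (g x ^ γ * g x) := by
          rw [ENNReal.ofReal_mul hC.le, ← ENNReal.ofReal_rpow_of_nonneg ENNReal.toReal_nonneg
            hγ0.le, ENNReal.ofReal_toReal hgx, mul_assoc]
      _ = _ := by
          congr 1
          conv_lhs => rw [← ENNReal.rpow_one (g x), ← ENNReal.rpow_mul, one_mul,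
            ← ENNReal.rpow_add_of_nonneg _ _ hγ0.le zero_le_one]
          congr 1
          rw [hγ]; ring
  calc ∑ Q ∈ 𝒯, ENNReal.ofReal (F Q ^ q) * w Q.toSet
      ≤ ∑ Q ∈ 𝒯, 2 * ∫⁻ x, (U Q).indicator (fun x => ENNReal.ofReal (F Q ^ γ) * g x) x ∂w := by
        refine Finset.sum_le_sum fun Q hQ => ?_
        have hFQ := hFp Q hQ
        rw [lintegral_indicator (hUm Q), lintegral_const_mul _ hg]
        have : F Q ^ q = F Q ^ γ * F Q := by
          conv_rhs => rw [← Real.rpow_one (F Q), ← Real.rpow_mul hFQ.le, one_mul,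
            ← Real.rpow_add hFQ]
          congr 1
          rw [hγ]; ring
        rw [this, ENNReal.ofReal_mul (by positivity), mul_assoc, mul_left_comm 2]
        gcongr _ * ?_
        exact hhalf Q hQ
    _ = 2 * ∫⁻ x, ∑ Q ∈ 𝒯, (U Q).indicator (fun x => ENNReal.ofReal (F Q ^ γ) * g x) x ∂w := by
        rw [lintegral_finsetSum _ fun Q _ => (hg.const_mul _).indicator (hUm Q), Finset.mul_sum]
    _ ≤ 2 * ∫⁻ x, ENNReal.ofReal (4 ^ γ * (1 - (1 / 2) ^ γ)⁻¹) * g x ^ q ∂w := by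
        gcongr with x
        exact hpt x
    _ = ENNReal.ofReal (recordConst q) * ∫⁻ x, g x ^ q ∂w := by
        rw [lintegral_const_mul _ (hg.pow_const q), recordConst,
          ENNReal.ofReal_mul (zero_le_two : (0 : ℝ) ≤ 2), mul_assoc, ENNReal.ofReal_ofNat, hγ]

/-! ### Weighted bounds for sparse operators -/

section Weights

variable {d : ℕ}

lemma IsWeight.weightMeasure_ne_top {w : (Fin d → ℝ) → ℝ} (hw : IsWeight w) (Q : Cube d) :
    weightMeasure w Q.toSet ≠ ∞ := by
  have h1 : IntegrableOn w (Set.Icc Q.corner (fun i => Q.corner i + Q.side)) volume :=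
    hw.locallyIntegrable.integrableOn_isCompact isCompact_Icc
  rw [weightMeasure, withDensity_apply _ Q.measurableSet_toSet]
  refine ne_top_of_le_ne_top ?_ (lintegral_mono_set Q.subset_Icc)
  exact h1.lintegral_lt_top.ne

lemma weightMeasure_absolutelyContinuous (w : (Fin d → ℝ) → ℝ) : weightMeasure w ≪ volume :=
  withDensity_absolutelyContinuous _ _

lemma le_cubeMaximal (w : (Fin d → ℝ) → ℝ) {Q G : Cube d} (hQG : Q.toSet ⊆ G.toSet)
    {x : Fin d → ℝ} (hx : x ∈ Q.toSet) :
    weightMeasure w Q.toSet / volume Q.toSet ≤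
      2 ^ d * cubeMaximal (G.toSet.indicator fun y => ENNReal.ofReal (w y)) x := by
  have hs := Q.side_pos
  have h1 : (∫⁻ y in Set.Icc (fun i => x i - Q.side) (fun i => x i + Q.side),
      G.toSet.indicator (fun y => ENNReal.ofReal (w y)) y) / ENNReal.ofReal ((2 * Q.side) ^ d) ≤
      cubeMaximal (G.toSet.indicator fun y => ENNReal.ofReal (w y)) x :=
    le_iSup₂_of_le (f := fun (t : ℝ) (_ : 0 < t) =>
      (∫⁻ y in Set.Icc (fun i => x i - t) (fun i => x i + t),
        G.toSet.indicator (fun y => ENNReal.ofReal (w y)) y) / ENNReal.ofReal ((2 * t) ^ d))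
      Q.side hs le_rfl
  have h2 : weightMeasure w Q.toSet ≤
      ∫⁻ y in Set.Icc (fun i => x i - Q.side) (fun i => x i + Q.side),
        G.toSet.indicator (fun y => ENNReal.ofReal (w y)) y := by
    rw [weightMeasure, withDensity_apply _ Q.measurableSet_toSet]
    calc ∫⁻ y in Q.toSet, ENNReal.ofReal (w y)
        = ∫⁻ y in Q.toSet, G.toSet.indicator (fun y => ENNReal.ofReal (w y)) y :=
          setLIntegral_congr_fun Q.measurableSet_toSet fun y hy => by
            rw [Set.indicator_of_mem (hQG hy)]
      _ ≤ _ := by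
          refine lintegral_mono_set fun y hy => ⟨fun i => ?_, fun i => ?_⟩
          · have := hx i; have := hy i; simp only [Set.mem_Ico] at *; linarith
          · have := hx i; have := hy i; simp only [Set.mem_Ico] at *; linarith
  have h3 : ENNReal.ofReal ((2 * Q.side) ^ d) = 2 ^ d * volume Q.toSet := by
    rw [Q.volume_toSet, mul_pow, ENNReal.ofReal_mul (by positivity),
      ENNReal.ofReal_pow (by norm_num), ENNReal.ofReal_pow hs.le]
    simp
  rw [h3] at h1
  calc weightMeasure w Q.toSet / volume Q.toSet
      = 2 ^ d * (weightMeasure w Q.toSet / (2 ^ d * volume Q.toSet)) := by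
        rw [← mul_div_assoc, ENNReal.mul_div_mul_left _ _ (by simp) (by simp)]
    _ ≤ 2 ^ d * cubeMaximal (G.toSet.indicator fun y => ENNReal.ofReal (w y)) x := by
        gcongr
        exact (ENNReal.div_le_div_right h2 _).trans h1

open Classical in
/-- An `A_∞` weight satisfies a Carleson condition over every sparse family: the maximal function
of the weight dominates its averages on the disjoint major parts of the cubes. -/
lemma carleson_of_isSparse {w : (Fin d → ℝ) → ℝ} (hw : IsWeight w)
    {𝒮 : Finset (Cube d)} (hn : IsNested 𝒮) (hsp : IsSparse 𝒮) (hd : 0 < d) (G : Cube d) :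
    ∑ Q ∈ 𝒮.filter (fun Q => Q.toSet ⊆ G.toSet), weightMeasure w Q.toSet ≤
      2 ^ (d + 1) * aInfty w * weightMeasure w G.toSet := by
  by_cases hG0 : weightMeasure w G.toSet = 0
  · rw [hG0, mul_zero, nonpos_iff_eq_zero, Finset.sum_eq_zero_iff]
    intro Q hQ
    exact measure_mono_null (Finset.mem_filter.1 hQ).2 hG0
  set 𝒰 := 𝒮.filter (fun Q => Q.toSet ⊆ G.toSet)
  set M := cubeMaximal (G.toSet.indicator fun y => ENNReal.ofReal (w y))
  set U : Cube d → Set (Fin d → ℝ) := fun Q =>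
    ⋃ Q' ∈ 𝒮.filter (fun Q' => Q'.toSet ⊂ Q.toSet), Q'.toSet
  have hUm : ∀ Q, MeasurableSet (U Q) := fun Q =>
    Finset.measurableSet_biUnion _ fun P _ => P.measurableSet_toSet
  set E : Cube d → Set (Fin d → ℝ) := fun Q => Q.toSet \ U Q
  have hEm : ∀ Q, MeasurableSet (E Q) := fun Q => Q.measurableSet_toSet.diff (hUm Q)
  have hE : ∀ Q ∈ 𝒮, volume Q.toSet ≤ 2 * volume (E Q) := by
    intro Q hQ
    have h1 : 2 * volume (U Q) ≤ volume Q.toSet := hsp Q hQ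
    have h2 : volume Q.toSet ≤ volume (E Q) + volume (U Q) := by
      refine (measure_mono ?_).trans (measure_union_le _ _)
      intro x hx
      by_cases h : x ∈ U Q
      · exact Or.inr h
      · exact Or.inl ⟨hx, h⟩
    have h3 : volume Q.toSet + volume Q.toSet ≤ 2 * volume (E Q) + volume Q.toSet := by
      calc volume Q.toSet + volume Q.toSet = 2 * volume Q.toSet := (two_mul _).symm
        _ ≤ 2 * (volume (E Q) + volume (U Q)) := by gcongr
        _ = 2 * volume (E Q) + 2 * volume (U Q) := mul_add _ _ _
        _ ≤ _ := by gcongr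
    exact (ENNReal.add_le_add_iff_right Q.volume_ne_top).1 h3
  have hterm : ∀ Q ∈ 𝒰, weightMeasure w Q.toSet ≤ 2 ^ (d + 1) * ∫⁻ x in E Q, M x := by
    intro Q hQ
    rw [Finset.mem_filter] at hQ
    calc weightMeasure w Q.toSet
        = weightMeasure w Q.toSet / volume Q.toSet * volume Q.toSet :=
          (ENNReal.div_mul_cancel Q.volume_ne_zero Q.volume_ne_top).symm
      _ ≤ weightMeasure w Q.toSet / volume Q.toSet * (2 * volume (E Q)) := by
          gcongr; exact hE Q hQ.1
      _ = 2 * ∫⁻ _ in E Q, weightMeasure w Q.toSet / volume Q.toSet := by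
          rw [setLIntegral_const]; ring
      _ ≤ 2 * ∫⁻ x in E Q, 2 ^ d * M x := by
          gcongr 2 * ?_
          exact setLIntegral_mono' (hEm Q) fun x hx => le_cubeMaximal w hQ.2 hx.1
      _ = 2 ^ (d + 1) * ∫⁻ x in E Q, M x := by
          rw [lintegral_const_mul' _ _ (by simp), pow_succ]; ring
  have hdisj : (𝒰 : Set (Cube d)).PairwiseDisjoint E := by
    intro Q hQ Q' hQ' hne
    refine Set.disjoint_left.2 fun x hx hx' => ?_
    have h1 := (Finset.mem_filter.1 hQ).1
    have h2 := (Finset.mem_filter.1 hQ').1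
    have hne' : Q.toSet ≠ Q'.toSet := fun h => hne (Cube.eq_of_toSet_eq hd h)
    rcases hn Q h1 Q' h2 x hx.1 hx'.1 with h | h
    · exact hx'.2 (Set.mem_biUnion (Finset.mem_coe.2 (Finset.mem_filter.2
        ⟨h1, LE.le.ssubset_of_ne h hne'⟩)) hx.1)
    · exact hx.2 (Set.mem_biUnion (Finset.mem_coe.2 (Finset.mem_filter.2
        ⟨h2, LE.le.ssubset_of_ne h hne'.symm⟩)) hx'.1)
  calc ∑ Q ∈ 𝒰, weightMeasure w Q.toSet
      ≤ ∑ Q ∈ 𝒰, 2 ^ (d + 1) * ∫⁻ x in E Q, M x := Finset.sum_le_sum hterm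
    _ = 2 ^ (d + 1) * ∫⁻ x in ⋃ Q ∈ 𝒰, E Q, M x := by
        rw [← Finset.mul_sum, lintegral_biUnion_finset hdisj fun Q _ => hEm Q]
    _ ≤ 2 ^ (d + 1) * ∫⁻ x in G.toSet, M x := by
        gcongr 2 ^ (d + 1) * ?_
        exact lintegral_mono_set (Set.iUnion₂_subset fun Q hQ =>
          Set.sdiff_subset.trans (Finset.mem_filter.1 hQ).2)
    _ = 2 ^ (d + 1) * ((∫⁻ x in G.toSet, M x) / weightMeasure w G.toSet *
          weightMeasure w G.toSet) := by
        rw [ENNReal.div_mul_cancel hG0 (hw.weightMeasure_ne_top G)]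
    _ ≤ 2 ^ (d + 1) * (aInfty w * weightMeasure w G.toSet) := by
        gcongr
        exact le_iSup (fun Q : Cube d => (∫⁻ x in Q.toSet, cubeMaximal
          (Q.toSet.indicator fun y => ENNReal.ofReal (w y)) x) / weightMeasure w Q.toSet) G
    _ = _ := by ring

/-- The sparse operator with respect to the measure `σ`, applied to `h ≥ 0`. -/
noncomputable def sparseOp (σ : Measure (Fin d → ℝ)) (𝒮 : Finset (Cube d))
    (h : (Fin d → ℝ) → ℝ≥0∞) (x : Fin d → ℝ) : ℝ≥0∞ :=
  ∑ Q ∈ 𝒮, Q.toSet.indicator (fun _ => (∫⁻ y in Q.toSet, h y ∂σ) / volume Q.toSet) x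

lemma measurable_sparseOp (σ : Measure (Fin d → ℝ)) (𝒮 : Finset (Cube d))
    (h : (Fin d → ℝ) → ℝ≥0∞) : Measurable (sparseOp σ 𝒮 h) :=
  Finset.measurable_fun_sum _ fun Q _ => measurable_const.indicator Q.measurableSet_toSet

/-- The constant of the weighted bound for sparse operators. -/
noncomputable def sparseConst (d : ℕ) (p : ℝ) : ℝ :=
  16 * (1 - (1 / 2) ^ (p⁻¹ * (1 - p⁻¹)))⁻¹ * 2 ^ (d + 1) *
    (recordConst p ^ p⁻¹ * recordConst (1 - p⁻¹)⁻¹ ^ (1 - p⁻¹))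

lemma sparseConst_nonneg {d : ℕ} {p : ℝ} (hp : 1 < p) : 0 ≤ sparseConst d p := by
  have hp0 : 0 < p := by linarith
  have hα1 : p⁻¹ < 1 := inv_lt_one_of_one_lt₀ hp
  have hα : 0 < p⁻¹ := by positivity
  have h1 : (1 / 2 : ℝ) ^ (p⁻¹ * (1 - p⁻¹)) ≤ 1 :=
    Real.rpow_le_one (by norm_num) (by norm_num) (mul_nonneg hα.le (by linarith))
  have h2 : 0 ≤ (1 - (1 / 2 : ℝ) ^ (p⁻¹ * (1 - p⁻¹)))⁻¹ := by rw [inv_nonneg]; linarith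
  have h3 := (recordConst_pos hp).le
  have h4 := (recordConst_pos (q := (1 - p⁻¹)⁻¹)
    ((one_lt_inv₀ (by linarith)).2 (by linarith))).le
  unfold sparseConst
  positivity

open Classical in
/-- The form of the sparse operator, with `h` and `g` integrated against the two weights. This is
`sum_form_le` with `F` and `G` the weighted averages of `h` and `g`; the cubes on which one of the
integrals vanishes do not contribute and are dropped. -/
lemma sparse_form_bound (hd : 0 < d) {p : ℝ} (hp : 1 < p)
    {w σ : (Fin d → ℝ) → ℝ} (hw : IsWeight w) (hσ : IsWeight σ)
    (hK : twoWeightAp p w σ ≠ ∞) (hAw : aInfty w ≠ ∞) (hAσ : aInfty σ ≠ ∞)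
    {𝒮 : Finset (Cube d)} (hn : IsNested 𝒮) (hsp : IsSparse 𝒮)
    {h g : (Fin d → ℝ) → ℝ≥0∞} (hh : Measurable h) (hg : Measurable g)
    (hhp : ∫⁻ x, h x ^ p ∂(weightMeasure σ) ≠ ∞)
    (hgp : ∫⁻ x, g x ^ (1 - p⁻¹)⁻¹ ∂(weightMeasure w) ≠ ∞)
    (hhf : ∀ Q ∈ 𝒮, ∫⁻ y in Q.toSet, h y ∂(weightMeasure σ) ≠ ∞)
    (hgf : ∀ Q ∈ 𝒮, ∫⁻ y in Q.toSet, g y ∂(weightMeasure w) ≠ ∞) :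
    ∑ Q ∈ 𝒮, (∫⁻ y in Q.toSet, h y ∂(weightMeasure σ)) / volume Q.toSet *
        ∫⁻ y in Q.toSet, g y ∂(weightMeasure w) ≤
      ENNReal.ofReal (sparseConst d p) * twoWeightAp p w σ *
        (aInfty w ^ (1 - p⁻¹) + aInfty σ ^ p⁻¹) *
        ((∫⁻ x, h x ^ p ∂(weightMeasure σ)) ^ p⁻¹ *
          (∫⁻ x, g x ^ (1 - p⁻¹)⁻¹ ∂(weightMeasure w)) ^ (1 - p⁻¹)) := by
  have hp0 : 0 < p := by linarith
  set α := p⁻¹ with hα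
  set β := 1 - p⁻¹ with hβ
  have hα0 : 0 < α := by positivity
  have hα1 : α < 1 := inv_lt_one_of_one_lt₀ hp
  have hβ0 : 0 < β := by rw [hβ]; linarith
  have hβ1 : β ≤ 1 := by rw [hβ]; linarith
  have hαβ : α + β = 1 := by rw [hβ]; ring
  have hq1 : 1 < β⁻¹ := (one_lt_inv₀ hβ0).2 (by rw [hβ]; linarith)
  have hαp : α⁻¹ = p := inv_inv p
  have hcp : 1 / p.conjExponent = β := by
    rw [Real.conjExponent, hβ]; field_simp
  set W := weightMeasure w with hW
  set Sg := weightMeasure σ with h_sigma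
  have hWt : ∀ Q : Cube d, W Q.toSet ≠ ∞ := hw.weightMeasure_ne_top
  have hSt : ∀ Q : Cube d, Sg Q.toSet ≠ ∞ := hσ.weightMeasure_ne_top
  set 𝒰 := 𝒮.filter fun Q => (∫⁻ y in Q.toSet, h y ∂Sg) ≠ 0 ∧ (∫⁻ y in Q.toSet, g y ∂W) ≠ 0
    with h𝒰
  have hUS : 𝒰 ⊆ 𝒮 := Finset.filter_subset _ _
  have hn' : IsNested 𝒰 := hn.mono hUS
  have hsp' : IsSparse 𝒰 := hsp.mono hUS
  have hS0 : ∀ Q ∈ 𝒰, Sg Q.toSet ≠ 0 := by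
    intro Q hQ h0
    refine (Finset.mem_filter.1 hQ).2.1 ?_
    rw [Measure.restrict_eq_zero.2 h0, lintegral_zero_measure]
  have hW0 : ∀ Q ∈ 𝒰, W Q.toSet ≠ 0 := by
    intro Q hQ h0
    refine (Finset.mem_filter.1 hQ).2.2 ?_
    rw [Measure.restrict_eq_zero.2 h0, lintegral_zero_measure]
  set v' : Cube d → ℝ := fun Q => volume.real Q.toSet with hv'
  set w' : Cube d → ℝ := fun Q => W.real Q.toSet with hw'
  set s' : Cube d → ℝ := fun Q => Sg.real Q.toSet with hs'
  set F : Cube d → ℝ := fun Q => ((∫⁻ y in Q.toSet, h y ∂Sg) / Sg Q.toSet).toReal with hF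
  set G : Cube d → ℝ := fun Q => ((∫⁻ y in Q.toSet, g y ∂W) / W Q.toSet).toReal with hG
  have hv0 : ∀ Q ∈ 𝒰, 0 < v' Q := fun Q _ =>
    ENNReal.toReal_pos Q.volume_ne_zero Q.volume_ne_top
  have hw0 : ∀ Q ∈ 𝒰, 0 < w' Q := fun Q hQ => ENNReal.toReal_pos (hW0 Q hQ) (hWt Q)
  have hs0 : ∀ Q ∈ 𝒰, 0 < s' Q := fun Q hQ => ENNReal.toReal_pos (hS0 Q hQ) (hSt Q)
  have hFt : ∀ Q ∈ 𝒰, (∫⁻ y in Q.toSet, h y ∂Sg) / Sg Q.toSet ≠ ∞ := fun Q hQ =>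
    ENNReal.div_ne_top (hhf Q (hUS hQ)) (hS0 Q hQ)
  have hGt : ∀ Q ∈ 𝒰, (∫⁻ y in Q.toSet, g y ∂W) / W Q.toSet ≠ ∞ := fun Q hQ =>
    ENNReal.div_ne_top (hgf Q (hUS hQ)) (hW0 Q hQ)
  have hF0 : ∀ Q ∈ 𝒰, 0 < F Q := fun Q hQ => ENNReal.toReal_pos
    (ENNReal.div_ne_zero.2 ⟨(Finset.mem_filter.1 hQ).2.1, hSt Q⟩) (hFt Q hQ)
  have hG0 : ∀ Q ∈ 𝒰, 0 < G Q := fun Q hQ => ENNReal.toReal_pos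
    (ENNReal.div_ne_zero.2 ⟨(Finset.mem_filter.1 hQ).2.2, hWt Q⟩) (hGt Q hQ)
  have hunion : ∀ (μ : Measure (Fin d → ℝ)), (∀ Q : Cube d, μ Q.toSet ≠ ∞) →
      ∀ G : Cube d, ∀ 𝒯 : Finset (Cube d), (∀ Q ∈ 𝒯, Q.toSet ⊂ G.toSet) →
      (𝒯 : Set (Cube d)).PairwiseDisjoint Cube.toSet →
      ∑ Q ∈ 𝒯, μ.real Q.toSet = μ.real (⋃ Q ∈ 𝒯, Q.toSet) := by
    intro μ hμ G 𝒯 _ hdis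
    rw [measureReal_biUnion_finset hdis (fun Q _ => Q.measurableSet_toSet) (fun Q _ => hμ Q)]
  have hsuper : ∀ (μ : Measure (Fin d → ℝ)), (∀ Q : Cube d, μ Q.toSet ≠ ∞) →
      ∀ G : Cube d, ∀ 𝒯 : Finset (Cube d), (∀ Q ∈ 𝒯, Q.toSet ⊂ G.toSet) →
      (𝒯 : Set (Cube d)).PairwiseDisjoint Cube.toSet →
      ∑ Q ∈ 𝒯, μ.real Q.toSet ≤ μ.real G.toSet := by
    intro μ hμ G 𝒯 h𝒯 hdis
    rw [hunion μ hμ G 𝒯 h𝒯 hdis]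
    exact measureReal_mono (Set.iUnion₂_subset fun Q hQ => (h𝒯 Q hQ).subset) (hμ G)
  have hcar : ∀ {u : (Fin d → ℝ) → ℝ}, IsWeight u → aInfty u ≠ ∞ → ∀ H ∈ 𝒰,
      ∑ Q ∈ 𝒰.filter (fun Q => Q.toSet ⊆ H.toSet), (weightMeasure u).real Q.toSet ≤
        2 ^ (d + 1) * (aInfty u).toReal * (weightMeasure u).real H.toSet := by
    intro u hu hut H _
    have h1 := carleson_of_isSparse hu hn' hsp' hd H
    have h2 := ENNReal.toReal_mono (ENNReal.mul_ne_top (ENNReal.mul_ne_top (by simp) hut)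
      (hu.weightMeasure_ne_top H)) h1
    rw [ENNReal.toReal_sum (fun Q _ => hu.weightMeasure_ne_top Q), ENNReal.toReal_mul,
      ENNReal.toReal_mul] at h2
    simpa [Measure.real] using h2
  have hrecord : ∀ {u : (Fin d → ℝ) → ℝ} {q : ℝ} {k : (Fin d → ℝ) → ℝ≥0∞}
      {Φ : Cube d → ℝ}, IsWeight u → 1 < q → Measurable k →
      (∫⁻ x, k x ^ q ∂(weightMeasure u) ≠ ∞) →
      (∀ Q ∈ 𝒰, weightMeasure u Q.toSet ≠ 0) → (∀ Q ∈ 𝒰, 0 < Φ Q) →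
      (∀ Q ∈ 𝒰, ENNReal.ofReal (Φ Q) =
        (∫⁻ x in Q.toSet, k x ∂(weightMeasure u)) / weightMeasure u Q.toSet) →
      ∀ 𝒯 ⊆ 𝒰, (∀ Q ∈ 𝒯, ∀ Q' ∈ 𝒯, Q.toSet ⊂ Q'.toSet →
        ⌊Real.logb 2 (Φ Q')⌋ < ⌊Real.logb 2 (Φ Q)⌋) →
      ∑ Q ∈ 𝒯, Φ Q ^ q * (weightMeasure u).real Q.toSet ≤
        recordConst q * (∫⁻ x, k x ^ q ∂(weightMeasure u)).toReal := by
    intro u q k Φ hu hq hk hkt hu0 hΦ hΦe 𝒯 h𝒯 hrec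
    have h1 := sum_record_le hq (weightMeasure u) 𝒯 (hn'.mono h𝒯) k hk
      (fun Q hQ => hu0 Q (h𝒯 hQ)) (fun Q _ => hu.weightMeasure_ne_top Q) Φ
      (fun Q hQ => hΦ Q (h𝒯 hQ)) (fun Q hQ => hΦe Q (h𝒯 hQ)) hrec hd
    have h2 := ENNReal.toReal_mono (ENNReal.mul_ne_top ENNReal.ofReal_ne_top hkt) h1
    rw [ENNReal.toReal_sum (fun Q _ => ENNReal.mul_ne_top ENNReal.ofReal_ne_top
      (hu.weightMeasure_ne_top Q)), ENNReal.toReal_mul,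
      ENNReal.toReal_ofReal (recordConst_pos hq).le] at h2
    refine le_trans (Finset.sum_le_sum fun Q hQ => ?_) h2
    have := hΦ Q (h𝒯 hQ)
    rw [ENNReal.toReal_mul, ENNReal.toReal_ofReal (by positivity), Measure.real]
  set I := (∫⁻ x, h x ^ p ∂Sg).toReal with hI
  set J := (∫⁻ x, g x ^ β⁻¹ ∂W).toReal with hJ
  have hrp := recordConst_pos hp
  have hrq := recordConst_pos hq1
  have hI0 : 0 ≤ I := ENNReal.toReal_nonneg
  have hJ0 : 0 ≤ J := ENNReal.toReal_nonneg
  have hmain := sum_form_le hd 𝒰 hn' v' w' s' F G (K := (twoWeightAp p w σ).toReal)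
    (As := 2 ^ (d + 1) * (aInfty σ).toReal) (Aw := 2 ^ (d + 1) * (aInfty w).toReal)
    (Cf := recordConst p * I) (Cg := recordConst β⁻¹ * J) hα0 hβ0 hαβ
    hv0 hw0 hs0 hF0 hG0 ENNReal.toReal_nonneg (by positivity) (by positivity) (by positivity)
    (by positivity) (by
      intro Q _
      have h1 : (W Q.toSet / volume Q.toSet) ^ α * (Sg Q.toSet / volume Q.toSet) ^ β ≤
          twoWeightAp p w σ := by
        rw [twoWeightAp]
        have := le_iSup (fun Q : Cube d => (weightMeasure w Q.toSet / volume Q.toSet) ^ (1 / p) *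
          (weightMeasure σ Q.toSet / volume Q.toSet) ^ (1 / p.conjExponent)) Q
        simpa only [hcp, one_div] using this
      have h2 := ENNReal.toReal_mono hK h1
      rwa [ENNReal.toReal_mul, ← ENNReal.toReal_rpow, ← ENNReal.toReal_rpow, ENNReal.toReal_div,
        ENNReal.toReal_div] at h2)
    (by
      intro G hG 𝒯 h𝒯 hsub hdis
      have h1 : ∑ Q ∈ 𝒯, v' Q = volume.real (⋃ Q ∈ 𝒯, Q.toSet) :=
        hunion volume Cube.volume_ne_top G 𝒯 hsub hdis
      have h2 : 2 * volume (⋃ Q ∈ 𝒯, Q.toSet) ≤ volume G.toSet := by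
        refine le_trans ?_ (hsp' G hG)
        gcongr 2 * volume ?_
        exact Set.biUnion_subset_biUnion_left fun P hP =>
          Finset.mem_filter.2 ⟨h𝒯 hP, hsub P hP⟩
      have h3 := ENNReal.toReal_mono G.volume_ne_top h2
      rw [ENNReal.toReal_mul] at h3
      rw [h1, le_div_iff₀ (by norm_num), mul_comm, Measure.real, ← ENNReal.toReal_ofNat]
      exact h3)
    (fun G _ 𝒯 _ => hsuper W hWt G 𝒯) (fun G _ 𝒯 _ => hsuper Sg hSt G 𝒯)
    (hcar hσ hAσ) (hcar hw hAw)
    (by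
      rw [hαp]
      exact hrecord hσ hp hh hhp hS0 hF0 fun Q hQ => ENNReal.ofReal_toReal (hFt Q hQ))
    (hrecord hw hq1 hg hgp hW0 hG0 fun Q hQ => ENNReal.ofReal_toReal (hGt Q hQ))
  have hLHS : ∑ Q ∈ 𝒮, (∫⁻ y in Q.toSet, h y ∂Sg) / volume Q.toSet *
      ∫⁻ y in Q.toSet, g y ∂W =
      ENNReal.ofReal (∑ Q ∈ 𝒰, F Q * G Q * (s' Q * w' Q / v' Q)) := by
    rw [ENNReal.ofReal_sum_of_nonneg (fun Q hQ => by
      have := hF0 Q hQ; have := hG0 Q hQ; have := hs0 Q hQ; have := hw0 Q hQ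
      have := hv0 Q hQ; positivity)]
    rw [← Finset.sum_subset hUS fun Q hQ hQU => ?_]
    · refine Finset.sum_congr rfl fun Q hQ => ?_
      have e1 : F Q * s' Q = (∫⁻ y in Q.toSet, h y ∂Sg).toReal := by
        rw [hF, hs']
        simp only [Measure.real]
        rw [← ENNReal.toReal_mul, ENNReal.div_mul_cancel (hS0 Q hQ) (hSt Q)]
      have e2 : G Q * w' Q = (∫⁻ y in Q.toSet, g y ∂W).toReal := by
        rw [hG, hw']
        simp only [Measure.real]
        rw [← ENNReal.toReal_mul, ENNReal.div_mul_cancel (hW0 Q hQ) (hWt Q)]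
      have e3 : F Q * G Q * (s' Q * w' Q / v' Q) = F Q * s' Q / v' Q * (G Q * w' Q) := by ring
      rw [e3, e1, e2, hv']
      simp only [Measure.real]
      rw [← ENNReal.toReal_div, ← ENNReal.toReal_mul,
        ENNReal.ofReal_toReal]
      exact ENNReal.mul_ne_top (ENNReal.div_ne_top (hhf Q (hUS hQ)) Q.volume_ne_zero)
        (hgf Q (hUS hQ))
    · have : ¬ ((∫⁻ y in Q.toSet, h y ∂Sg) ≠ 0 ∧ (∫⁻ y in Q.toSet, g y ∂W) ≠ 0) := fun hc =>
        hQU (Finset.mem_filter.2 ⟨hQ, hc⟩)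
      rw [not_and_or, not_not, not_not] at this
      rcases this with h0 | h0
      · rw [h0, ENNReal.zero_div, zero_mul]
      · rw [h0, mul_zero]
  rw [hLHS]
  have h2d : (1 : ℝ) ≤ 2 ^ (d + 1) := one_le_pow₀ (by norm_num)
  have hpow : ∀ {γ : ℝ}, 0 < γ → γ ≤ 1 → ∀ x : ℝ, 0 ≤ x →
      (2 ^ (d + 1) * x) ^ γ ≤ 2 ^ (d + 1) * x ^ γ := by
    intro γ hγ hγ1 x hx
    rw [Real.mul_rpow (by positivity) hx]
    gcongr
    calc ((2 : ℝ) ^ (d + 1)) ^ γ ≤ ((2 : ℝ) ^ (d + 1)) ^ (1 : ℝ) :=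
          Real.rpow_le_rpow_of_exponent_le h2d hγ1
      _ = _ := Real.rpow_one _
  have hC1 : 0 ≤ (1 - (1 / 2 : ℝ) ^ (α * β))⁻¹ := by
    rw [inv_nonneg, sub_nonneg]
    exact Real.rpow_le_one (by norm_num) (by norm_num) (mul_pos hα0 hβ0).le
  have hfinal : ∑ Q ∈ 𝒰, F Q * G Q * (s' Q * w' Q / v' Q) ≤
      sparseConst d p * (twoWeightAp p w σ).toReal *
        ((aInfty w).toReal ^ β + (aInfty σ).toReal ^ α) * (I ^ α * J ^ β) := by
    refine hmain.trans ?_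
    rw [Real.mul_rpow hrp.le hI0, Real.mul_rpow hrq.le hJ0]
    have h1 := hpow hα0 hα1.le (aInfty σ).toReal ENNReal.toReal_nonneg
    have h2 := hpow hβ0 hβ1 (aInfty w).toReal ENNReal.toReal_nonneg
    calc 16 * (1 - (1 / 2 : ℝ) ^ (α * β))⁻¹ * (twoWeightAp p w σ).toReal *
          ((2 ^ (d + 1) * (aInfty σ).toReal) ^ α + (2 ^ (d + 1) * (aInfty w).toReal) ^ β) *
          (recordConst p ^ α * I ^ α * (recordConst β⁻¹ ^ β * J ^ β))
        ≤ 16 * (1 - (1 / 2 : ℝ) ^ (α * β))⁻¹ * (twoWeightAp p w σ).toReal *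
          (2 ^ (d + 1) * (aInfty σ).toReal ^ α + 2 ^ (d + 1) * (aInfty w).toReal ^ β) *
          (recordConst p ^ α * I ^ α * (recordConst β⁻¹ ^ β * J ^ β)) := by
          have := @ENNReal.toReal_nonneg (twoWeightAp p w σ)
          gcongr
      _ = _ := by rw [sparseConst]; ring
  refine (ENNReal.ofReal_le_ofReal hfinal).trans_eq ?_
  have hsc := sparseConst_nonneg (d := d) hp
  rw [ENNReal.ofReal_mul (by positivity), ENNReal.ofReal_mul (by positivity),
    ENNReal.ofReal_mul hsc, ENNReal.ofReal_add (by positivity) (by positivity),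
    ENNReal.ofReal_mul (by positivity),
    ← ENNReal.ofReal_rpow_of_nonneg ENNReal.toReal_nonneg hβ0.le,
    ← ENNReal.ofReal_rpow_of_nonneg ENNReal.toReal_nonneg hα0.le,
    ← ENNReal.ofReal_rpow_of_nonneg hI0 hα0.le, ← ENNReal.ofReal_rpow_of_nonneg hJ0 hβ0.le,
    ENNReal.ofReal_toReal hK, ENNReal.ofReal_toReal hAw, ENNReal.ofReal_toReal hAσ,
    hI, hJ, ENNReal.ofReal_toReal hhp, ENNReal.ofReal_toReal hgp]

/-- The two-weight bound for sparse operators, from the bilinear estimate tested against the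
power `p - 1` of the operator itself. -/
theorem sparseOp_bound (hd : 0 < d) {p : ℝ} (hp : 1 < p)
    {w σ : (Fin d → ℝ) → ℝ} (hw : IsWeight w) (hσ : IsWeight σ)
    (hK : twoWeightAp p w σ ≠ ∞) (hAw : aInfty w ≠ ∞) (hAσ : aInfty σ ≠ ∞)
    {𝒮 : Finset (Cube d)} (hn : IsNested 𝒮) (hsp : IsSparse 𝒮)
    {h : (Fin d → ℝ) → ℝ≥0∞} (hh : Measurable h)
    (hhp : ∫⁻ x, h x ^ p ∂(weightMeasure σ) ≠ ∞)
    (hhf : ∀ Q ∈ 𝒮, ∫⁻ y in Q.toSet, h y ∂(weightMeasure σ) ≠ ∞) :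
    (∫⁻ x, sparseOp (weightMeasure σ) 𝒮 h x ^ p ∂(weightMeasure w)) ^ p⁻¹ ≤
      ENNReal.ofReal (sparseConst d p) * twoWeightAp p w σ *
        (aInfty w ^ (1 - p⁻¹) + aInfty σ ^ p⁻¹) *
        (∫⁻ x, h x ^ p ∂(weightMeasure σ)) ^ p⁻¹ := by
  have hp0 : 0 < p := by linarith
  have hα1 : p⁻¹ < 1 := inv_lt_one_of_one_lt₀ hp
  have hβ0 : 0 < 1 - p⁻¹ := by linarith
  set A := sparseOp (weightMeasure σ) 𝒮 h with hA
  have hAm : Measurable A := measurable_sparseOp _ _ _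
  set c : Cube d → ℝ≥0∞ := fun Q => (∫⁻ y in Q.toSet, h y ∂(weightMeasure σ)) / volume Q.toSet
  have hc : ∀ Q ∈ 𝒮, c Q ≠ ∞ := fun Q hQ => ENNReal.div_ne_top (hhf Q hQ) Q.volume_ne_zero
  set B := ∑ Q ∈ 𝒮, c Q with hB
  have hBt : B ≠ ∞ := ENNReal.sum_ne_top.2 hc
  have hAB : ∀ x, A x ≤ (⋃ Q ∈ 𝒮, Q.toSet).indicator (fun _ => B) x := by
    intro x
    by_cases hx : x ∈ ⋃ Q ∈ 𝒮, Q.toSet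
    · rw [Set.indicator_of_mem hx]
      exact Finset.sum_le_sum fun Q _ => Set.indicator_le_self _ _ _
    · rw [Set.indicator_of_notMem hx, nonpos_iff_eq_zero]
      refine Finset.sum_eq_zero fun Q hQ => Set.indicator_of_notMem (fun hxQ => hx ?_) _
      exact Set.mem_biUnion (Finset.mem_coe.2 hQ) hxQ
  have hUm : MeasurableSet (⋃ Q ∈ 𝒮, Q.toSet) :=
    Finset.measurableSet_biUnion _ fun P _ => P.measurableSet_toSet
  have hUt : weightMeasure w (⋃ Q ∈ 𝒮, Q.toSet) ≠ ∞ :=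
    ((measure_biUnion_finset_le _ _).trans_lt (ENNReal.sum_lt_top.2 fun Q _ =>
      (hw.weightMeasure_ne_top Q).lt_top)).ne
  set X := ∫⁻ x, A x ^ p ∂(weightMeasure w) with hX
  have hXt : X ≠ ∞ := by
    refine ne_top_of_le_ne_top (b := B ^ p * weightMeasure w (⋃ Q ∈ 𝒮, Q.toSet)) ?_ ?_
    · exact ENNReal.mul_ne_top (ENNReal.rpow_ne_top_of_nonneg hp0.le hBt) hUt
    · rw [hX, ← lintegral_indicator_const hUm]
      refine lintegral_mono fun x => ?_
      refine (ENNReal.rpow_le_rpow (hAB x) hp0.le).trans ?_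
      by_cases hx : x ∈ ⋃ Q ∈ 𝒮, Q.toSet
      · rw [Set.indicator_of_mem hx, Set.indicator_of_mem hx]
      · rw [Set.indicator_of_notMem hx, ENNReal.zero_rpow_of_pos hp0]
        exact zero_le
  have hgm : Measurable fun x => A x ^ (p - 1) := hAm.pow_const _
  -- duality: the form is tested with `g = A ^ (p - 1)`, whose `L^{p'}(w)` norm is `X ^ (1 - p⁻¹)`;
  -- this power can be cancelled at the end because `X` is finite
  have hgX : ∫⁻ x, (A x ^ (p - 1)) ^ (1 - p⁻¹)⁻¹ ∂(weightMeasure w) = X := by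
    refine lintegral_congr fun x => ?_
    rw [← ENNReal.rpow_mul]
    congr 1
    have : p - 1 ≠ 0 := by linarith
    field_simp
  have hform := sparse_form_bound hd hp hw hσ hK hAw hAσ hn hsp hh hgm hhp (hgX ▸ hXt) hhf (by
    intro Q _
    refine ne_top_of_le_ne_top (b := B ^ (p - 1) * weightMeasure w Q.toSet) ?_ ?_
    · exact ENNReal.mul_ne_top (ENNReal.rpow_ne_top_of_nonneg (by linarith) hBt)
        (hw.weightMeasure_ne_top Q)
    · rw [← setLIntegral_const]
      refine lintegral_mono fun x => ?_
      refine ENNReal.rpow_le_rpow ((hAB x).trans (Set.indicator_le_self _ _ _)) (by linarith))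
  rw [hgX] at hform
  have hXform : X = ∑ Q ∈ 𝒮, c Q * ∫⁻ y in Q.toSet, A y ^ (p - 1) ∂(weightMeasure w) := by
    calc X = ∫⁻ x, ∑ Q ∈ 𝒮, Q.toSet.indicator (fun x => c Q * A x ^ (p - 1)) x
          ∂(weightMeasure w) := by
          refine lintegral_congr fun x => ?_
          have e1 : A x ^ p = A x * A x ^ (p - 1) := by
            conv_rhs => rw [← ENNReal.rpow_one (A x), ← ENNReal.rpow_mul, one_mul,
              ← ENNReal.rpow_add_of_nonneg _ _ zero_le_one (by linarith)]
            congr 1; ring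
          rw [e1]
          have e2 : A x * A x ^ (p - 1) =
              ∑ Q ∈ 𝒮, Q.toSet.indicator (fun _ => c Q) x * A x ^ (p - 1) := by
            rw [← Finset.sum_mul]; rfl
          rw [e2]
          refine Finset.sum_congr rfl fun Q _ => ?_
          by_cases hx : x ∈ Q.toSet
          · rw [Set.indicator_of_mem hx, Set.indicator_of_mem hx]
          · rw [Set.indicator_of_notMem hx, Set.indicator_of_notMem hx, zero_mul]
      _ = _ := by
          rw [lintegral_finsetSum _ fun Q _ => (hgm.const_mul _).indicator Q.measurableSet_toSet]
          refine Finset.sum_congr rfl fun Q _ => ?_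
          rw [lintegral_indicator Q.measurableSet_toSet, lintegral_const_mul _ hgm]
  rw [← hXform] at hform
  rcases eq_or_ne X 0 with h0 | h0
  · rw [h0, ENNReal.zero_rpow_of_pos (by positivity)]
    exact zero_le
  have hXβ0 : X ^ (1 - p⁻¹) ≠ 0 := (ENNReal.rpow_pos (pos_iff_ne_zero.2 h0) hXt).ne'
  have hXβt : X ^ (1 - p⁻¹) ≠ ∞ := ENNReal.rpow_ne_top_of_nonneg hβ0.le hXt
  refine (ENNReal.mul_le_mul_iff_left hXβ0 hXβt).1 ?_
  rw [← ENNReal.rpow_add _ _ h0 hXt, add_sub_cancel, ENNReal.rpow_one, mul_assoc _ _ (X ^ _)]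
  exact hform

end Weights

/-! ### Generalized Haar functions -/

section Haar

variable {𝕜 : Type*} [RCLike 𝕜] {d : ℕ}

lemma Cube.eq_of_mem_child {Q : Cube d} {e e' : Fin d → Bool} {x : Fin d → ℝ}
    (h : x ∈ (Q.child e).toSet) (h' : x ∈ (Q.child e').toSet) : e = e' := by
  funext i
  have h1 := h i
  have h2 := h' i
  have hs := Q.side_pos
  simp only [Cube.child, Set.mem_Ico] at h1 h2
  cases h3 : e i <;> cases h4 : e' i <;> simp [h3, h4] at h1 h2 ⊢ <;> linarith

lemma Cube.setIntegral_eq_sum_child (Q : Cube d) {F : (Fin d → ℝ) → 𝕜}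
    (hF : IntegrableOn F Q.toSet) :
    ∫ y in Q.toSet, F y = ∑ e, ∫ y in (Q.child e).toSet, F y := by
  have hU : Q.toSet = ⋃ e ∈ (Finset.univ : Finset (Fin d → Bool)), (Q.child e).toSet := by
    ext x
    simp only [Finset.mem_univ, Set.iUnion_true, Set.mem_iUnion]
    exact ⟨fun hx => Q.exists_mem_child hx, fun ⟨e, he⟩ => Q.child_subset e he⟩
  conv_lhs => rw [hU]
  rw [integral_biUnion_finset _ (fun e _ => (Q.child e).measurableSet_toSet) ?_
    (fun e _ => hF.mono_set (Q.child_subset e))]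
  intro e _ e' _ hne
  exact Set.disjoint_left.2 fun x hx hx' => hne (Cube.eq_of_mem_child hx hx')

lemma IsGeneralizedHaar.eq_zero {Q : Cube d} {h : (Fin d → ℝ) → 𝕜} (hh : IsGeneralizedHaar Q h)
    {x : Fin d → ℝ} (hx : x ∉ Q.toSet) : h x = 0 := by
  obtain ⟨a, b, hab⟩ := hh
  rw [hab, Set.indicator_of_notMem hx, zero_add]
  exact Finset.sum_eq_zero fun e _ => Set.indicator_of_notMem (fun h => hx (Q.child_subset e h)) _

lemma IsGeneralizedHaar.eq_of_mem_child {Q : Cube d} {h : (Fin d → ℝ) → 𝕜}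
    (hh : IsGeneralizedHaar Q h) {e : Fin d → Bool} {x y : Fin d → ℝ}
    (hx : x ∈ (Q.child e).toSet) (hy : y ∈ (Q.child e).toSet) : h x = h y := by
  obtain ⟨a, b, hab⟩ := hh
  rw [hab, hab, Set.indicator_of_mem (Q.child_subset e hx),
    Set.indicator_of_mem (Q.child_subset e hy)]
  congr 1
  refine Finset.sum_congr rfl fun e' _ => ?_
  by_cases he : e' = e
  · subst he; rw [Set.indicator_of_mem hx, Set.indicator_of_mem hy]
  · rw [Set.indicator_of_notMem (fun h => he (Cube.eq_of_mem_child h hx)),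
      Set.indicator_of_notMem (fun h => he (Cube.eq_of_mem_child h hy))]

lemma IsGeneralizedHaar.integrable {Q : Cube d} {h : (Fin d → ℝ) → 𝕜}
    (hh : IsGeneralizedHaar Q h) : Integrable h := by
  obtain ⟨a, b, hab⟩ := hh
  rw [show h = fun x => Q.toSet.indicator (fun _ => a) x +
    ∑ e, (Q.child e).toSet.indicator (fun _ => b e) x from funext hab]
  refine Integrable.add ?_ (integrable_finsetSum _ fun e _ => ?_)
  · exact (integrable_indicator_iff Q.measurableSet_toSet).2
      (integrableOn_const Q.volume_ne_top)
  · exact (integrable_indicator_iff (Q.child e).measurableSet_toSet).2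
      (integrableOn_const (Q.child e).volume_ne_top)

/-- The pairing with a generalized Haar function sees the integrals over the children only. -/
lemma IsGeneralizedHaar.integral_mul {Q : Cube d} {h : (Fin d → ℝ) → 𝕜}
    (hh : IsGeneralizedHaar Q h) : ∃ c : (Fin d → Bool) → 𝕜, ∀ F : (Fin d → ℝ) → 𝕜,
      IntegrableOn F Q.toSet →
        ∫ y, F y * starRingEnd 𝕜 (h y) = ∑ e, c e * ∫ y in (Q.child e).toSet, F y := by
  obtain ⟨a, b, hab⟩ := hh
  refine ⟨fun e => starRingEnd 𝕜 a + starRingEnd 𝕜 (b e), fun F hF => ?_⟩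
  have h1 : ∀ y, F y * starRingEnd 𝕜 (h y) = Q.toSet.indicator (fun y => starRingEnd 𝕜 a * F y) y +
      ∑ e, (Q.child e).toSet.indicator (fun y => starRingEnd 𝕜 (b e) * F y) y := by
    intro y
    rw [hab, map_add, map_sum, mul_add, Finset.mul_sum]
    congr 1
    · by_cases hy : y ∈ Q.toSet
      · rw [Set.indicator_of_mem hy, Set.indicator_of_mem hy, mul_comm]
      · rw [Set.indicator_of_notMem hy, Set.indicator_of_notMem hy, map_zero, mul_zero]
    · refine Finset.sum_congr rfl fun e _ => ?_
      by_cases hy : y ∈ (Q.child e).toSet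
      · rw [Set.indicator_of_mem hy, Set.indicator_of_mem hy, mul_comm]
      · rw [Set.indicator_of_notMem hy, Set.indicator_of_notMem hy, map_zero, mul_zero]
  have hc : ∀ e, IntegrableOn F (Q.child e).toSet := fun e => hF.mono_set (Q.child_subset e)
  simp_rw [h1]
  rw [integral_add]
  · rw [integral_indicator Q.measurableSet_toSet, integral_const_mul,
      Q.setIntegral_eq_sum_child hF, integral_finsetSum, Finset.mul_sum, ← Finset.sum_add_distrib]
    · refine Finset.sum_congr rfl fun e _ => ?_
      rw [integral_indicator (Q.child e).measurableSet_toSet, integral_const_mul, add_mul]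
    · intro e _
      exact (integrable_indicator_iff (Q.child e).measurableSet_toSet).2 ((hc e).const_mul _)
  · exact (integrable_indicator_iff Q.measurableSet_toSet).2 (hF.const_mul _)
  · exact integrable_finsetSum _ fun e _ =>
      (integrable_indicator_iff (Q.child e).measurableSet_toSet).2 ((hc e).const_mul _)

end Haar

/-! ### The components of a Haar shift -/

section Averages

variable {𝕜 : Type*} [RCLike 𝕜] {d : ℕ}

/-- The average of `‖F‖` over a cube. -/
noncomputable def cubeAvg (F : (Fin d → ℝ) → 𝕜) (Q : Cube d) : ℝ≥0∞ :=
  (∫⁻ y in Q.toSet, ‖F y‖ₑ) / volume Q.toSet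

/-- The cube of the `i`-th generation below `Q` that contains the point `x` of `Q`. -/
noncomputable def gridCube (D : Set (Cube d)) (Q : Cube d) (i : ℕ) (x : Fin d → ℝ) : Cube d :=
  open Classical in
  if h : ∃ R ∈ subcubes D i Q, x ∈ R.toSet then h.choose else Q

variable {D : Set (Cube d)}

lemma IsDyadicGrid.gridCube_spec (h : IsDyadicGrid D) {Q : Cube d} (hQ : Q ∈ D) (i : ℕ)
    {x : Fin d → ℝ} (hx : x ∈ Q.toSet) :
    gridCube D Q i x ∈ subcubes D i Q ∧ x ∈ (gridCube D Q i x).toSet := by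
  have h1 := h.exists_subcubes_mem hQ hx i
  rw [gridCube, dif_pos h1]
  exact h1.choose_spec

lemma IsDyadicGrid.gridCube_eq (h : IsDyadicGrid D) {Q R : Cube d} (hQ : Q ∈ D) {i : ℕ}
    {x : Fin d → ℝ} (hR : R ∈ subcubes D i Q) (hx : x ∈ R.toSet) : gridCube D Q i x = R :=
  have h1 := h.gridCube_spec hQ i (hR.2.1 hx)
  h.subcubes_eq h1.1 hR h1.2 hx

end Averages

namespace HaarShift

variable {𝕜 : Type*} [RCLike 𝕜] {d : ℕ} (S : HaarShift 𝕜 d)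

/-- The cubes of the `k`-th generation below a cube of the grid, as a finite set. -/
noncomputable def gen (k : ℕ) (Q : Cube d) : Finset (Cube d) :=
  open Classical in
  if h : Q ∈ S.grid then (S.isDyadicGrid.finite_subcubes h k).toFinset else ∅

lemma mem_gen {k : ℕ} {Q R : Cube d} (hQ : Q ∈ S.grid) :
    R ∈ S.gen k Q ↔ R ∈ subcubes S.grid k Q := by
  rw [gen, dif_pos hQ, Set.Finite.mem_toFinset]

lemma gen_pairwiseDisjoint {k : ℕ} {Q : Cube d} (hQ : Q ∈ S.grid) :
    (S.gen k Q : Set (Cube d)).PairwiseDisjoint Cube.toSet := by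
  intro R hR R' hR' hne
  rw [Finset.mem_coe, S.mem_gen hQ] at hR hR'
  exact Set.disjoint_left.2 fun x hx hx' => hne (S.isDyadicGrid.subcubes_eq hR hR' hx hx')

lemma biUnion_gen (k : ℕ) {Q : Cube d} (hQ : Q ∈ S.grid) :
    ⋃ R ∈ S.gen k Q, R.toSet = Q.toSet := by
  refine subset_antisymm (Set.iUnion₂_subset fun R hR => ((S.mem_gen hQ).1 hR).2.1) fun x hx => ?_
  obtain ⟨R, hR, hxR⟩ := S.isDyadicGrid.exists_subcubes_mem hQ hx k
  exact Set.mem_biUnion (Finset.mem_coe.2 ((S.mem_gen hQ).2 hR)) hxR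

lemma component_eq_sum {Q : Cube d} (hQ : Q ∈ S.grid) (F : (Fin d → ℝ) → 𝕜) (x : Fin d → ℝ) :
    S.component Q F x = ∑ Q' ∈ S.gen S.m Q, ∑ R' ∈ S.gen S.n Q,
      (∫ y, F y * starRingEnd 𝕜 (S.inner Q' R' y)) / ((Q.side ^ d : ℝ) : 𝕜) * S.outer Q' R' x := by
  have hcoe : ∀ k, subcubes S.grid k Q = S.gen k Q := fun k => by
    ext R; exact (S.mem_gen hQ).symm
  rw [component, hcoe, hcoe, finsum_mem_coe_finset]
  exact Finset.sum_congr rfl fun Q' _ => finsum_mem_coe_finset _ _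

lemma component_eq_sum_of_mem {Q Q' : Cube d} (hQ : Q ∈ S.grid)
    (hQ' : Q' ∈ subcubes S.grid S.m Q) (F : (Fin d → ℝ) → 𝕜) {x : Fin d → ℝ} (hx : x ∈ Q'.toSet) :
    S.component Q F x = ∑ R' ∈ S.gen S.n Q,
      (∫ y, F y * starRingEnd 𝕜 (S.inner Q' R' y)) / ((Q.side ^ d : ℝ) : 𝕜) * S.outer Q' R' x := by
  rw [S.component_eq_sum hQ]
  refine Finset.sum_eq_single_of_mem Q' ((S.mem_gen hQ).2 hQ') fun P hP hne => ?_
  refine Finset.sum_eq_zero fun R' hR' => ?_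
  rw [S.mem_gen hQ] at hP hR'
  rw [(S.outer_haar Q hQ P hP R' hR').eq_zero fun hxP =>
    hne (S.isDyadicGrid.subcubes_eq hP hQ' hxP hx), mul_zero]

lemma component_eq_zero {Q : Cube d} (hQ : Q ∈ S.grid) (F : (Fin d → ℝ) → 𝕜) {x : Fin d → ℝ}
    (hx : x ∉ Q.toSet) : S.component Q F x = 0 := by
  rw [S.component_eq_sum hQ]
  refine Finset.sum_eq_zero fun P hP => Finset.sum_eq_zero fun R' hR' => ?_
  rw [S.mem_gen hQ] at hP hR'
  rw [(S.outer_haar Q hQ P hP R' hR').eq_zero fun hxP => hx (hP.2.1 hxP), mul_zero]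

lemma enorm_component_le {Q : Cube d} (hQ : Q ∈ S.grid) (F : (Fin d → ℝ) → 𝕜) (x : Fin d → ℝ) :
    ‖S.component Q F x‖ₑ ≤ Q.toSet.indicator (fun _ => cubeAvg F Q) x := by
  by_cases hx : x ∈ Q.toSet
  swap
  · rw [S.component_eq_zero hQ F hx]; simp
  obtain ⟨Q', hQ', hxQ'⟩ := S.isDyadicGrid.exists_subcubes_mem hQ hx S.m
  rw [S.component_eq_sum_of_mem hQ hQ' F hxQ', Set.indicator_of_mem hx]
  have hvol : ‖((Q.side ^ d : ℝ) : 𝕜)‖ₑ = volume Q.toSet := by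
    have : ‖((Q.side ^ d : ℝ) : 𝕜)‖ = Q.side ^ d := by
      rw [RCLike.norm_ofReal, abs_of_nonneg (pow_nonneg Q.side_pos.le d)]
    rw [← ofReal_norm, this, Q.volume_toSet, ENNReal.ofReal_pow Q.side_pos.le]
  calc ‖∑ R' ∈ S.gen S.n Q, (∫ y, F y * starRingEnd 𝕜 (S.inner Q' R' y)) /
        ((Q.side ^ d : ℝ) : 𝕜) * S.outer Q' R' x‖ₑ
      ≤ ∑ R' ∈ S.gen S.n Q, ‖(∫ y, F y * starRingEnd 𝕜 (S.inner Q' R' y)) /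
        ((Q.side ^ d : ℝ) : 𝕜) * S.outer Q' R' x‖ₑ := enorm_sum_le _ _
    _ ≤ ∑ R' ∈ S.gen S.n Q, (∫⁻ y in R'.toSet, ‖F y‖ₑ) / volume Q.toSet := by
        refine Finset.sum_le_sum fun R' hR' => ?_
        rw [S.mem_gen hQ] at hR'
        have hin := S.inner_haar Q hQ Q' hQ' R' hR'
        set s := ⨆ y, ‖S.inner Q' R' y‖ₑ
        set t := ⨆ y, ‖S.outer Q' R' y‖ₑ
        have h1 : ‖∫ y, F y * starRingEnd 𝕜 (S.inner Q' R' y)‖ₑ ≤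
            (∫⁻ y in R'.toSet, ‖F y‖ₑ) * s := by
          calc ‖∫ y, F y * starRingEnd 𝕜 (S.inner Q' R' y)‖ₑ
              ≤ ∫⁻ y, ‖F y * starRingEnd 𝕜 (S.inner Q' R' y)‖ₑ := enorm_integral_le_lintegral_enorm _
            _ = ∫⁻ y in R'.toSet, ‖F y * starRingEnd 𝕜 (S.inner Q' R' y)‖ₑ := by
                refine (setLIntegral_eq_of_support_subset fun y hy => ?_).symm
                by_contra hyR
                rw [Function.mem_support, hin.eq_zero hyR] at hy
                simp at hy
            _ ≤ ∫⁻ y in R'.toSet, s * ‖F y‖ₑ := by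
                refine lintegral_mono fun y => ?_
                rw [enorm_mul, mul_comm]
                gcongr
                rw [← ofReal_norm, RCLike.norm_conj, ofReal_norm]
                exact le_iSup (fun y => ‖S.inner Q' R' y‖ₑ) y
            _ ≤ _ := by
                rcases eq_or_ne s ∞ with hs | hs
                · exfalso
                  -- a generalized Haar function takes finitely many values
                  obtain ⟨a, b, hab⟩ := hin
                  have : s ≤ ‖a‖ₑ + ∑ e, ‖b e‖ₑ := by
                    refine iSup_le fun y => ?_
                    rw [hab]
                    refine (enorm_add_le _ _).trans (add_le_add ?_ ((enorm_sum_le _ _).trans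
                      (Finset.sum_le_sum fun e _ => ?_)))
                    · exact (enorm_indicator_eq_indicator_enorm _ _).trans_le
                        (Set.indicator_le_self _ _ _)
                    · exact (enorm_indicator_eq_indicator_enorm _ _).trans_le
                        (Set.indicator_le_self _ _ _)
                  rw [hs, top_le_iff] at this
                  exact absurd this (ENNReal.add_ne_top.2 ⟨enorm_ne_top,
                    ENNReal.sum_ne_top.2 fun _ _ => enorm_ne_top⟩)
                · rw [lintegral_const_mul' _ _ hs, mul_comm]
        rw [enorm_mul, div_eq_mul_inv, enorm_mul, enorm_inv (by
          have := Q.side_pos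
          exact_mod_cast (pow_pos this d).ne'), hvol, ENNReal.div_eq_inv_mul]
        calc ‖∫ y, F y * starRingEnd 𝕜 (S.inner Q' R' y)‖ₑ * (volume Q.toSet)⁻¹ *
              ‖S.outer Q' R' x‖ₑ
            ≤ (∫⁻ y in R'.toSet, ‖F y‖ₑ) * s * (volume Q.toSet)⁻¹ * t := by
              gcongr
              exact le_iSup (fun y => ‖S.outer Q' R' y‖ₑ) x
          _ = (volume Q.toSet)⁻¹ * (∫⁻ y in R'.toSet, ‖F y‖ₑ) * (s * t) := by ring
          _ ≤ (volume Q.toSet)⁻¹ * (∫⁻ y in R'.toSet, ‖F y‖ₑ) * 1 := by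
              gcongr
              exact S.normalized Q hQ Q' hQ' R' hR'
          _ = _ := mul_one _
    _ = cubeAvg F Q := by
        simp_rw [div_eq_mul_inv]
        rw [← Finset.sum_mul, ← lintegral_biUnion_finset (S.gen_pairwiseDisjoint hQ)
          (fun R _ => R.measurableSet_toSet), S.biUnion_gen _ hQ, cubeAvg, div_eq_mul_inv]

lemma enorm_component_le_avg {Q : Cube d} (hQ : Q ∈ S.grid) (F : (Fin d → ℝ) → 𝕜)
    (x : Fin d → ℝ) : ‖S.component Q F x‖ₑ ≤ cubeAvg F Q :=
  (S.enorm_component_le hQ F x).trans (Set.indicator_le_self _ _ _)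

/-- The output of a component is constant on the children of the cubes of generation `m`. -/
lemma component_eq_of_mem {Q P : Cube d} (hd : 0 < d) (hQ : Q ∈ S.grid) {k : ℕ} (hk : S.m + 1 ≤ k)
    (hP : P ∈ subcubes S.grid k Q) (F : (Fin d → ℝ) → 𝕜) {x y : Fin d → ℝ} (hx : x ∈ P.toSet)
    (hy : y ∈ P.toSet) : S.component Q F x = S.component Q F y := by
  obtain ⟨Q', hQ', hxQ'⟩ := S.isDyadicGrid.exists_subcubes_mem hQ (hP.2.1 hx) S.m
  obtain ⟨e, he⟩ := Q'.exists_mem_child hxQ'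
  have hsub : P.toSet ⊆ (Q'.child e).toSet := by
    refine S.isDyadicGrid.subset_of_side_le hd hP.1 (S.isDyadicGrid.child_mem Q' hQ'.1 e) ?_ hx he
    have := Q.side_pos
    rw [hP.2.2, Cube.child_side, hQ'.2.2, div_div, ← pow_succ]
    exact div_le_div_of_nonneg_left this.le (by positivity) (pow_le_pow_right₀ (by norm_num) hk)
  rw [S.component_eq_sum_of_mem hQ hQ' F hxQ',
    S.component_eq_sum_of_mem hQ hQ' F (Q'.child_subset e (hsub hy))]
  refine Finset.sum_congr rfl fun R' hR' => ?_
  rw [S.mem_gen hQ] at hR'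
  rw [(S.outer_haar Q hQ Q' hQ' R' hR').eq_of_mem_child he (hsub hy)]

lemma child_mem_subcubes {Q R : Cube d} {k : ℕ} (hR : R ∈ subcubes S.grid k Q)
    (e : Fin d → Bool) : R.child e ∈ subcubes S.grid (k + 1) Q :=
  ⟨S.isDyadicGrid.child_mem R hR.1 e, (R.child_subset e).trans hR.2.1, by
    rw [Cube.child_side, hR.2.2, pow_succ, div_div]⟩

/-- A component sees the input only through its integrals over the cubes of generation `n + 1`. -/
lemma component_congr {Q : Cube d} (hQ : Q ∈ S.grid) {F G : (Fin d → ℝ) → 𝕜}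
    (hF : IntegrableOn F Q.toSet) (hG : IntegrableOn G Q.toSet)
    (hFG : ∀ R ∈ subcubes S.grid (S.n + 1) Q, ∫ y in R.toSet, F y = ∫ y in R.toSet, G y)
    (x : Fin d → ℝ) : S.component Q F x = S.component Q G x := by
  rw [S.component_eq_sum hQ, S.component_eq_sum hQ]
  refine Finset.sum_congr rfl fun Q' hQ' => Finset.sum_congr rfl fun R' hR' => ?_
  rw [S.mem_gen hQ] at hQ' hR'
  obtain ⟨c, hc⟩ := (S.inner_haar Q hQ Q' hQ' R' hR').integral_mul
  rw [hc F (hF.mono_set hR'.2.1), hc G (hG.mono_set hR'.2.1)]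
  congr 2
  exact Finset.sum_congr rfl fun e _ => by rw [hFG _ (S.child_mem_subcubes hR' e)]

lemma component_congr_on {Q : Cube d} (hQ : Q ∈ S.grid) {F G : (Fin d → ℝ) → 𝕜}
    (hF : IntegrableOn F Q.toSet) (hFG : Set.EqOn F G Q.toSet)
    (x : Fin d → ℝ) : S.component Q F x = S.component Q G x :=
  S.component_congr hQ hF (hF.congr_fun hFG Q.measurableSet_toSet) (fun R hR =>
    setIntegral_congr_fun R.measurableSet_toSet fun _ hy => hFG (hR.2.1 hy)) x

lemma component_sub {Q : Cube d} (hQ : Q ∈ S.grid) {F G : (Fin d → ℝ) → 𝕜}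
    (hF : IntegrableOn F Q.toSet) (hG : IntegrableOn G Q.toSet) (x : Fin d → ℝ) :
    S.component Q (fun y => F y - G y) x = S.component Q F x - S.component Q G x := by
  rw [S.component_eq_sum hQ, S.component_eq_sum hQ, S.component_eq_sum hQ,
    ← Finset.sum_sub_distrib]
  refine Finset.sum_congr rfl fun Q' hQ' => ?_
  rw [← Finset.sum_sub_distrib]
  refine Finset.sum_congr rfl fun R' hR' => ?_
  rw [S.mem_gen hQ] at hQ' hR'
  obtain ⟨c, hc⟩ := (S.inner_haar Q hQ Q' hQ' R' hR').integral_mul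
  have hF' := hF.mono_set hR'.2.1
  have hG' := hG.mono_set hR'.2.1
  rw [hc F hF', hc G hG', hc (fun y => F y - G y) (hF'.sub hG'), ← sub_mul, ← sub_div,
    ← Finset.sum_sub_distrib]
  congr 2
  refine Finset.sum_congr rfl fun e _ => ?_
  rw [integral_sub (hF'.mono_set (R'.child_subset e)) (hG'.mono_set (R'.child_subset e)), mul_sub]

lemma integrable_component {Q : Cube d} (hQ : Q ∈ S.grid) (F : (Fin d → ℝ) → 𝕜) :
    Integrable (S.component Q F) := by
  rw [show S.component Q F = fun x => ∑ Q' ∈ S.gen S.m Q, ∑ R' ∈ S.gen S.n Q,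
      (∫ y, F y * starRingEnd 𝕜 (S.inner Q' R' y)) / ((Q.side ^ d : ℝ) : 𝕜) * S.outer Q' R' x
    from funext (S.component_eq_sum hQ F)]
  refine integrable_finsetSum _ fun Q' hQ' => integrable_finsetSum _ fun R' hR' => ?_
  rw [S.mem_gen hQ] at hQ' hR'
  exact (S.outer_haar Q hQ Q' hQ' R' hR').integrable.const_mul _

/-- The sum of the components at the cubes of generation at most `j` below `Q` along the chain of
cubes that contain `x`. -/
noncomputable def partialSum (Q : Cube d) (j : ℕ) (F : (Fin d → ℝ) → 𝕜) (x : Fin d → ℝ) : 𝕜 :=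
  ∑ i ∈ Finset.range (j + 1), S.component (gridCube S.grid Q i x) F x

end HaarShift

/-! ### Truncations -/

namespace HaarShift

variable {𝕜 : Type*} [RCLike 𝕜] {d : ℕ} (S : HaarShift 𝕜 d)

/-- The strict ancestors of a cube in the grid. -/
def ancestors (Q : Cube d) : Set (Cube d) := {R | R ∈ S.grid ∧ Q.toSet ⊂ R.toSet}

/-- The sum of the averages over all strict ancestors of a cube. -/
noncomputable def tailAvg (F : (Fin d → ℝ) → 𝕜) (Q : Cube d) : ℝ≥0∞ :=
  ∑' R : S.ancestors Q, cubeAvg F R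

/-- The part of the shift coming from the strict ancestors of a cube. -/
noncomputable def tailSum (F : (Fin d → ℝ) → 𝕜) (Q : Cube d) (x : Fin d → ℝ) : 𝕜 :=
  ∑' R : S.ancestors Q, S.component R F x

lemma summable_of_tsum_enorm_ne_top {ι : Type*} {f : ι → 𝕜} (h : ∑' i, ‖f i‖ₑ ≠ ∞) :
    Summable f := by
  refine Summable.of_norm ?_
  have := ENNReal.summable_toReal h
  simpa using this

lemma tsum_enorm_ancestors_le (F : (Fin d → ℝ) → 𝕜) (Q : Cube d) (x : Fin d → ℝ) :
    ∑' R : S.ancestors Q, ‖S.component R F x‖ₑ ≤ S.tailAvg F Q :=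
  ENNReal.tsum_le_tsum fun R => S.enorm_component_le_avg R.2.1 F x

lemma enorm_tailSum_le (F : (Fin d → ℝ) → 𝕜) (Q : Cube d) (x : Fin d → ℝ) :
    ‖S.tailSum F Q x‖ₑ ≤ S.tailAvg F Q :=
  enorm_tsum_le_tsum_enorm.trans (S.tsum_enorm_ancestors_le F Q x)

lemma tsum_large_le (hd : 0 < d) (F : (Fin d → ℝ) → 𝕜) {Q : Cube d} (hQ : Q ∈ S.grid) {ε : ℝ}
    (hε : Q.side ≤ ε) {x : Fin d → ℝ} (hx : x ∈ Q.toSet) :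
    ∑' R : S.largeCubes ε, ‖S.component R F x‖ₑ ≤ cubeAvg F Q + S.tailAvg F Q := by
  classical
  rw [tailAvg, tsum_subtype (S.largeCubes ε) fun R => ‖S.component R F x‖ₑ,
    tsum_subtype (S.ancestors Q) fun R => cubeAvg F R,
    ← tsum_pi_single Q (cubeAvg F Q), ← ENNReal.tsum_add]
  refine ENNReal.tsum_le_tsum fun R => ?_
  by_cases hR : R ∈ S.largeCubes ε
  swap
  · rw [Set.indicator_of_notMem hR]; exact zero_le
  rw [Set.indicator_of_mem hR]
  by_cases hxR : x ∈ R.toSet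
  swap
  · rw [S.component_eq_zero hR.1 F hxR, enorm_zero]; exact zero_le
  refine (S.enorm_component_le_avg hR.1 F x).trans ?_
  have hsub := S.isDyadicGrid.subset_of_side_le hd hQ hR.1 (hε.trans hR.2) hx hxR
  by_cases he : Q.toSet = R.toSet
  · rw [Cube.eq_of_toSet_eq hd he, Pi.single_eq_same]
    exact le_self_add
  · rw [Set.indicator_of_mem (show R ∈ S.ancestors Q from
      ⟨hR.1, LE.le.ssubset_of_ne hsub he⟩)]
    exact le_add_self

/-- For `x` in `Q` and `ε` comparable to `2 ^ (-j) * ℓ(Q)`, the truncation at scale `ε` splits into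
the contributions of the ancestors of `Q` and of the first `j` generations below `Q`. -/
lemma hasSum_truncation (hd : 0 < d) (F : (Fin d → ℝ) → 𝕜) {Q : Cube d} (hQ : Q ∈ S.grid)
    {ε : ℝ} {j : ℕ} (hε1 : Q.side / 2 ^ (j + 1) < ε) (hε2 : ε ≤ Q.side / 2 ^ j)
    {x : Fin d → ℝ} (hx : x ∈ Q.toSet) (ht : S.tailAvg F Q ≠ ∞) :
    HasSum (fun R : S.largeCubes ε => S.component R F x)
      (S.tailSum F Q x + S.partialSum Q j F x) := by
  classical
  have hg := fun i => S.isDyadicGrid.gridCube_spec hQ i hx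
  have hinj : Set.InjOn (fun i => gridCube S.grid Q i x) (Finset.range (j + 1)) := by
    intro a _ b _ hab
    simp only at hab
    have h1 := (hg a).1
    rw [hab] at h1
    exact IsDyadicGrid.subcubes_index_unique h1 (hg b).1
  set T : Finset (Cube d) := (Finset.range (j + 1)).image fun i => gridCube S.grid Q i x with hT
  have hQs := Q.side_pos
  have hancS : HasSum ((S.ancestors Q).indicator fun R => S.component R F x)
      (S.tailSum F Q x) :=
    (hasSum_subtype_iff_indicator (f := fun R => S.component R F x)).1
      (summable_of_tsum_enorm_ne_top (ne_top_of_le_ne_top ht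
        (S.tsum_enorm_ancestors_le F Q x))).hasSum
  have hTS : HasSum ((T : Set (Cube d)).indicator fun R => S.component R F x)
      (S.partialSum Q j F x) := by
    have h1 : ∑ R ∈ T, S.component R F x = S.partialSum Q j F x := by
      rw [hT, Finset.sum_image hinj, partialSum]
    have h2 : HasSum ((T : Set (Cube d)).indicator fun R => S.component R F x)
        (∑ R ∈ T, (T : Set (Cube d)).indicator (fun R => S.component R F x) R) :=
      hasSum_sum_of_ne_finset_zero fun R hR => Set.indicator_of_notMem (by simpa using hR) _
    rw [← h1]
    convert h2 using 1
    exact Finset.sum_congr rfl fun R hR => (Set.indicator_of_mem (Finset.mem_coe.2 hR)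
      (fun R => S.component R F x)).symm
  refine (hasSum_subtype_iff_indicator (f := fun R => S.component R F x)).2 ?_
  convert hancS.add hTS using 1
  funext R
  by_cases hxR : R ∈ S.grid ∧ x ∈ R.toSet
  swap
  · have h0 : ∀ A : Set (Cube d), (∀ P ∈ A, P ∈ S.grid) →
        A.indicator (fun R => S.component R F x) R = 0 := by
      intro A hA
      by_cases hRA : R ∈ A
      · rw [Set.indicator_of_mem hRA]
        exact S.component_eq_zero (hA R hRA) F fun h => hxR ⟨hA R hRA, h⟩
      · exact Set.indicator_of_notMem hRA _
    rw [h0 _ fun P hP => hP.1, h0 _ fun P hP => hP.1, h0 (T : Set (Cube d)), add_zero]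
    intro P hP
    obtain ⟨i, -, rfl⟩ := Finset.mem_image.1 (Finset.mem_coe.1 hP)
    exact (hg i).1.1
  obtain ⟨hRg, hxR⟩ := hxR
  by_cases hRanc : R ∈ S.ancestors Q
  · have h1 := S.isDyadicGrid.side_lt_of_ssubset hd hQ hRanc.1 hRanc.2
    have hRl : R ∈ S.largeCubes ε :=
      ⟨hRg, hε2.trans ((div_le_self hQs.le (one_le_pow₀ (by norm_num))).trans h1.le)⟩
    have hRT : R ∉ (T : Set (Cube d)) := by
      intro hRT
      obtain ⟨i, -, rfl⟩ := Finset.mem_image.1 (Finset.mem_coe.1 hRT)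
      exact hRanc.2.2 (hg i).1.2.1
    rw [Set.indicator_of_mem hRl, Set.indicator_of_mem hRanc, Set.indicator_of_notMem hRT, add_zero]
  · have hle : R.side ≤ Q.side := by
      by_contra! hlt
      have hsub := S.isDyadicGrid.subset_of_side_le hd hQ hRg hlt.le hx hxR
      refine hRanc ⟨hRg, LE.le.ssubset_of_ne hsub fun he => ?_⟩
      rw [Cube.eq_of_toSet_eq hd he] at hlt
      exact lt_irrefl _ hlt
    obtain ⟨i, hi⟩ := S.isDyadicGrid.exists_subcubes hd hRg hQ hxR hx hle
    have hRi : gridCube S.grid Q i x = R := S.isDyadicGrid.gridCube_eq hQ hi hxR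
    rw [Set.indicator_of_notMem hRanc, zero_add]
    by_cases hij : i ≤ j
    · rw [Set.indicator_of_mem, Set.indicator_of_mem]
      · exact Finset.mem_coe.2 (Finset.mem_image.2 ⟨i, Finset.mem_range.2 (by omega), hRi⟩)
      · refine ⟨hRg, hε2.trans ?_⟩
        rw [hi.2.2]
        exact div_le_div_of_nonneg_left hQs.le (by positivity)
          (pow_le_pow_right₀ (by norm_num) hij)
    · rw [Set.indicator_of_notMem, Set.indicator_of_notMem]
      · intro hRT
        obtain ⟨i', hi', he⟩ := Finset.mem_image.1 (Finset.mem_coe.1 hRT)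
        have h1 := (hg i').1
        rw [he] at h1
        have := IsDyadicGrid.subcubes_index_unique h1 hi
        rw [Finset.mem_range] at hi'
        omega
      · intro hRl
        have h1 := hRl.2
        rw [hi.2.2] at h1
        have : Q.side / 2 ^ i ≤ Q.side / 2 ^ (j + 1) :=
          div_le_div_of_nonneg_left hQs.le (by positivity)
            (pow_le_pow_right₀ (by norm_num) (by omega))
        linarith

lemma maximalTruncation_le (hd : 0 < d) (F : (Fin d → ℝ) → 𝕜) {Q : Cube d} (hQ : Q ∈ S.grid)
    {x : Fin d → ℝ} (hx : x ∈ Q.toSet) :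
    S.maximalTruncation F x ≤ S.tailAvg F Q + ⨆ j, ‖S.partialSum Q j F x‖ₑ := by
  by_cases ht : S.tailAvg F Q = ∞
  · rw [ht, top_add]; exact le_top
  refine iSup₂_le fun ε hε => ?_
  have hQs := Q.side_pos
  rcases le_or_gt ε Q.side with hle | hlt
  · obtain ⟨j, hj1, hj2⟩ := exists_nat_pow_near (x := Q.side / ε) (y := 2)
      ((one_le_div hε).2 hle) (by norm_num)
    rw [le_div_iff₀ hε] at hj1
    rw [div_lt_iff₀ hε] at hj2
    have h1 := S.hasSum_truncation hd F hQ (j := j) (ε := ε)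
      (by rw [div_lt_iff₀ (by positivity), mul_comm]; exact hj2)
      (by rw [le_div_iff₀ (by positivity), mul_comm]; exact hj1) hx ht
    rw [truncation, h1.tsum_eq]
    refine (enorm_add_le _ _).trans (add_le_add (S.enorm_tailSum_le F Q x) ?_)
    exact le_iSup (fun j => ‖S.partialSum Q j F x‖ₑ) j
  · refine le_add_right ?_
    rw [truncation]
    refine enorm_tsum_le_tsum_enorm.trans ?_
    rw [tailAvg, tsum_subtype (S.largeCubes ε) fun R => ‖S.component R F x‖ₑ,
      tsum_subtype (S.ancestors Q) fun R => cubeAvg F R]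
    refine ENNReal.tsum_le_tsum fun R => ?_
    by_cases hR : R ∈ S.largeCubes ε
    swap
    · rw [Set.indicator_of_notMem hR]; exact zero_le
    rw [Set.indicator_of_mem hR]
    by_cases hxR : x ∈ R.toSet
    swap
    · rw [S.component_eq_zero hR.1 F hxR, enorm_zero]; exact zero_le
    have hside : Q.side < R.side := hlt.trans_le hR.2
    have hsub := S.isDyadicGrid.subset_of_side_le hd hQ hR.1 hside.le hx hxR
    rw [Set.indicator_of_mem (show R ∈ S.ancestors Q from ⟨hR.1, LE.le.ssubset_of_ne hsub fun he => by
      rw [Cube.eq_of_toSet_eq hd he] at hside; exact lt_irrefl _ hside⟩)]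
    exact S.enorm_component_le_avg hR.1 F x

/-- The averages of a function supported in `Q` over the ancestors of `Q` decay geometrically. -/
lemma tailAvg_le (hd : 0 < d) {F : (Fin d → ℝ) → 𝕜} {Q : Cube d} (hQ : Q ∈ S.grid)
    (hF : ∀ y ∉ Q.toSet, F y = 0) : S.tailAvg F Q ≤ 2 * cubeAvg F Q := by
  have hanc : ∀ R : S.ancestors Q, ∃ k, Q ∈ subcubes S.grid k R := fun R =>
    S.isDyadicGrid.exists_subcubes hd hQ R.2.1 Q.corner_mem (R.2.2.subset Q.corner_mem)
      (S.isDyadicGrid.side_lt_of_ssubset hd hQ R.2.1 R.2.2).le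
  choose k hk using hanc
  have hkinj : Function.Injective k := by
    intro R R' h
    refine Subtype.ext (S.isDyadicGrid.eq_of_mem_of_side_eq R.2.1 R'.2.1 ?_
      (R.2.2.subset Q.corner_mem) (R'.2.2.subset Q.corner_mem))
    have h1 := (hk R).2.2.symm.trans (hk R').2.2
    rw [h] at h1
    field_simp at h1
    exact h1
  calc S.tailAvg F Q ≤ ∑' R : S.ancestors Q, cubeAvg F Q * (2⁻¹ : ℝ≥0∞) ^ k R := by
        refine ENNReal.tsum_le_tsum fun R => ?_
        have hint : ∫⁻ y in (R : Cube d).toSet, ‖F y‖ₑ = ∫⁻ y in Q.toSet, ‖F y‖ₑ := by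
          rw [← Set.inter_eq_self_of_subset_left R.2.2.subset,
            ← Measure.restrict_restrict Q.measurableSet_toSet]
          refine (setLIntegral_eq_of_support_subset fun y hy => ?_).symm
          by_contra hyQ
          exact hy (by simp [hF y hyQ])
        rw [cubeAvg, cubeAvg, hint, IsDyadicGrid.volume_subcubes (hk R), div_eq_mul_inv,
          div_eq_mul_inv, mul_assoc, ENNReal.mul_inv (Or.inr Q.volume_ne_top)
          (Or.inr Q.volume_ne_zero), mul_comm (volume Q.toSet)⁻¹]
        have h1 : ((2 : ℝ≥0∞) ^ (k R * d))⁻¹ ≤ 2⁻¹ ^ k R := by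
          rw [← ENNReal.inv_pow, ENNReal.inv_le_inv]
          exact pow_le_pow_right₀ (by norm_num) (Nat.le_mul_of_pos_right _ hd)
        calc _ ≤ (∫⁻ y in Q.toSet, ‖F y‖ₑ) * (2⁻¹ ^ k R * (volume Q.toSet)⁻¹) := by gcongr
          _ = _ := by ring
    _ ≤ ∑' i, cubeAvg F Q * (2⁻¹ : ℝ≥0∞) ^ i :=
        ENNReal.tsum_comp_le_tsum_of_injective hkinj fun i => cubeAvg F Q * (2⁻¹ : ℝ≥0∞) ^ i
    _ = 2 * cubeAvg F Q := by
        rw [ENNReal.tsum_mul_left, ENNReal.tsum_geometric, ENNReal.one_sub_inv_two, inv_inv,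
          mul_comm]

end HaarShift

/-! ### The maximal truncation of bounded functions -/

namespace HaarShift

variable {𝕜 : Type*} [RCLike 𝕜] {d : ℕ} (S : HaarShift 𝕜 d)

lemma component_gridCube_eq_sum {Q : Cube d} (hQ : Q ∈ S.grid) (l : ℕ) (F : (Fin d → ℝ) → 𝕜)
    {y : Fin d → ℝ} (hy : y ∈ Q.toSet) :
    S.component (gridCube S.grid Q l y) F y = ∑ R ∈ S.gen l Q, S.component R F y := by
  have h1 := S.isDyadicGrid.gridCube_spec hQ l hy
  refine (Finset.sum_eq_single_of_mem (f := fun R => S.component R F y) _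
    ((S.mem_gen hQ).2 h1.1) fun R hR hne => ?_).symm
  rw [S.mem_gen hQ] at hR
  exact S.component_eq_zero hR.1 F fun hyR =>
    hne (S.isDyadicGrid.gridCube_eq hQ hR hyR).symm

lemma cubeAvg_le_of_bound {f : (Fin d → ℝ) → 𝕜} {B : ℝ≥0∞} (hB : ∀ y, ‖f y‖ₑ ≤ B) (Q : Cube d) :
    cubeAvg f Q ≤ B := by
  rw [cubeAvg]
  refine ENNReal.div_le_of_le_mul ?_
  rw [← setLIntegral_const]
  exact lintegral_mono hB

/-- The part of the truncation over the generations in `(i, j]` below `Q`. -/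
noncomputable def middleSum (Q : Cube d) (i j : ℕ) (F : (Fin d → ℝ) → 𝕜) (y : Fin d → ℝ) : 𝕜 :=
  ∑ l ∈ Finset.Ico (i + 1) (j + 1), S.component (gridCube S.grid Q l y) F y

lemma integrableOn_middleSum {Q : Cube d} (hQ : Q ∈ S.grid) (i j : ℕ) (F : (Fin d → ℝ) → 𝕜) :
    IntegrableOn (S.middleSum Q i j F) Q.toSet := by
  have h1 : IntegrableOn (fun y => ∑ l ∈ Finset.Ico (i + 1) (j + 1),
      ∑ R ∈ S.gen l Q, S.component R F y) Q.toSet := by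
    refine Integrable.integrableOn (integrable_finsetSum _ fun l _ =>
      integrable_finsetSum _ fun R hR => ?_)
    exact S.integrable_component ((S.mem_gen hQ).1 hR).1 F
  refine h1.congr_fun (fun y hy => ?_) Q.measurableSet_toSet
  exact Finset.sum_congr rfl fun l _ => (S.component_gridCube_eq_sum hQ l F hy).symm

lemma partialSum_eq_add_middleSum (Q : Cube d) {i j : ℕ} (hij : i ≤ j) (F : (Fin d → ℝ) → 𝕜)
    (y : Fin d → ℝ) : S.partialSum Q j F y = S.partialSum Q i F y + S.middleSum Q i j F y := by
  rw [partialSum, partialSum, middleSum, Finset.sum_range_add_sum_Ico _ (by omega)]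

lemma gridCube_eq_of_mem (hd : 0 < d) {Q P : Cube d} (hQ : Q ∈ S.grid) {i l k : ℕ}
    (hP : P ∈ subcubes S.grid (i + k) Q) (hl : l ≤ i) {x y : Fin d → ℝ} (hx : x ∈ P.toSet)
    (hy : y ∈ P.toSet) : gridCube S.grid Q l y = gridCube S.grid Q l x := by
  have h1 := S.isDyadicGrid.gridCube_spec hQ l (hP.2.1 hx)
  refine S.isDyadicGrid.gridCube_eq hQ h1.1 ?_
  have h2 : P ∈ subcubes S.grid (l + (i + k - l)) Q := by rwa [show l + (i + k - l) = i + k by omega]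
  exact (S.isDyadicGrid.subcubes_of_le hd h1.1 h2 h1.2 hx).2.1 hy

lemma partialSum_eq_of_mem (hd : 0 < d) {Q P : Cube d} (hQ : Q ∈ S.grid) {i : ℕ}
    (hP : P ∈ subcubes S.grid (i + (S.m + 1)) Q) (F : (Fin d → ℝ) → 𝕜) {x y : Fin d → ℝ}
    (hx : x ∈ P.toSet) (hy : y ∈ P.toSet) : S.partialSum Q i F y = S.partialSum Q i F x := by
  refine Finset.sum_congr rfl fun l hl => ?_
  have hl' : l ≤ i := by have := Finset.mem_range.1 hl; omega
  rw [S.gridCube_eq_of_mem hd hQ hP hl' hx hy]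
  have h1 := S.isDyadicGrid.gridCube_spec hQ l (hP.2.1 hx)
  have h2 : P ∈ subcubes S.grid (l + (i + (S.m + 1) - l)) Q := by
    rwa [show l + (i + (S.m + 1) - l) = i + (S.m + 1) by omega]
  exact S.component_eq_of_mem hd h1.1.1 (by omega)
    (S.isDyadicGrid.subcubes_of_le hd h1.1 h2 h1.2 hx) F hy hx

lemma tailSum_eq_of_mem (hd : 0 < d) {Q P : Cube d} (hQ : Q ∈ S.grid) {k : ℕ} (hk : S.m + 1 ≤ k)
    (hP : P ∈ subcubes S.grid k Q) (F : (Fin d → ℝ) → 𝕜) {x y : Fin d → ℝ}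
    (hx : x ∈ P.toSet) (hy : y ∈ P.toSet) : S.tailSum F Q y = S.tailSum F Q x := by
  refine tsum_congr fun R => ?_
  obtain ⟨k0, hk0⟩ := S.isDyadicGrid.exists_subcubes hd hQ R.2.1 Q.corner_mem
    (R.2.2.subset Q.corner_mem) (S.isDyadicGrid.side_lt_of_ssubset hd hQ R.2.1 R.2.2).le
  exact S.component_eq_of_mem hd R.2.1 (by omega) (IsDyadicGrid.subcubes_trans hk0 hP) F hy hx

/-- On a small cube `P` the truncation is a constant plus the middle generations. -/
lemma setIntegral_truncation (hd : 0 < d) {Q P : Cube d} (hQ : Q ∈ S.grid) {i j : ℕ}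
    (hij : i ≤ j) (hP : P ∈ subcubes S.grid (i + (S.m + 1)) Q) (F : (Fin d → ℝ) → 𝕜)
    (ht : S.tailAvg F Q ≠ ∞) {x : Fin d → ℝ} (hx : x ∈ P.toSet) :
    ∫ y in P.toSet, S.truncation (Q.side / 2 ^ j) F y =
      volume.real P.toSet • (S.tailSum F Q x + S.partialSum Q i F x) +
        ∫ y in P.toSet, S.middleSum Q i j F y := by
  have h1 : ∀ y ∈ P.toSet, S.truncation (Q.side / 2 ^ j) F y =
      (S.tailSum F Q x + S.partialSum Q i F x) + S.middleSum Q i j F y := by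
    intro y hy
    have hQs := Q.side_pos
    have h2 := S.hasSum_truncation hd F hQ (j := j) (ε := Q.side / 2 ^ j)
      (by gcongr <;> norm_num) le_rfl (hP.2.1 hy) ht
    rw [truncation, h2.tsum_eq, S.partialSum_eq_add_middleSum Q hij,
      S.partialSum_eq_of_mem hd hQ hP F hx hy,
      S.tailSum_eq_of_mem hd hQ (by omega : S.m + 1 ≤ i + (S.m + 1)) hP F hx hy, add_assoc]
  rw [setIntegral_congr_fun P.measurableSet_toSet h1, integral_add, setIntegral_const]
  · exact integrableOn_const P.volume_ne_top
  · exact (S.integrableOn_middleSum hQ i j F).mono_set hP.2.1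

lemma tendsto_setIntegral_truncation
    {T : Lp 𝕜 2 (volume : Measure (Fin d → ℝ)) →L[𝕜] Lp 𝕜 2 (volume : Measure (Fin d → ℝ))}
    (hT : S.Represents T) {Q : Cube d} {f : (Fin d → ℝ) → 𝕜} (hf2 : MemLp f 2 volume)
    (hfi : MemLp f ∞ volume) (hf0 : ∀ y ∉ Q.toSet, f y = 0) (P : Cube d) :
    Tendsto (fun j : ℕ => ∫ y in P.toSet, S.truncation (Q.side / 2 ^ j) f y) atTop
      (𝓝 (∫ y in P.toSet, T (hf2.toLp f) y)) := by
  have hind : ∀ u : (Fin d → ℝ) → 𝕜, ∫ y in P.toSet, u y =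
      ∫ y, u y * starRingEnd 𝕜 (P.toSet.indicator (fun _ => (1 : 𝕜)) y) := by
    intro u
    rw [← integral_indicator P.measurableSet_toSet]
    refine integral_congr_ae (Eventually.of_forall fun y => ?_)
    by_cases hy : y ∈ P.toSet
    · simp [hy]
    · simp [hy]
  have hcs : ∀ (R : Cube d) (u : (Fin d → ℝ) → 𝕜), (∀ y ∉ R.toSet, u y = 0) →
      HasCompactSupport u := fun R u hu =>
    HasCompactSupport.intro (isCompact_Icc (a := R.corner) (b := fun i => R.corner i + R.side))
      fun y hy => hu y fun h => hy (R.subset_Icc h)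
  have h1 := hT f (P.toSet.indicator fun _ => (1 : 𝕜)) hf2 hfi (hcs Q f hf0)
    (memLp_indicator_const ∞ P.measurableSet_toSet 1 (Or.inr P.volume_ne_top))
    (hcs P _ fun y hy => Set.indicator_of_notMem hy _)
  simp_rw [hind]
  refine h1.comp (tendsto_nhdsWithin_iff.2 ⟨?_, Eventually.of_forall fun j => ?_⟩)
  · have := (tendsto_pow_atTop_nhds_zero_of_lt_one (r := (1 / 2 : ℝ)) (by norm_num)
      (by norm_num)).const_mul Q.side
    rw [mul_zero] at this
    refine this.congr fun j => ?_
    rw [one_div, inv_pow, div_eq_mul_inv]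
  · have := Q.side_pos
    exact Set.mem_Ioi.2 (by positivity)

/-- `L²`-averages of the image of a bounded function supported in `Q`, over a cube `P` that is not
much smaller than `Q`. -/
lemma cubeAvg_image_le
    (T : Lp 𝕜 2 (volume : Measure (Fin d → ℝ)) →L[𝕜] Lp 𝕜 2 (volume : Measure (Fin d → ℝ)))
    {Q P : Cube d} {k : ℕ} (hP : volume Q.toSet = (2 : ℝ≥0∞) ^ k * volume P.toSet)
    {f : (Fin d → ℝ) → 𝕜}
    (hf2 : MemLp f 2 volume) {B : ℝ≥0∞} (hB : ∀ y, ‖f y‖ₑ ≤ B) (hf0 : ∀ y ∉ Q.toSet, f y = 0) :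
    cubeAvg (T (hf2.toLp f)) P ≤ ‖T‖ₑ * 2 ^ k * B := by
  set u := T (hf2.toLp f) with hu
  have h1 : ∫⁻ y in P.toSet, ‖u y‖ₑ ≤ ‖u‖ₑ * volume P.toSet ^ (1 / 2 : ℝ) := by
    have := eLpNorm_le_eLpNorm_mul_rpow_measure_univ (p := 1) (q := 2)
      (μ := volume.restrict P.toSet) (f := u) (by norm_num)
      (Lp.aestronglyMeasurable u).restrict
    rw [eLpNorm_one_eq_lintegral_enorm] at this
    refine this.trans ?_
    rw [Measure.restrict_apply_univ]
    have e1 : (1 / (1 : ℝ≥0∞).toReal - 1 / (2 : ℝ≥0∞).toReal) = 1 / 2 := by norm_num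
    rw [e1, Lp.enorm_def]
    gcongr
    exact Measure.restrict_le_self
  have h2 : ‖u‖ₑ ≤ ‖T‖ₑ * (B * volume Q.toSet ^ (1 / 2 : ℝ)) := by
    refine (T.le_opENorm _).trans ?_
    gcongr
    rw [Lp.enorm_toLp]
    have e : f = Q.toSet.indicator f := by
      funext y
      by_cases hy : y ∈ Q.toSet
      · rw [Set.indicator_of_mem hy]
      · rw [Set.indicator_of_notMem hy, hf0 y hy]
    rw [e, eLpNorm_indicator_eq_eLpNorm_restrict Q.measurableSet_toSet]
    refine (eLpNorm_le_of_ae_enorm_bound (C := B) (Eventually.of_forall hB)).trans ?_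
    rw [Measure.restrict_apply_univ]
    simp
  rw [cubeAvg]
  refine ENNReal.div_le_of_le_mul (h1.trans ?_)
  have hP0 := P.volume_ne_zero
  have hPt := P.volume_ne_top
  calc ‖u‖ₑ * volume P.toSet ^ (1 / 2 : ℝ)
      ≤ ‖T‖ₑ * (B * volume Q.toSet ^ (1 / 2 : ℝ)) * volume P.toSet ^ (1 / 2 : ℝ) := by gcongr
    _ = ‖T‖ₑ * (B * ((2 : ℝ≥0∞) ^ k) ^ (1 / 2 : ℝ)) *
          (volume P.toSet ^ (1 / 2 : ℝ) * volume P.toSet ^ (1 / 2 : ℝ)) := by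
        rw [hP, ENNReal.mul_rpow_of_nonneg _ _ (by norm_num)]; ring
    _ ≤ ‖T‖ₑ * (B * 2 ^ k) * volume P.toSet := by
        gcongr
        · calc ((2 : ℝ≥0∞) ^ k) ^ (1 / 2 : ℝ) ≤ ((2 : ℝ≥0∞) ^ k) ^ (1 : ℝ) :=
              ENNReal.rpow_le_rpow_of_exponent_le (one_le_pow₀ (by norm_num)) (by norm_num)
            _ = _ := ENNReal.rpow_one _
        · rw [← ENNReal.rpow_add _ _ hP0 hPt]; norm_num
    _ = _ := by ring

/-- Cotlar's inequality for Haar shifts acting on bounded functions. The truncation of `f` at the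
cube `Q` of generation `i` is constant on the subcube `P`; there it differs from the truncation of
`f 1_Q` by the mean of `T f - T (f 1_Q)`, because the smaller cubes do not distinguish the two
functions. -/
lemma enorm_partialSum_le_of_bounded (hd : 0 < d)
    {T : Lp 𝕜 2 (volume : Measure (Fin d → ℝ)) →L[𝕜] Lp 𝕜 2 (volume : Measure (Fin d → ℝ))}
    (hT : S.Represents T) {Q₀ : Cube d} (hQ₀ : Q₀ ∈ S.grid) {f : (Fin d → ℝ) → 𝕜}
    (hf2 : MemLp f 2 volume) {B : ℝ≥0∞} (hBt : B ≠ ∞) (hB : ∀ y, ‖f y‖ₑ ≤ B)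
    (hf0 : ∀ y ∉ Q₀.toSet, f y = 0) (i : ℕ) {x : Fin d → ℝ} (hx : x ∈ Q₀.toSet) :
    ‖S.partialSum Q₀ i f x‖ₑ ≤
      cubeAvg (T (hf2.toLp f)) (gridCube S.grid Q₀ (i + (S.m + 1)) x) +
        (‖T‖ₑ * 2 ^ ((S.m + 1) * d) + 5) * B := by
  obtain ⟨hQ, hxQ⟩ := S.isDyadicGrid.gridCube_spec hQ₀ i hx
  obtain ⟨hP, hxP⟩ := S.isDyadicGrid.gridCube_spec hQ₀ (i + (S.m + 1)) hx
  set Q := gridCube S.grid Q₀ i x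
  set P := gridCube S.grid Q₀ (i + (S.m + 1)) x
  have hPQ := S.isDyadicGrid.subcubes_of_le hd hQ hP hxQ hxP
  set f₁ := Q.toSet.indicator f with hf₁
  have hf₁2 : MemLp f₁ 2 volume := hf2.indicator Q.measurableSet_toSet
  have hf₁B : ∀ y, ‖f₁ y‖ₑ ≤ B := fun y => by
    rw [hf₁, enorm_indicator_eq_indicator_enorm]
    exact (Set.indicator_le_self _ _ _).trans (hB y)
  have hf₁0 : ∀ y ∉ Q.toSet, f₁ y = 0 := fun y hy => Set.indicator_of_notMem hy _
  have hf₁0' : ∀ y ∉ Q₀.toSet, f₁ y = 0 := fun y hy => hf₁0 y fun h => hy (hQ.2.1 h)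
  have hi : ∀ u : (Fin d → ℝ) → 𝕜, AEStronglyMeasurable u volume → (∀ y, ‖u y‖ₑ ≤ B) →
      MemLp u ∞ volume := fun u hu huB => ⟨hu, by
    rw [eLpNorm_exponent_top]
    exact lt_of_le_of_lt (essSup_le_of_ae_le B (Eventually.of_forall huB)) hBt.lt_top⟩
  have htail : ∀ u : (Fin d → ℝ) → 𝕜, (∀ y, ‖u y‖ₑ ≤ B) → (∀ y ∉ Q₀.toSet, u y = 0) →
      S.tailAvg u Q₀ ≤ 2 * B := fun u huB hu0 =>
    (S.tailAvg_le hd hQ₀ hu0).trans (by gcongr; exact cubeAvg_le_of_bound huB Q₀)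
  have ht : S.tailAvg f Q₀ ≠ ∞ :=
    ne_top_of_le_ne_top (ENNReal.mul_ne_top (by simp) hBt) (htail f hB hf0)
  have ht₁ : S.tailAvg f₁ Q₀ ≠ ∞ :=
    ne_top_of_le_ne_top (ENNReal.mul_ne_top (by simp) hBt) (htail f₁ hf₁B hf₁0')
  set K := S.tailSum f Q₀ x + S.partialSum Q₀ i f x with hK
  set K₁ := S.tailSum f₁ Q₀ x + S.partialSum Q₀ i f₁ x with hK₁
  have hmid : ∀ j, ∀ y ∈ P.toSet, S.middleSum Q₀ i j f y = S.middleSum Q₀ i j f₁ y := by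
    intro j y hy
    refine Finset.sum_congr rfl fun l hl => ?_
    have hl' : i + 1 ≤ l := (Finset.mem_Ico.1 hl).1
    have h1 := S.isDyadicGrid.gridCube_spec hQ₀ l (hP.2.1 hy)
    have h2 : gridCube S.grid Q₀ l y ∈ subcubes S.grid (i + (l - i)) Q₀ := by
      rw [show i + (l - i) = l by omega]; exact h1.1
    have h3 := S.isDyadicGrid.subcubes_of_le hd hQ h2 (hPQ.2.1 hy) h1.2
    have hint : IntegrableOn f (gridCube S.grid Q₀ l y).toSet :=
      IntegrableOn.of_bound (Cube.volume_ne_top _).lt_top hf2.1.restrict B.toReal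
        (Eventually.of_forall fun z => by
          have := ENNReal.toReal_mono hBt (hB z)
          simpa using this)
    exact S.component_congr_on h1.1.1 hint (fun z hz => by
      rw [hf₁, Set.indicator_of_mem (h3.2.1 hz)]) y
  have hconst : ∀ j, i ≤ j → (∫ y in P.toSet, S.truncation (Q₀.side / 2 ^ j) f y) -
      ∫ y in P.toSet, S.truncation (Q₀.side / 2 ^ j) f₁ y = volume.real P.toSet • (K - K₁) := by
    intro j hij
    rw [S.setIntegral_truncation hd hQ₀ hij hP f ht hxP,
      S.setIntegral_truncation hd hQ₀ hij hP f₁ ht₁ hxP,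
      setIntegral_congr_fun P.measurableSet_toSet (hmid j), smul_sub]
    ring
  have hlim := (S.tendsto_setIntegral_truncation hT hf2 (hi f hf2.1 hB) hf0 P).sub
    (S.tendsto_setIntegral_truncation hT hf₁2 (hi f₁ hf₁2.1 hf₁B) hf₁0' P)
  have heq := tendsto_nhds_unique hlim (tendsto_const_nhds.congr'
    ((eventually_ge_atTop i).mono fun j hj => (hconst j hj).symm))
  have hdiff : ‖K - K₁‖ₑ ≤ cubeAvg (T (hf2.toLp f)) P + cubeAvg (T (hf₁2.toLp f₁)) P := by
    rw [cubeAvg, cubeAvg, ← ENNReal.add_div,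
      ENNReal.le_div_iff_mul_le (Or.inl P.volume_ne_zero) (Or.inl P.volume_ne_top)]
    have e1 : ‖K - K₁‖ₑ * volume P.toSet = ‖volume.real P.toSet • (K - K₁)‖ₑ := by
      rw [enorm_smul, mul_comm, Measure.real, Real.enorm_eq_ofReal ENNReal.toReal_nonneg,
        ENNReal.ofReal_toReal P.volume_ne_top]
    rw [e1, ← heq]
    exact enorm_sub_le.trans (add_le_add (enorm_integral_le_lintegral_enorm _)
      (enorm_integral_le_lintegral_enorm _))
  have hT1 : cubeAvg (T (hf₁2.toLp f₁)) P ≤ ‖T‖ₑ * 2 ^ ((S.m + 1) * d) * B :=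
    cubeAvg_image_le T (IsDyadicGrid.volume_subcubes hPQ) hf₁2 hf₁B hf₁0
  have hQs := Q₀.side_pos
  have hK₁b : ‖K₁‖ₑ ≤ 3 * B := by
    have h2 := S.hasSum_truncation hd f₁ hQ₀ (j := i) (ε := Q₀.side / 2 ^ i)
      (by gcongr <;> norm_num) le_rfl hx ht₁
    rw [hK₁, ← h2.tsum_eq]
    refine enorm_tsum_le_tsum_enorm.trans ?_
    refine (S.tsum_large_le hd f₁ hQ.1 (by rw [hQ.2.2]) hxQ).trans ?_
    have h3 := cubeAvg_le_of_bound hf₁B Q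
    calc cubeAvg f₁ Q + S.tailAvg f₁ Q ≤ B + 2 * B :=
          add_le_add h3 ((S.tailAvg_le hd hQ.1 hf₁0).trans (by gcongr))
      _ = 3 * B := by ring
  have hsplit : S.partialSum Q₀ i f x = (K - K₁) + K₁ - S.tailSum f Q₀ x := by rw [hK]; ring
  rw [hsplit]
  calc ‖K - K₁ + K₁ - S.tailSum f Q₀ x‖ₑ
      ≤ ‖K - K₁‖ₑ + ‖K₁‖ₑ + ‖S.tailSum f Q₀ x‖ₑ :=
        enorm_sub_le.trans (by gcongr; exact enorm_add_le _ _)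
    _ ≤ (cubeAvg (T (hf2.toLp f)) P + ‖T‖ₑ * 2 ^ ((S.m + 1) * d) * B) + 3 * B + 2 * B := by
        gcongr
        · exact hdiff.trans (by gcongr)
        · exact (S.enorm_tailSum_le f Q₀ x).trans (htail f hB hf0)
    _ = _ := by ring

end HaarShift

/-! ### Maximal cubes and the Calderón–Zygmund decomposition -/

section MaxCubes

variable {d : ℕ}

open Classical in
/-- The maximal elements of a finite family of cubes. -/
noncomputable def maxCubes (𝒬 : Finset (Cube d)) : Finset (Cube d) :=
  𝒬.filter fun P => ∀ P' ∈ 𝒬, P.toSet ⊆ P'.toSet → P = P'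

open Classical in
lemma maxCubes_subset (𝒬 : Finset (Cube d)) : maxCubes 𝒬 ⊆ 𝒬 := Finset.filter_subset _ _

open Classical in
lemma exists_mem_maxCubes (hd : 0 < d) {𝒬 : Finset (Cube d)} {Q : Cube d} (hQ : Q ∈ 𝒬) :
    ∃ P ∈ maxCubes 𝒬, Q.toSet ⊆ P.toSet := by
  obtain ⟨P, hP, hmax⟩ := Finset.exists_max_image
    (𝒬.filter fun P => Q.toSet ⊆ P.toSet) Cube.side ⟨Q, by simp [hQ]⟩
  rw [Finset.mem_filter] at hP
  refine ⟨P, Finset.mem_filter.2 ⟨hP.1, fun P' hP' hsub => ?_⟩, hP.2⟩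
  have hle := hmax P' (Finset.mem_filter.2 ⟨hP', hP.2.trans hsub⟩)
  have h2 : P'.side = P.side := le_antisymm hle (Cube.side_le_of_subset hd hsub)
  refine Cube.eq_of_toSet_eq hd (subset_antisymm hsub fun x hx i => ?_)
  have hc := Cube.corner_le_and_le_of_subset hsub i
  have := hx i
  constructor <;> linarith [this.1, this.2]

open Classical in
lemma maxCubes_pairwiseDisjoint {𝒬 : Finset (Cube d)} (hn : IsNested 𝒬) :
    (maxCubes 𝒬 : Set (Cube d)).PairwiseDisjoint Cube.toSet := by
  intro P hP P' hP' hne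
  refine Set.disjoint_left.2 fun x hx hx' => hne ?_
  have h1 := Finset.mem_filter.1 hP
  have h2 := Finset.mem_filter.1 hP'
  rcases hn P h1.1 P' h2.1 x hx hx' with h | h
  · exact h1.2 P' h2.1 h
  · exact (h2.2 P h1.1 h).symm

lemma biUnion_maxCubes (hd : 0 < d) (𝒬 : Finset (Cube d)) :
    ⋃ Q ∈ maxCubes 𝒬, Q.toSet = ⋃ Q ∈ 𝒬, Q.toSet := by
  refine subset_antisymm (Set.biUnion_subset_biUnion_left (maxCubes_subset 𝒬))
    (Set.iUnion₂_subset fun Q hQ => ?_)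
  obtain ⟨P, hP, hsub⟩ := exists_mem_maxCubes hd hQ
  exact hsub.trans (Set.subset_biUnion_of_mem (u := Cube.toSet) (Finset.mem_coe.2 hP))

/-- The weak type estimate for the dyadic maximal function. -/
lemma mul_volume_biUnion_le (hd : 0 < d) {𝒬 : Finset (Cube d)} (hn : IsNested 𝒬)
    (ν : Measure (Fin d → ℝ)) {c : ℝ≥0∞} (hc : ∀ Q ∈ 𝒬, c * volume Q.toSet ≤ ν Q.toSet) :
    c * volume (⋃ Q ∈ 𝒬, Q.toSet) ≤ ν (⋃ Q ∈ 𝒬, Q.toSet) := by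
  rw [← biUnion_maxCubes hd,
    measure_biUnion_finset (maxCubes_pairwiseDisjoint hn) fun Q _ => Q.measurableSet_toSet,
    measure_biUnion_finset (maxCubes_pairwiseDisjoint hn) fun Q _ => Q.measurableSet_toSet,
    Finset.mul_sum]
  exact Finset.sum_le_sum fun Q hQ => hc Q (maxCubes_subset 𝒬 hQ)

variable {𝕜 : Type*} [RCLike 𝕜]

lemma cubeAvg_mul_volume (F : (Fin d → ℝ) → 𝕜) (Q : Cube d) :
    cubeAvg F Q * volume Q.toSet = ∫⁻ y in Q.toSet, ‖F y‖ₑ :=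
  ENNReal.div_mul_cancel Q.volume_ne_zero Q.volume_ne_top

lemma sq_mul_volume_le (hd : 0 < d) {𝒬 : Finset (Cube d)} (hn : IsNested 𝒬)
    (u : Lp 𝕜 2 (volume : Measure (Fin d → ℝ))) {μ : ℝ≥0∞} (hμ : ∀ Q ∈ 𝒬, μ ≤ cubeAvg u Q) :
    μ ^ 2 * volume (⋃ Q ∈ 𝒬, Q.toSet) ≤ ‖u‖ₑ ^ 2 := by
  have hL2 : ∀ s : Set (Fin d → ℝ), (eLpNorm u 2 (volume.restrict s)) ^ 2 =
      ∫⁻ y in s, ‖u y‖ₑ ^ 2 := by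
    intro s
    rw [eLpNorm_eq_lintegral_rpow_enorm_toReal (by norm_num) (by norm_num), ← ENNReal.rpow_natCast,
      ← ENNReal.rpow_mul]
    simp
  have h1 := mul_volume_biUnion_le hd hn (volume.withDensity fun y => ‖u y‖ₑ ^ 2) (c := μ ^ 2) (by
    intro Q hQ
    rw [withDensity_apply _ Q.measurableSet_toSet, ← hL2]
    have h2 := eLpNorm_le_eLpNorm_mul_rpow_measure_univ (p := 1) (q := 2)
      (μ := volume.restrict Q.toSet) (f := u) (by norm_num)
      (Lp.aestronglyMeasurable u).restrict
    rw [eLpNorm_one_eq_lintegral_enorm, Measure.restrict_apply_univ,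
      show (1 / (1 : ℝ≥0∞).toReal - 1 / (2 : ℝ≥0∞).toReal) = 1 / 2 by norm_num,
      ← cubeAvg_mul_volume] at h2
    have h3 : μ * volume Q.toSet ≤
        eLpNorm u 2 (volume.restrict Q.toSet) * volume Q.toSet ^ (1 / 2 : ℝ) :=
      le_trans (by gcongr; exact hμ Q hQ) h2
    have h4 := pow_le_pow_left' h3 2
    have h5 : (volume Q.toSet ^ (1 / 2 : ℝ)) ^ 2 = volume Q.toSet := by
      rw [← ENNReal.rpow_natCast, ← ENNReal.rpow_mul]; simp
    rw [mul_pow, mul_pow, h5, pow_two (volume Q.toSet), ← mul_assoc] at h4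
    exact (ENNReal.mul_le_mul_iff_left Q.volume_ne_zero Q.volume_ne_top).1 h4)
  refine h1.trans ?_
  refine (measure_mono (Set.subset_univ _)).trans ?_
  rw [withDensity_apply _ MeasurableSet.univ, ← hL2, Measure.restrict_univ, Lp.enorm_def]

end MaxCubes

namespace HaarShift

variable {𝕜 : Type*} [RCLike 𝕜] {d : ℕ} (S : HaarShift 𝕜 d)

/-- The cubes of generation at most `L` below `Q`. -/
noncomputable def gensUpTo (L : ℕ) (Q : Cube d) : Finset (Cube d) :=
  open Classical in (Finset.range (L + 1)).biUnion fun l => S.gen l Q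

lemma mem_gensUpTo {L : ℕ} {Q R : Cube d} (hQ : Q ∈ S.grid) :
    R ∈ S.gensUpTo L Q ↔ ∃ l ≤ L, R ∈ subcubes S.grid l Q := by
  simp only [gensUpTo, Finset.mem_biUnion, Finset.mem_range, Nat.lt_succ_iff, S.mem_gen hQ]

lemma isNested_gensUpTo (hd : 0 < d) {L : ℕ} {Q : Cube d} (hQ : Q ∈ S.grid) :
    IsNested (S.gensUpTo L Q) :=
  S.isDyadicGrid.isNested hd fun _ hR => by
    obtain ⟨l, -, hl⟩ := (S.mem_gensUpTo hQ).1 hR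
    exact hl.1

lemma cubeAvg_le_parent {F : (Fin d → ℝ) → 𝕜} {Q P : Cube d} (hPQ : P ∈ subcubes S.grid 1 Q) :
    cubeAvg F P ≤ 2 ^ d * cubeAvg F Q := by
  have h1 := IsDyadicGrid.volume_subcubes hPQ
  rw [one_mul] at h1
  rw [cubeAvg, cubeAvg, h1, ← mul_div_assoc, ENNReal.mul_div_mul_left _ _ (by simp) (by simp)]
  gcongr
  exact hPQ.2.1

open Classical in
/-- The Calderón–Zygmund decomposition of `F` on `Q` at height `t`, stopped at generation `L`: the
family `ℬ` consists of the maximal cubes of generation at most `L` on which the average of `‖F‖`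
exceeds `t`, and `g` is the conditional expectation of `F` on the partition of `Q` formed by `ℬ` and
the remaining cubes of generation `L`. -/
lemma exists_goodPart (hd : 0 < d) {Q : Cube d} (hQ : Q ∈ S.grid) {F : (Fin d → ℝ) → 𝕜}
    (hF : IntegrableOn F Q.toSet) {t : ℝ≥0∞} (ht : cubeAvg F Q ≤ t) (L : ℕ) :
    ∃ (ℬ : Finset (Cube d)) (g : (Fin d → ℝ) → 𝕜),
      (∀ P ∈ ℬ, ∃ l ≤ L, P ∈ subcubes S.grid l Q) ∧
      (ℬ : Set (Cube d)).PairwiseDisjoint Cube.toSet ∧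
      t * volume (⋃ P ∈ ℬ, P.toSet) ≤ ∫⁻ y in Q.toSet, ‖F y‖ₑ ∧
      (∀ x ∈ Q.toSet, x ∉ ⋃ P ∈ ℬ, P.toSet →
        ∀ i ≤ L, cubeAvg F (gridCube S.grid Q i x) ≤ t) ∧
      Measurable g ∧ (∀ y, ‖g y‖ₑ ≤ 2 ^ d * t) ∧ (∀ y ∉ Q.toSet, g y = 0) ∧
      (∀ l ≤ L, ∀ R ∈ subcubes S.grid l Q,
        (∀ P ∈ ℬ, ∀ y ∈ P.toSet, y ∈ R.toSet → P.toSet ⊆ R.toSet) →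
        ∫ y in R.toSet, F y = ∫ y in R.toSet, g y) ∧
      (∀ P ∈ ℬ, ∫⁻ y in P.toSet, ‖g y‖ₑ ≤ ∫⁻ y in P.toSet, ‖F y‖ₑ) := by
  have hgrid := S.isDyadicGrid
  set 𝒬 := (S.gensUpTo L Q).filter fun P => t < cubeAvg F P with h𝒬
  have hn : IsNested 𝒬 := (S.isNested_gensUpTo hd hQ).mono (Finset.filter_subset _ _)
  set ℬ := maxCubes 𝒬 with hℬ
  have hℬ1 : ∀ P ∈ ℬ, ∃ l ≤ L, P ∈ subcubes S.grid l Q := fun P hP =>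
    (S.mem_gensUpTo hQ).1 (Finset.mem_filter.1 (maxCubes_subset 𝒬 hP)).1
  have hℬt : ∀ P ∈ 𝒬, t < cubeAvg F P := fun P hP => (Finset.mem_filter.1 hP).2
  set ℛ := (S.gen L Q).filter fun R => ∀ P ∈ ℬ, ¬ R.toSet ⊆ P.toSet with hℛ
  have hℛ1 : ∀ R ∈ ℛ, R ∈ subcubes S.grid L Q := fun R hR =>
    (S.mem_gen hQ).1 (Finset.mem_filter.1 hR).1
  set 𝒲 := ℬ ∪ ℛ with h𝒲
  have hbr : ∀ P ∈ ℬ, ∀ R ∈ ℛ, Disjoint P.toSet R.toSet := by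
    intro P hP R hR
    refine Set.disjoint_left.2 fun x hxP hxR => ?_
    obtain ⟨l, hl, hPl⟩ := hℬ1 P hP
    have h1 : R ∈ subcubes S.grid (l + (L - l)) Q := by
      rw [show l + (L - l) = L by omega]; exact hℛ1 R hR
    exact (Finset.mem_filter.1 hR).2 P hP (hgrid.subcubes_of_le hd hPl h1 hxP hxR).2.1
  have hdisjB : (ℬ : Set (Cube d)).PairwiseDisjoint Cube.toSet := maxCubes_pairwiseDisjoint hn
  have hdisj : (𝒲 : Set (Cube d)).PairwiseDisjoint Cube.toSet := by
    rw [h𝒲, Finset.coe_union, Set.pairwiseDisjoint_union]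
    refine ⟨hdisjB, ?_, fun P hP R hR _ => hbr P hP R hR⟩
    exact (S.gen_pairwiseDisjoint hQ (k := L)).subset
      (Finset.coe_subset.2 (Finset.filter_subset _ _))
  have h𝒲Q : ∀ P ∈ 𝒲, P.toSet ⊆ Q.toSet := by
    intro P hP
    rcases Finset.mem_union.1 hP with h | h
    · obtain ⟨l, -, hPl⟩ := hℬ1 P h
      exact hPl.2.1
    · exact (hℛ1 P h).2.1
  have hcover : ∀ x ∈ Q.toSet, ∃ P ∈ 𝒲, x ∈ P.toSet := by
    intro x hx
    obtain ⟨h1, h2⟩ := hgrid.gridCube_spec hQ L hx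
    by_cases h : ∀ P ∈ ℬ, ¬ (gridCube S.grid Q L x).toSet ⊆ P.toSet
    · exact ⟨_, Finset.mem_union_right _ (Finset.mem_filter.2 ⟨(S.mem_gen hQ).2 h1, h⟩), h2⟩
    · push Not at h
      obtain ⟨P, hP, hsub⟩ := h
      exact ⟨P, Finset.mem_union_left _ hP, hsub h2⟩
  have hFP : ∀ P ∈ 𝒲, IntegrableOn F P.toSet := fun P hP => hF.mono_set (h𝒲Q P hP)
  have h2d : (1 : ℝ≥0∞) ≤ 2 ^ d := one_le_pow₀ (by norm_num)
  have havg : ∀ P ∈ 𝒲, cubeAvg F P ≤ 2 ^ d * t := by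
    intro P hP
    rcases Finset.mem_union.1 hP with h | h
    · obtain ⟨l, hl, hPl⟩ := hℬ1 P h
      rcases l with _ | l
      · have : P = Q := hgrid.subcubes_eq hPl (IsDyadicGrid.self_mem_subcubes hQ) P.corner_mem
          (hPl.2.1 P.corner_mem)
        rw [this]
        exact ht.trans (le_mul_of_one_le_left zero_le h2d)
      · obtain ⟨h1, h2⟩ := hgrid.gridCube_spec hQ l (hPl.2.1 P.corner_mem)
        set P' := gridCube S.grid Q l P.corner
        have h3 : P ∈ subcubes S.grid 1 P' := hgrid.subcubes_of_le hd h1 hPl h2 P.corner_mem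
        have h4 : cubeAvg F P' ≤ t := by
          by_contra! hlt
          have h5 : P' ∈ 𝒬 := Finset.mem_filter.2
            ⟨(S.mem_gensUpTo hQ).2 ⟨l, by omega, h1⟩, hlt⟩
          have h6 := (Finset.mem_filter.1 h).2 P' h5 h3.2.1
          rw [← h6] at h1
          have := IsDyadicGrid.subcubes_index_unique h1 hPl
          omega
        exact (S.cubeAvg_le_parent h3).trans (by gcongr)
    · refine le_trans ?_ (le_mul_of_one_le_left zero_le h2d)
      by_contra! hlt
      have h5 : P ∈ 𝒬 := Finset.mem_filter.2
        ⟨(S.mem_gensUpTo hQ).2 ⟨L, le_rfl, hℛ1 P h⟩, hlt⟩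
      obtain ⟨P', hP', hsub⟩ := exists_mem_maxCubes hd h5
      exact (Finset.mem_filter.1 h).2 P' hP' hsub
  set c : Cube d → 𝕜 := fun P => (volume.real P.toSet)⁻¹ • ∫ y in P.toSet, F y with hc
  set g : (Fin d → ℝ) → 𝕜 := fun x => ∑ P ∈ 𝒲, P.toSet.indicator (fun _ => c P) x with hg
  have hgP : ∀ P ∈ 𝒲, ∀ x ∈ P.toSet, g x = c P := by
    intro P hP x hx
    have h1 := Finset.sum_eq_single_of_mem (f := fun P => P.toSet.indicator (fun _ => c P) x) P hP
      fun P' hP' hne => Set.indicator_of_notMem (fun hx' =>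
        Set.disjoint_left.1 (hdisj hP' hP hne) hx' hx) _
    rw [hg]
    simp only
    rw [h1, Set.indicator_of_mem hx]
  have hg0 : ∀ y ∉ Q.toSet, g y = 0 := fun y hy => Finset.sum_eq_zero fun P hP =>
    Set.indicator_of_notMem (fun h => hy (h𝒲Q P hP h)) _
  have hcb : ∀ P, ‖c P‖ₑ ≤ cubeAvg F P := by
    intro P
    rw [hc]
    simp only
    rw [enorm_smul, cubeAvg, ENNReal.div_eq_inv_mul]
    gcongr
    · rw [enorm_inv (show volume.real P.toSet ≠ 0 from
      (ENNReal.toReal_pos P.volume_ne_zero P.volume_ne_top).ne'), Measure.real,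
        Real.enorm_eq_ofReal ENNReal.toReal_nonneg, ENNReal.ofReal_toReal P.volume_ne_top]
    · exact enorm_integral_le_lintegral_enorm _
  have hgm : Measurable g :=
    Finset.measurable_fun_sum _ fun P _ => measurable_const.indicator P.measurableSet_toSet
  have hgb : ∀ y, ‖g y‖ₑ ≤ 2 ^ d * t := by
    intro y
    by_cases hy : y ∈ Q.toSet
    · obtain ⟨P, hP, hyP⟩ := hcover y hy
      rw [hgP P hP y hyP]
      exact (hcb P).trans (havg P hP)
    · rw [hg0 y hy, enorm_zero]; exact zero_le
  have hgint : ∀ P ∈ 𝒲, ∫ y in P.toSet, g y = ∫ y in P.toSet, F y := by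
    intro P hP
    rw [setIntegral_congr_fun P.measurableSet_toSet (hgP P hP), setIntegral_const, hc]
    simp only
    rw [smul_smul, mul_inv_cancel₀ (show volume.real P.toSet ≠ 0 from
        (ENNReal.toReal_pos P.volume_ne_zero P.volume_ne_top).ne'),
      one_smul]
  refine ⟨ℬ, g, hℬ1, hdisjB, ?_, ?_, hgm, hgb, hg0, ?_, ?_⟩
  · have h1 := mul_volume_biUnion_le hd hn (volume.withDensity fun y => ‖F y‖ₑ) (c := t) (by
      intro P hP
      rw [withDensity_apply _ P.measurableSet_toSet, ← cubeAvg_mul_volume]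
      gcongr
      exact (hℬt P hP).le)
    rw [hℬ, biUnion_maxCubes hd]
    refine h1.trans ?_
    rw [withDensity_apply _ (Finset.measurableSet_biUnion _ fun P _ => P.measurableSet_toSet)]
    refine lintegral_mono_set (Set.iUnion₂_subset fun P hP => ?_)
    obtain ⟨l, -, hPl⟩ := (S.mem_gensUpTo hQ).1 (Finset.mem_filter.1 hP).1
    exact hPl.2.1
  · intro x hx hxB i hi
    by_contra! hlt
    obtain ⟨h1, h2⟩ := hgrid.gridCube_spec hQ i hx
    have h5 : gridCube S.grid Q i x ∈ 𝒬 := Finset.mem_filter.2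
      ⟨(S.mem_gensUpTo hQ).2 ⟨i, hi, h1⟩, hlt⟩
    rw [hℬ, biUnion_maxCubes hd] at hxB
    exact hxB (Set.mem_biUnion (Finset.mem_coe.2 h5) h2)
  · intro l hl R hR hcomp
    set 𝒰 := 𝒲.filter fun P => P.toSet ⊆ R.toSet
    have hU : R.toSet = ⋃ P ∈ 𝒰, P.toSet := by
      refine subset_antisymm (fun x hx => ?_)
        (Set.iUnion₂_subset fun P hP => (Finset.mem_filter.1 hP).2)
      obtain ⟨P, hP, hxP⟩ := hcover x (hR.2.1 hx)
      refine Set.mem_biUnion (Finset.mem_coe.2 (Finset.mem_filter.2 ⟨hP, ?_⟩)) hxP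
      rcases Finset.mem_union.1 hP with h | h
      · exact hcomp P h x hxP hx
      · have h1 : P ∈ subcubes S.grid (l + (L - l)) Q := by
          rw [show l + (L - l) = L by omega]; exact hℛ1 P h
        exact (hgrid.subcubes_of_le hd hR h1 hx hxP).2.1
    have hd' : (𝒰 : Set (Cube d)).PairwiseDisjoint Cube.toSet :=
      hdisj.subset (Finset.coe_subset.2 (Finset.filter_subset _ _))
    have hgi : ∀ P ∈ 𝒰, IntegrableOn g P.toSet := fun P hP =>
      (integrableOn_const (C := c P) P.volume_ne_top).congr_fun
        (fun y hy => (hgP P (Finset.mem_filter.1 hP).1 y hy).symm) P.measurableSet_toSet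
    rw [hU, integral_biUnion_finset _ (fun P _ => P.measurableSet_toSet) hd'
      (fun P hP => hFP P (Finset.mem_filter.1 hP).1),
      integral_biUnion_finset _ (fun P _ => P.measurableSet_toSet) hd' hgi]
    exact Finset.sum_congr rfl fun P hP => (hgint P (Finset.mem_filter.1 hP).1).symm
  · intro P hP
    rw [setLIntegral_congr_fun P.measurableSet_toSet
      (fun y hy => by rw [hgP P (Finset.mem_union_left _ hP) y hy]), setLIntegral_const,
      ← cubeAvg_mul_volume F P]
    gcongr
    exact hcb P

end HaarShift

/-! ### The exceptional set of a cube -/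

namespace HaarShift

variable {𝕜 : Type*} [RCLike 𝕜] {d : ℕ} (S : HaarShift 𝕜 d)

lemma cubeAvg_subcube_eq_zero {F : (Fin d → ℝ) → 𝕜} {Q R : Cube d} (h : cubeAvg F Q = 0)
    (hR : R.toSet ⊆ Q.toSet) : cubeAvg F R = 0 := by
  have h1 : ∫⁻ y in Q.toSet, ‖F y‖ₑ = 0 := by rw [← cubeAvg_mul_volume, h, zero_mul]
  rw [cubeAvg, le_antisymm ((lintegral_mono_set hR).trans h1.le) zero_le, ENNReal.zero_div]

lemma enorm_partialSum_le_sum {Q : Cube d} (hQ : Q ∈ S.grid) (j : ℕ) (F : (Fin d → ℝ) → 𝕜)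
    {x : Fin d → ℝ} (hx : x ∈ Q.toSet) :
    ‖S.partialSum Q j F x‖ₑ ≤ ∑ i ∈ Finset.range (j + 1), cubeAvg F (gridCube S.grid Q i x) :=
  (enorm_sum_le _ _).trans (Finset.sum_le_sum fun i _ =>
    S.enorm_component_le_avg (S.isDyadicGrid.gridCube_spec hQ i hx).1.1 F x)

open Classical in
/-- Let `b` have integral zero on every cube of generation at most `k + n + 1` that swallows all the
cubes of `ℬ` it meets. Then off `⋃ ℬ` a component of generation `l` sees only the restriction of `b`
to the cubes of `ℬ` of generations in `(l, l + n]`, and each cube of `ℬ` is counted for at most `n`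
values of `l`. -/
lemma exists_badPart_bound (hd : 0 < d) {Q : Cube d} (hQ : Q ∈ S.grid) {b : (Fin d → ℝ) → 𝕜}
    (hb : IntegrableOn b Q.toSet) {ℬ : Finset (Cube d)}
    (hℬ : ∀ P ∈ ℬ, ∃ l, P ∈ subcubes S.grid l Q)
    (hdisj : (ℬ : Set (Cube d)).PairwiseDisjoint Cube.toSet) {k : ℕ}
    (hint : ∀ l ≤ k + S.n + 1, ∀ R ∈ subcubes S.grid l Q,
      (∀ P ∈ ℬ, ∀ y ∈ P.toSet, y ∈ R.toSet → P.toSet ⊆ R.toSet) → ∫ y in R.toSet, b y = 0) :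
    ∃ s : (Fin d → ℝ) → ℝ≥0∞, Measurable s ∧
      ∫⁻ x, s x ≤ S.n * ∫⁻ y in ⋃ P ∈ ℬ, P.toSet, ‖b y‖ₑ ∧
      ∀ x ∈ Q.toSet, x ∉ ⋃ P ∈ ℬ, P.toSet → ∀ j ≤ k, ‖S.partialSum Q j b x‖ₑ ≤ s x := by
  have hgrid := S.isDyadicGrid
  choose! e he using hℬ
  set V : ℕ → Set (Fin d → ℝ) := fun l =>
    ⋃ P ∈ ℬ.filter (fun P => l < e P ∧ e P ≤ l + S.n), P.toSet with hV
  have hVm : ∀ l, MeasurableSet (V l) := fun l =>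
    Finset.measurableSet_biUnion _ fun P _ => P.measurableSet_toSet
  have hVQ : ∀ l, V l ⊆ Q.toSet := fun l =>
    Set.iUnion₂_subset fun P hP => (he P (Finset.mem_filter.1 hP).1).2.1
  set β : ℕ → (Fin d → ℝ) → 𝕜 := fun l => (V l).indicator b with hβ
  have hβi : ∀ l, IntegrableOn (β l) Q.toSet := fun l => hb.indicator (hVm l)
  refine ⟨fun x => ∑ l ∈ Finset.range (k + 1), ∑ R ∈ S.gen l Q,
    R.toSet.indicator (fun _ => cubeAvg (β l) R) x, ?_, ?_, ?_⟩
  · exact Finset.measurable_fun_sum _ fun l _ => Finset.measurable_fun_sum _ fun R _ =>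
      measurable_const.indicator R.measurableSet_toSet
  · rw [lintegral_finsetSum _ fun l _ => Finset.measurable_fun_sum _ fun R _ =>
      measurable_const.indicator R.measurableSet_toSet]
    have h1 : ∀ l, ∫⁻ x, ∑ R ∈ S.gen l Q, R.toSet.indicator (fun _ => cubeAvg (β l) R) x =
        ∑ P ∈ ℬ, if l < e P ∧ e P ≤ l + S.n then ∫⁻ y in P.toSet, ‖b y‖ₑ else 0 := by
      intro l
      rw [lintegral_finsetSum _ fun R _ => measurable_const.indicator R.measurableSet_toSet]
      have h2 : ∀ R ∈ S.gen l Q, ∫⁻ x, R.toSet.indicator (fun _ => cubeAvg (β l) R) x =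
          ∫⁻ y in R.toSet, ‖β l y‖ₑ := fun R _ => by
        rw [lintegral_indicator_const R.measurableSet_toSet, cubeAvg_mul_volume]
      rw [Finset.sum_congr rfl h2, ← lintegral_biUnion_finset (S.gen_pairwiseDisjoint hQ)
        fun R _ => R.measurableSet_toSet, S.biUnion_gen l hQ, ← Finset.sum_filter,
        ← lintegral_biUnion_finset (hdisj.subset (Finset.coe_subset.2 (Finset.filter_subset _ _)))
        fun R _ => R.measurableSet_toSet]
      have h3 : ∀ y, ‖β l y‖ₑ = (V l).indicator (fun y => ‖b y‖ₑ) y := fun y =>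
        enorm_indicator_eq_indicator_enorm _ _
      simp only [h3]
      rw [lintegral_indicator (hVm l), Measure.restrict_restrict (hVm l),
        Set.inter_eq_left.2 (hVQ l)]
    rw [Finset.sum_congr rfl fun l _ => h1 l, Finset.sum_comm,
      lintegral_biUnion_finset hdisj fun R _ => R.measurableSet_toSet, Finset.mul_sum]
    refine Finset.sum_le_sum fun P _ => ?_
    rw [← Finset.sum_filter, Finset.sum_const, nsmul_eq_mul]
    gcongr
    calc _ ≤ (Finset.Ico (e P - S.n) (e P)).card := Finset.card_le_card fun l hl => by
          have := (Finset.mem_filter.1 hl).2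
          rw [Finset.mem_Ico]; omega
      _ ≤ S.n := by rw [Nat.card_Ico]; omega
  · intro x hx hxB j hj
    have hkey : ∀ l ≤ k, ‖S.component (gridCube S.grid Q l x) b x‖ₑ ≤
        ∑ R ∈ S.gen l Q, R.toSet.indicator (fun _ => cubeAvg (β l) R) x := by
      intro l hl
      obtain ⟨hR, hxR⟩ := hgrid.gridCube_spec hQ l hx
      set R := gridCube S.grid Q l x
      have h1 : S.component R b x = S.component R (β l) x := by
        refine S.component_congr hR.1 (hb.mono_set hR.2.1) ((hβi l).mono_set hR.2.1)
          (fun R' hR' => ?_) x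
        have hR'Q := IsDyadicGrid.subcubes_trans hR hR'
        by_cases h : ∃ P ∈ ℬ, (∃ y ∈ P.toSet, y ∈ R'.toSet) ∧ e P ≤ l + S.n
        · obtain ⟨P, hP, ⟨y, hyP, hyR⟩, heP⟩ := h
          have hlt : l < e P := by
            by_contra! hle
            have h2 : R ∈ subcubes S.grid (e P + (l - e P)) Q := by
              rw [show e P + (l - e P) = l by omega]; exact hR
            exact hxB (Set.mem_biUnion (Finset.mem_coe.2 hP)
              ((hgrid.subcubes_of_le hd (he P hP) h2 hyP (hR'.2.1 hyR)).2.1 hxR))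
          have h3 : R' ∈ subcubes S.grid (e P + (l + (S.n + 1) - e P)) Q := by
            rw [show e P + (l + (S.n + 1) - e P) = l + (S.n + 1) by omega]; exact hR'Q
          have h4 := (hgrid.subcubes_of_le hd (he P hP) h3 hyP hyR).2.1
          refine setIntegral_congr_fun R'.measurableSet_toSet fun z hz => ?_
          have : z ∈ V l := Set.mem_biUnion
            (Finset.mem_coe.2 (Finset.mem_filter.2 ⟨hP, hlt, heP⟩)) (h4 hz)
          simp only [hβ]
          rw [Set.indicator_of_mem this]
        · push Not at h
          rw [hint _ (by omega : l + (S.n + 1) ≤ k + S.n + 1) R' hR'Q fun P hP y hyP hyR => ?_]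
          · refine (setIntegral_eq_zero_of_forall_eq_zero fun z hz => ?_).symm
            refine Set.indicator_of_notMem (fun hzV => ?_) _
            obtain ⟨P, hP, hzP⟩ := Set.mem_iUnion₂.1 hzV
            obtain ⟨hPB, -, h5⟩ := Finset.mem_filter.1 hP
            exact absurd h5 (not_le.2 (h P hPB ⟨z, hzP, hz⟩))
          · have h5 := h P hP ⟨y, hyP, hyR⟩
            have h6 : P ∈ subcubes S.grid (l + (S.n + 1) + (e P - (l + (S.n + 1)))) Q := by
              rw [show l + (S.n + 1) + (e P - (l + (S.n + 1))) = e P by omega]; exact he P hP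
            exact (hgrid.subcubes_of_le hd hR'Q h6 hyR hyP).2.1
      rw [h1]
      refine (S.enorm_component_le hR.1 _ x).trans ?_
      exact Finset.single_le_sum (f := fun R => R.toSet.indicator (fun _ => cubeAvg (β l) R) x)
        (fun _ _ => zero_le) ((S.mem_gen hQ).2 hR)
    refine (enorm_sum_le _ _).trans ?_
    refine (Finset.sum_le_sum fun l hl => hkey l ?_).trans ?_
    · have := Finset.mem_range.1 hl; omega
    · exact Finset.sum_le_sum_of_subset (Finset.range_subset_range.2 (by omega))

/-- The constant of the sparse domination, for a shift whose operator has norm `Λ`. -/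
noncomputable def stoppingConst (Λ : ℝ≥0∞) : ℝ≥0∞ :=
  (4 * (Λ + 1) + (Λ * 2 ^ ((S.m + 1) * d) + 5)) * (2 ^ d * 8) + 16 * (S.n + 1)

/-- On at least half of `Q` neither the averages of `F` nor the partial sums of the shift up to
generation `k` exceed a multiple of the average of `F` over `Q`. -/
lemma volume_exceptional_le (hd : 0 < d)
    {T : Lp 𝕜 2 (volume : Measure (Fin d → ℝ)) →L[𝕜] Lp 𝕜 2 (volume : Measure (Fin d → ℝ))}
    (hT : S.Represents T) {Q : Cube d} (hQ : Q ∈ S.grid) {F : (Fin d → ℝ) → 𝕜}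
    (hF : IntegrableOn F Q.toSet) (k : ℕ) :
    2 * volume {x | x ∈ Q.toSet ∧ ∃ i ≤ k,
      S.stoppingConst ‖T‖ₑ * cubeAvg F Q < cubeAvg F (gridCube S.grid Q i x) ∨
      S.stoppingConst ‖T‖ₑ * cubeAvg F Q < ‖S.partialSum Q i F x‖ₑ} ≤ volume Q.toSet := by
  classical
  have hgrid := S.isDyadicGrid
  set a := cubeAvg F Q with ha
  set E := {x | x ∈ Q.toSet ∧ ∃ i ≤ k,
      S.stoppingConst ‖T‖ₑ * a < cubeAvg F (gridCube S.grid Q i x) ∨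
      S.stoppingConst ‖T‖ₑ * a < ‖S.partialSum Q i F x‖ₑ} with hE
  have hat : a ≠ ∞ := (ENNReal.div_lt_top hF.2.ne Q.volume_ne_zero).ne
  rcases eq_or_ne a 0 with h0 | h0
  · have : E = ∅ := by
      refine Set.eq_empty_of_forall_notMem fun x hx => ?_
      obtain ⟨hxQ, i, -, hi⟩ := hx
      have hz : ∀ i, cubeAvg F (gridCube S.grid Q i x) = 0 := fun i =>
        cubeAvg_subcube_eq_zero h0 (hgrid.gridCube_spec hQ i hxQ).1.2.1
      have h2 := S.enorm_partialSum_le_sum hQ i F hxQ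
      simp only [hz, Finset.sum_const_zero, nonpos_iff_eq_zero] at h2
      rw [h2, hz] at hi
      simp at hi
    rw [this]; simp
  set B : ℝ≥0∞ := 2 ^ d * (8 * a) with hB
  have hBt : B ≠ ∞ := ENNReal.mul_ne_top (by simp) (ENNReal.mul_ne_top (by simp) hat)
  have hB0 : B ≠ 0 := by simp [hB, h0]
  set Λ := ‖T‖ₑ with hΛ
  have hΛt : Λ ≠ ∞ := enorm_ne_top
  obtain ⟨ℬ, g, hℬ, hdisj, hvol, hgood, hgm, hgB, hg0, hint, hgF⟩ :=
    S.exists_goodPart hd hQ hF (t := 8 * a) (le_mul_of_one_le_left zero_le (by norm_num))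
      (k + S.n + 1)
  have hFa : ∫⁻ y in Q.toSet, ‖F y‖ₑ = a * volume Q.toSet := (cubeAvg_mul_volume F Q).symm
  set Ω := ⋃ P ∈ ℬ, P.toSet with hΩ
  have hΩm : MeasurableSet Ω := Finset.measurableSet_biUnion _ fun P _ => P.measurableSet_toSet
  have hΩQ : Ω ⊆ Q.toSet := Set.iUnion₂_subset fun P hP => by
    obtain ⟨l, -, hl⟩ := hℬ P hP
    exact hl.2.1
  have hΩv : 8 * volume Ω ≤ volume Q.toSet := by
    rw [hFa, mul_comm 8 a, mul_assoc] at hvol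
    exact (ENNReal.mul_le_mul_iff_right h0 hat).1 hvol
  -- the `L²` bound for the bounded function `g`, to be used with the weak type of averages
  have hgle : ∀ y, ‖g y‖ₑ ≤ Q.toSet.indicator (fun _ => B) y := by
    intro y
    by_cases hy : y ∈ Q.toSet
    · rw [Set.indicator_of_mem hy]; exact hgB y
    · rw [hg0 y hy, Set.indicator_of_notMem hy, enorm_zero]
  have hg2n : eLpNorm g 2 volume ≤ B * volume Q.toSet ^ (1 / 2 : ℝ) := by
    calc eLpNorm g 2 volume ≤ eLpNorm (Q.toSet.indicator fun _ => B) 2 volume :=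
          eLpNorm_mono_enorm fun y => by simpa using hgle y
      _ = _ := by
          rw [eLpNorm_indicator_const Q.measurableSet_toSet (by norm_num) (by norm_num)]
          simp
  have hg2 : MemLp g 2 volume := ⟨hgm.aestronglyMeasurable, hg2n.trans_lt
    (ENNReal.mul_lt_top hBt.lt_top (ENNReal.rpow_lt_top_of_nonneg (by norm_num) Q.volume_ne_top))⟩
  have hgQ : IntegrableOn g Q.toSet := ⟨hgm.aestronglyMeasurable, lt_of_le_of_lt
    (lintegral_mono hgB) (by
      rw [setLIntegral_const]
      exact ENNReal.mul_lt_top hBt.lt_top Q.volume_ne_top.lt_top)⟩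
  set u := T (hg2.toLp g) with hu
  have hun : ‖u‖ₑ ^ 2 ≤ Λ ^ 2 * B ^ 2 * volume Q.toSet := by
    have h1 : ‖u‖ₑ ≤ Λ * (B * volume Q.toSet ^ (1 / 2 : ℝ)) := by
      refine (T.le_opENorm _).trans ?_
      rw [Lp.enorm_toLp]
      gcongr
    refine (pow_le_pow_left' h1 2).trans_eq ?_
    rw [mul_pow, mul_pow, ← ENNReal.rpow_natCast (volume Q.toSet ^ (1 / 2 : ℝ)),
      ← ENNReal.rpow_mul]
    simp [mul_assoc]
  set μ : ℝ≥0∞ := 4 * (Λ + 1) * B with hμ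
  set 𝒬 := (S.gensUpTo (k + (S.m + 1)) Q).filter fun P => μ < cubeAvg u P with h𝒬
  set ET := ⋃ P ∈ 𝒬, P.toSet with hET
  have hETv : 8 * volume ET ≤ volume Q.toSet := by
    have h1 := sq_mul_volume_le hd ((S.isNested_gensUpTo hd hQ).mono (Finset.filter_subset _ _))
      u (μ := μ) (𝒬 := 𝒬) fun P hP => (Finset.mem_filter.1 hP).2.le
    have h2 : ((Λ + 1) ^ 2 * B ^ 2) * (8 * volume ET) ≤ ((Λ + 1) ^ 2 * B ^ 2) * volume Q.toSet :=
      calc ((Λ + 1) ^ 2 * B ^ 2) * (8 * volume ET)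
          = 8 * ((Λ + 1) ^ 2 * B ^ 2 * volume ET) := by ring
        _ ≤ 16 * ((Λ + 1) ^ 2 * B ^ 2 * volume ET) := by gcongr; norm_num
        _ = μ ^ 2 * volume ET := by rw [hμ]; ring
        _ ≤ Λ ^ 2 * B ^ 2 * volume Q.toSet := h1.trans hun
        _ ≤ _ := by gcongr; exact le_self_add
    refine (ENNReal.mul_le_mul_iff_right ?_ ?_).1 h2
    · simp [hB0]
    · exact ENNReal.mul_ne_top (ENNReal.pow_ne_top (by simp [hΛt])) (ENNReal.pow_ne_top hBt)
  -- off the bad cubes the bad part is dominated by an integrable function `s`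
  set b : (Fin d → ℝ) → 𝕜 := fun y => F y - g y with hb
  obtain ⟨s, hsm, hsint, hs⟩ := S.exists_badPart_bound hd hQ (b := b) (hF.sub hgQ)
    (fun P hP => (hℬ P hP).imp fun _ h => h.2) hdisj (k := k) (fun l hl R hR h => by
      rw [hb, integral_sub (hF.mono_set hR.2.1) (hgQ.mono_set hR.2.1), hint l hl R hR h, sub_self])
  set ES := {x | 16 * (S.n + 1) * a < s x} with hES
  have hESv : 8 * volume ES ≤ volume Q.toSet := by
    have h1 : 16 * (S.n + 1) * a * volume ES ≤ ∫⁻ x, s x := by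
      refine le_trans ?_ (mul_meas_ge_le_lintegral hsm (16 * (S.n + 1) * a))
      have h2 : ES ⊆ {x | 16 * (S.n + 1) * a ≤ s x} := fun x hx =>
        Set.mem_ofPred_eq ▸ le_of_lt (α := ℝ≥0∞) hx
      gcongr
    have h2 : ∫⁻ y in Ω, ‖b y‖ₑ ≤ 2 * (a * volume Q.toSet) := by
      rw [hΩ, lintegral_biUnion_finset hdisj fun R _ => R.measurableSet_toSet]
      calc ∑ P ∈ ℬ, ∫⁻ y in P.toSet, ‖b y‖ₑ ≤ ∑ P ∈ ℬ, 2 * ∫⁻ y in P.toSet, ‖F y‖ₑ := by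
            refine Finset.sum_le_sum fun P hP => ?_
            calc ∫⁻ y in P.toSet, ‖b y‖ₑ ≤ ∫⁻ y in P.toSet, (‖F y‖ₑ + ‖g y‖ₑ) :=
                  lintegral_mono fun y => enorm_sub_le
              _ = (∫⁻ y in P.toSet, ‖F y‖ₑ) + ∫⁻ y in P.toSet, ‖g y‖ₑ :=
                  lintegral_add_right _ hgm.enorm
              _ ≤ _ := by rw [two_mul]; exact add_le_add_right (hgF P hP) _
        _ = 2 * ∫⁻ y in Ω, ‖F y‖ₑ := by
            rw [← Finset.mul_sum, hΩ,
              lintegral_biUnion_finset hdisj fun R _ => R.measurableSet_toSet]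
        _ ≤ _ := by rw [← hFa]; gcongr
    have h3 : (2 * (S.n + 1) * a) * (8 * volume ES) ≤ (2 * (S.n + 1) * a) * volume Q.toSet :=
      calc (2 * (S.n + 1) * a) * (8 * volume ES) = 16 * (S.n + 1) * a * volume ES := by ring
        _ ≤ S.n * (2 * (a * volume Q.toSet)) := h1.trans (hsint.trans (by gcongr))
        _ ≤ (S.n + 1) * (2 * (a * volume Q.toSet)) := by gcongr; exact le_self_add
        _ = _ := by ring
    refine (ENNReal.mul_le_mul_iff_right ?_ ?_).1 h3
    · simp [h0]
    · exact ENNReal.mul_ne_top (ENNReal.mul_ne_top (by simp) (by simp)) hat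
  have hsub : E ⊆ Ω ∪ ET ∪ ES := by
    rintro x ⟨hxQ, i, hi, hor⟩
    by_contra hx
    simp only [Set.mem_union, not_or] at hx
    obtain ⟨⟨hxΩ, hxT⟩, hxS⟩ := hx
    rcases hor with hor | hor
    · refine absurd (hgood x hxQ hxΩ i (by omega)) (not_le.2 (lt_of_le_of_lt ?_ hor))
      gcongr
      rw [stoppingConst]
      calc (8 : ℝ≥0∞) ≤ 16 * 1 := by norm_num
        _ ≤ 16 * (S.n + 1) := by gcongr; exact le_add_self
        _ ≤ _ := le_add_self
    · refine absurd hor (not_lt.2 ?_)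
      have h1 : S.partialSum Q i F x = S.partialSum Q i g x + S.partialSum Q i b x := by
        rw [partialSum, partialSum, partialSum, ← Finset.sum_add_distrib]
        refine Finset.sum_congr rfl fun l _ => ?_
        have hR := (hgrid.gridCube_spec hQ l hxQ).1
        rw [hb, S.component_sub hR.1 (hF.mono_set hR.2.1) (hgQ.mono_set hR.2.1)]
        ring
      have h2 := S.enorm_partialSum_le_of_bounded hd hT hQ hg2 hBt hgB hg0 i hxQ
      have h3 : cubeAvg u (gridCube S.grid Q (i + (S.m + 1)) x) ≤ μ := by
        by_contra! hlt
        obtain ⟨hP, hxP⟩ := hgrid.gridCube_spec hQ (i + (S.m + 1)) hxQ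
        exact hxT (Set.mem_biUnion (Finset.mem_coe.2 (Finset.mem_filter.2
          ⟨(S.mem_gensUpTo hQ).2 ⟨_, by omega, hP⟩, hlt⟩)) hxP)
      have h4 : s x ≤ 16 * (S.n + 1) * a := not_lt.1 hxS
      calc ‖S.partialSum Q i F x‖ₑ ≤ ‖S.partialSum Q i g x‖ₑ + ‖S.partialSum Q i b x‖ₑ := by
            rw [h1]; exact enorm_add_le _ _
        _ ≤ (μ + (Λ * 2 ^ ((S.m + 1) * d) + 5) * B) + 16 * (S.n + 1) * a := by
            gcongr
            · exact h2.trans (by gcongr)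
            · exact (hs x hxQ hxΩ i hi).trans h4
        _ = S.stoppingConst Λ * a := by rw [stoppingConst, hμ, hB]; ring
  have h8 : 8 * volume E ≤ 3 * volume Q.toSet :=
    calc 8 * volume E ≤ 8 * (volume Ω + volume ET + volume ES) := by
          gcongr
          exact (measure_mono hsub).trans ((measure_union_le _ _).trans
            (by gcongr; exact measure_union_le _ _))
      _ = 8 * volume Ω + 8 * volume ET + 8 * volume ES := by ring
      _ ≤ volume Q.toSet + volume Q.toSet + volume Q.toSet := by gcongr
      _ = _ := by ring
  refine (ENNReal.mul_le_mul_iff_right (a := 4) (by norm_num) (by norm_num)).1 ?_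
  calc 4 * (2 * volume E) = 8 * volume E := by ring
    _ ≤ 3 * volume Q.toSet := h8
    _ ≤ 4 * volume Q.toSet := by gcongr; norm_num

end HaarShift

/-! ### Sparse domination -/

namespace HaarShift

variable {𝕜 : Type*} [RCLike 𝕜] {d : ℕ} (S : HaarShift 𝕜 d)

lemma one_le_stoppingConst (Λ : ℝ≥0∞) : 1 ≤ S.stoppingConst Λ := by
  rw [stoppingConst]
  calc (1 : ℝ≥0∞) ≤ 16 * 1 := by norm_num
    _ ≤ 16 * (S.n + 1) := by gcongr; exact le_add_self
    _ ≤ _ := le_add_self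

lemma partialSum_eq_add {Q P : Cube d} (hQ : Q ∈ S.grid) {i j : ℕ}
    (hP : P ∈ subcubes S.grid (i + 1) Q) (hj : i + 1 ≤ j) (F : (Fin d → ℝ) → 𝕜)
    {x : Fin d → ℝ} (hx : x ∈ P.toSet) :
    S.partialSum Q j F x = S.partialSum Q i F x + S.partialSum P (j - (i + 1)) F x := by
  have h1 : ∀ l, gridCube S.grid Q (i + 1 + l) x = gridCube S.grid P l x := by
    intro l
    obtain ⟨h2, h3⟩ := S.isDyadicGrid.gridCube_spec hP.1 l hx
    exact S.isDyadicGrid.gridCube_eq hQ (IsDyadicGrid.subcubes_trans hP h2) h3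
  rw [partialSum, show j + 1 = (i + 1) + (j - (i + 1) + 1) by omega, Finset.sum_range_add,
    partialSum, partialSum]
  simp only [h1]

open Classical in
/-- Sparse domination of the partial sums up to generation `k`. The stopping cubes of `Q` are the
maximal cubes at which the average of `F` or a partial sum that is constant there is too large;
the construction is repeated below each of them. -/
lemma exists_sparse_domination (hd : 0 < d)
    {T : Lp 𝕜 2 (volume : Measure (Fin d → ℝ)) →L[𝕜] Lp 𝕜 2 (volume : Measure (Fin d → ℝ))}
    (hT : S.Represents T) (F : (Fin d → ℝ) → 𝕜) (k : ℕ) : ∀ Q ∈ S.grid, IntegrableOn F Q.toSet →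
    ∃ 𝒮 : Finset (Cube d), (∀ P ∈ 𝒮, P ∈ S.grid ∧ P.toSet ⊆ Q.toSet) ∧ IsSparse 𝒮 ∧
      ∀ x ∈ Q.toSet, ∀ j ≤ k, ‖S.partialSum Q j F x‖ₑ ≤ (S.m + 2) * S.stoppingConst ‖T‖ₑ *
        ∑ P ∈ 𝒮, P.toSet.indicator (fun _ => cubeAvg F P) x := by
  induction k using Nat.strong_induction_on with
  | _ k ih =>
  intro Q hQ hF
  have hgrid := S.isDyadicGrid
  set C := S.stoppingConst ‖T‖ₑ with hC
  have hC1 : 1 ≤ C := S.one_le_stoppingConst _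
  set a := cubeAvg F Q with ha
  set 𝒬 := (S.gensUpTo k Q).filter fun P => ∃ i, P ∈ subcubes S.grid (i + 1) Q ∧ i + 1 ≤ k ∧
    (C * a < cubeAvg F P ∨ ∃ l, i + 1 = l + (S.m + 1) ∧
      ∃ y ∈ P.toSet, C * a < ‖S.partialSum Q l F y‖ₑ) with h𝒬
  have hn : IsNested 𝒬 := (S.isNested_gensUpTo hd hQ).mono (Finset.filter_subset _ _)
  set 𝒯 := maxCubes 𝒬 with h𝒯
  have hdisj : (𝒯 : Set (Cube d)).PairwiseDisjoint Cube.toSet := maxCubes_pairwiseDisjoint hn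
  have hmem𝒬 : ∀ P i, P ∈ subcubes S.grid (i + 1) Q → i + 1 ≤ k →
      (C * a < cubeAvg F P ∨ ∃ l, i + 1 = l + (S.m + 1) ∧
        ∃ y ∈ P.toSet, C * a < ‖S.partialSum Q l F y‖ₑ) → P ∈ 𝒬 := fun P i h1 h2 h3 =>
    Finset.mem_filter.2 ⟨(S.mem_gensUpTo hQ).2 ⟨_, h2, h1⟩, i, h1, h2, h3⟩
  have hgenT : ∀ P ∈ 𝒯, ∃ i, P ∈ subcubes S.grid (i + 1) Q ∧ i + 1 ≤ k := fun P hP => by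
    obtain ⟨-, i, h1, h2, -⟩ := Finset.mem_filter.1 (maxCubes_subset 𝒬 hP)
    exact ⟨i, h1, h2⟩
  choose! e he hek using hgenT
  have hvol : 2 * volume (⋃ P ∈ 𝒯, P.toSet) ≤ volume Q.toSet := by
    refine le_trans ?_ (S.volume_exceptional_le hd hT hQ hF k)
    gcongr 2 * volume ?_
    refine Set.iUnion₂_subset fun P hP x hx => ?_
    obtain ⟨-, i, h1, h2, h3⟩ := Finset.mem_filter.1 (maxCubes_subset 𝒬 hP)
    refine ⟨h1.2.1 hx, ?_⟩
    rcases h3 with h3 | ⟨l, hl, y, hy, h3⟩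
    · exact ⟨i + 1, h2, Or.inl (by rwa [hgrid.gridCube_eq hQ h1 hx])⟩
    · rw [hl] at h1
      exact ⟨l, by omega, Or.inr (by rwa [S.partialSum_eq_of_mem hd hQ h1 F hy hx])⟩
  -- if no selected cube of generation at most `j` contains `x`, the partial sum up to `j - (m + 1)`
  -- is at most `C * a`, and the remaining `m + 1` components are bounded by averages
  have hA : ∀ x ∈ Q.toSet, ∀ j ≤ k, (∀ P ∈ 𝒯, x ∈ P.toSet → j < e P + 1) →
      ‖S.partialSum Q j F x‖ₑ ≤ (S.m + 2) * C * a := by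
    intro x hx j hj hno
    have hnot : ∀ i, i + 1 ≤ j → gridCube S.grid Q (i + 1) x ∉ 𝒬 := by
      intro i hi h
      obtain ⟨h1, h2⟩ := hgrid.gridCube_spec hQ (i + 1) hx
      obtain ⟨P, hP, hsub⟩ := exists_mem_maxCubes hd h
      have h3 := hno P hP (hsub h2)
      have h4 : P ∈ subcubes S.grid (i + 1 + (e P + 1 - (i + 1))) Q := by
        rw [show i + 1 + (e P + 1 - (i + 1)) = e P + 1 by omega]; exact he P hP
      have h5 := hgrid.subcubes_of_le hd h1 h4 h2 (hsub h2)
      have h6 : P = gridCube S.grid Q (i + 1) x := Cube.eq_of_toSet_eq hd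
        (subset_antisymm h5.2.1 hsub)
      have := IsDyadicGrid.subcubes_index_unique (he P hP) (h6 ▸ h1)
      omega
    have havg : ∀ i ≤ j, cubeAvg F (gridCube S.grid Q i x) ≤ C * a := by
      intro i hi
      obtain ⟨h1, h2⟩ := hgrid.gridCube_spec hQ i hx
      rcases i with _ | i
      · rw [hgrid.gridCube_eq hQ (IsDyadicGrid.self_mem_subcubes hQ) hx]
        exact le_mul_of_one_le_left zero_le hC1
      · by_contra! hlt
        exact hnot i hi (hmem𝒬 _ i h1 (by omega) (Or.inl hlt))
    have hsum : ∀ l, j ≤ l + (S.m + 1) →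
        ∑ i ∈ Finset.Ico (l + 1) (j + 1), cubeAvg F (gridCube S.grid Q i x) ≤
          (S.m + 1) * (C * a) := by
      intro l hl
      calc ∑ i ∈ Finset.Ico (l + 1) (j + 1), cubeAvg F (gridCube S.grid Q i x)
          ≤ ∑ i ∈ Finset.Ico (l + 1) (j + 1), C * a := Finset.sum_le_sum fun i hi =>
            havg i (by have := Finset.mem_Ico.1 hi; omega)
        _ = ((j + 1 - (l + 1) : ℕ) : ℝ≥0∞) * (C * a) := by
            rw [Finset.sum_const, nsmul_eq_mul, Nat.card_Ico]
        _ ≤ ((S.m + 1 : ℕ) : ℝ≥0∞) * (C * a) := by gcongr; omega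
        _ = _ := by push_cast; ring
    by_cases hjm : S.m + 1 ≤ j
    · obtain ⟨l, rfl⟩ : ∃ l, j = l + (S.m + 1) := ⟨j - (S.m + 1), by omega⟩
      have h1 : ‖S.partialSum Q l F x‖ₑ ≤ C * a := by
        by_contra! hlt
        obtain ⟨h1, h2⟩ := hgrid.gridCube_spec hQ (l + S.m + 1) hx
        exact hnot (l + S.m) (by omega) (hmem𝒬 _ _ h1 (by omega)
          (Or.inr ⟨l, by omega, x, h2, hlt⟩))
      rw [S.partialSum_eq_add_middleSum Q (by omega : l ≤ l + (S.m + 1))]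
      calc _ ≤ ‖S.partialSum Q l F x‖ₑ + ‖S.middleSum Q l (l + (S.m + 1)) F x‖ₑ := enorm_add_le _ _
        _ ≤ C * a + (S.m + 1) * (C * a) := by
            gcongr
            refine ((enorm_sum_le _ _).trans (Finset.sum_le_sum fun i _ => ?_)).trans
              (hsum l le_rfl)
            exact S.enorm_component_le_avg (hgrid.gridCube_spec hQ i hx).1.1 F x
        _ = _ := by ring
    · refine (S.enorm_partialSum_le_sum hQ j F hx).trans ?_
      calc ∑ i ∈ Finset.range (j + 1), cubeAvg F (gridCube S.grid Q i x)
          ≤ ∑ i ∈ Finset.range (j + 1), C * a := Finset.sum_le_sum fun i hi =>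
            havg i (by have := Finset.mem_range.1 hi; omega)
        _ = ((j + 1 : ℕ) : ℝ≥0∞) * (C * a) := by
            rw [Finset.sum_const, nsmul_eq_mul, Finset.card_range]
        _ ≤ ((S.m + 2 : ℕ) : ℝ≥0∞) * (C * a) := by
            gcongr ?_ * _
            exact_mod_cast (by omega : j + 1 ≤ S.m + 2)
        _ = _ := by push_cast; ring
  have ih' : ∀ P ∈ 𝒯, ∃ 𝒮 : Finset (Cube d), (∀ R ∈ 𝒮, R ∈ S.grid ∧ R.toSet ⊆ P.toSet) ∧
      IsSparse 𝒮 ∧ ∀ x ∈ P.toSet, ∀ j ≤ k - (e P + 1), ‖S.partialSum P j F x‖ₑ ≤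
        (S.m + 2) * C * ∑ R ∈ 𝒮, R.toSet.indicator (fun _ => cubeAvg F R) x := fun P hP =>
    ih (k - (e P + 1)) (by have := hek P hP; omega) P (he P hP).1 (hF.mono_set (he P hP).2.1)
  choose! 𝒮 h𝒮1 h𝒮2 h𝒮3 using ih'
  have hPQ : ∀ P ∈ 𝒯, ¬ Q.toSet ⊆ P.toSet := fun P hP hsub => by
    have h1 : P = Q := Cube.eq_of_toSet_eq hd (subset_antisymm (he P hP).2.1 hsub)
    have h2 := he P hP
    rw [h1] at h2
    exact absurd (IsDyadicGrid.subcubes_index_unique h2 (IsDyadicGrid.self_mem_subcubes hQ))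
      (by omega)
  have hQn : Q ∉ 𝒯.biUnion 𝒮 := fun h => by
    obtain ⟨P, hP, hR⟩ := Finset.mem_biUnion.1 h
    exact hPQ P hP (h𝒮1 P hP Q hR).2
  refine ⟨insert Q (𝒯.biUnion 𝒮), ?_, ?_, ?_⟩
  · intro R hR
    rcases Finset.mem_insert.1 hR with rfl | hR
    · exact ⟨hQ, subset_rfl⟩
    · obtain ⟨P, hP, hR⟩ := Finset.mem_biUnion.1 hR
      exact ⟨(h𝒮1 P hP R hR).1, (h𝒮1 P hP R hR).2.trans (he P hP).2.1⟩
  · intro R hR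
    rcases Finset.mem_insert.1 hR with rfl | hR
    · refine le_trans ?_ hvol
      gcongr 2 * volume ?_
      refine Set.iUnion₂_subset fun R' hR' => ?_
      obtain ⟨h1, h2⟩ := Finset.mem_filter.1 hR'
      rcases Finset.mem_insert.1 h1 with rfl | h1
      · exact absurd h2 (ssubset_irrefl _)
      · obtain ⟨P, hP, hR'⟩ := Finset.mem_biUnion.1 h1
        exact (h𝒮1 P hP R' hR').2.trans
          (Set.subset_biUnion_of_mem (u := Cube.toSet) (Finset.mem_coe.2 hP))
    · obtain ⟨P, hP, hRP⟩ := Finset.mem_biUnion.1 hR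
      refine le_trans ?_ (h𝒮2 P hP R hRP)
      gcongr 2 * volume ?_
      refine Set.biUnion_subset_biUnion_left fun R' hR' => ?_
      obtain ⟨h1, h2⟩ := Finset.mem_filter.1 hR'
      refine Finset.mem_filter.2 ⟨?_, h2⟩
      rcases Finset.mem_insert.1 h1 with rfl | h1
      · exact absurd (h2.subset.trans (h𝒮1 P hP R hRP).2) (hPQ P hP)
      · obtain ⟨P', hP', hR'⟩ := Finset.mem_biUnion.1 h1
        have h3 : P' = P := by
          by_contra hne
          exact Set.disjoint_left.1 (hdisj hP' hP hne) ((h𝒮1 P' hP' R' hR').2 R'.corner_mem)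
            ((h𝒮1 P hP R hRP).2 (h2.subset R'.corner_mem))
        exact h3 ▸ hR'
  · intro x hx j hj
    rw [Finset.sum_insert hQn, Set.indicator_of_mem hx]
    by_cases h : ∃ P ∈ 𝒯, x ∈ P.toSet ∧ e P + 1 ≤ j
    · obtain ⟨P, hP, hxP, hle⟩ := h
      have huniq : ∀ P' ∈ 𝒯, x ∈ P'.toSet → P' = P := fun P' hP' hx' => by
        by_contra hne
        exact Set.disjoint_left.1 (hdisj hP' hP hne) hx' hxP
      rw [S.partialSum_eq_add hQ (he P hP) hle F hxP, mul_add]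
      refine (enorm_add_le _ _).trans (add_le_add ?_ ?_)
      · exact hA x hx (e P) (by omega) fun P' hP' hx' => by rw [huniq P' hP' hx']; omega
      · refine (h𝒮3 P hP x hxP _ (by omega)).trans ?_
        gcongr
        exact Finset.subset_biUnion_of_mem 𝒮 hP
    · push Not at h
      refine (hA x hx j hj fun P hP hxP => h P hP hxP).trans ?_
      gcongr
      exact le_self_add

end HaarShift

/-! ### From sparse operators to the maximal truncation -/

section Chains

variable {d : ℕ} {D : Set (Cube d)}

lemma IsDyadicGrid.two_mul_volume_le (hd : 0 < d) (h : IsDyadicGrid D) {P R : Cube d} (hP : P ∈ D)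
    (hR : R ∈ D) (hPR : P.toSet ⊂ R.toSet) : 2 * volume P.toSet ≤ volume R.toSet := by
  obtain ⟨k, hk⟩ := h.exists_subcubes hd hP hR P.corner_mem (hPR.subset P.corner_mem)
    (h.side_lt_of_ssubset hd hP hR hPR).le
  have hk0 : k ≠ 0 := by
    rintro rfl
    have := h.subcubes_eq hk (IsDyadicGrid.self_mem_subcubes hR) P.corner_mem
      (hPR.subset P.corner_mem)
    rw [this] at hPR
    exact ssubset_irrefl _ hPR
  rw [IsDyadicGrid.volume_subcubes hk]
  gcongr
  calc (2 : ℝ≥0∞) = 2 ^ 1 := (pow_one _).symm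
    _ ≤ 2 ^ (k * d) := pow_le_pow_right₀ (by norm_num) (Nat.mul_pos (Nat.pos_of_ne_zero hk0) hd)

open Classical in
/-- A chain of cubes of a grid is sparse, since every cube has at most half the volume of the next
one. -/
lemma IsDyadicGrid.isSparse_of_subset (hd : 0 < d) (h : IsDyadicGrid D) {𝒜 : Finset (Cube d)}
    {Q : Cube d} (h𝒜 : ∀ R ∈ 𝒜, R ∈ D ∧ Q.toSet ⊆ R.toSet) : IsSparse 𝒜 := by
  intro R hR
  rcases (𝒜.filter fun R' => R'.toSet ⊂ R.toSet).eq_empty_or_nonempty with he | hne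
  · rw [he]; simp
  obtain ⟨P, hP, hmax⟩ := Finset.exists_max_image _ Cube.side hne
  obtain ⟨hP1, hP2⟩ := Finset.mem_filter.1 hP
  refine le_trans ?_ (h.two_mul_volume_le hd (h𝒜 P hP1).1 (h𝒜 R hR).1 hP2)
  gcongr 2 * volume ?_
  refine Set.iUnion₂_subset fun R' hR' => ?_
  have h1 := h𝒜 R' (Finset.mem_filter.1 hR').1
  exact h.subset_of_side_le hd h1.1 (h𝒜 P hP1).1 (hmax R' hR') (h1.2 Q.corner_mem)
    ((h𝒜 P hP1).2 Q.corner_mem)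

lemma IsDyadicGrid.countable_superset (hd : 0 < d) (h : IsDyadicGrid D) {Q : Cube d} (hQ : Q ∈ D) :
    {R | R ∈ D ∧ Q.toSet ⊆ R.toSet}.Countable := by
  have hanc : ∀ R ∈ {R | R ∈ D ∧ Q.toSet ⊆ R.toSet}, ∃ k, Q ∈ subcubes D k R := fun R hR =>
    h.exists_subcubes hd hQ hR.1 Q.corner_mem (hR.2 Q.corner_mem) (Cube.side_le_of_subset hd hR.2)
  choose! k hk using hanc
  refine Set.countable_iff_exists_injOn.2 ⟨k, fun R hR R' hR' heq => ?_⟩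
  refine h.eq_of_mem_of_side_eq hR.1 hR'.1 ?_ (hR.2 Q.corner_mem) (hR'.2 Q.corner_mem)
  have h1 := (hk R hR).2.2.symm.trans (hk R' hR').2.2
  rw [heq] at h1
  field_simp at h1
  exact h1

end Chains

namespace HaarShift

variable {𝕜 : Type*} [RCLike 𝕜] {d : ℕ} (S : HaarShift 𝕜 d)

/-- The sparse operators built from the averages of `F` over the cubes of the grid of the shift are
bounded by `H` in `L^p(μ)`. -/
def SparseBound (p : ℝ) (μ : Measure (Fin d → ℝ)) (F : (Fin d → ℝ) → 𝕜) (H : ℝ≥0∞) : Prop :=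
  ∀ 𝒮 : Finset (Cube d), (∀ Q ∈ 𝒮, Q ∈ S.grid) → IsSparse 𝒮 →
    ∫⁻ x, (∑ Q ∈ 𝒮, Q.toSet.indicator (fun _ => cubeAvg F Q) x) ^ p ∂μ ≤ H ^ p

variable {S} {p : ℝ} {μ : Measure (Fin d → ℝ)} {F : (Fin d → ℝ) → 𝕜} {H : ℝ≥0∞}

lemma SparseBound.tailAvg_rpow_mul_le (h : S.SparseBound p μ F H) (hd : 0 < d) (hp : 0 < p)
    (Q : Cube d) : S.tailAvg F Q ^ p * μ Q.toSet ≤ H ^ p := by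
  rw [tailAvg, ENNReal.tsum_eq_iSup_sum, ← ENNReal.orderIsoRpow_apply p hp, OrderIso.map_iSup,
    ENNReal.iSup_mul]
  refine iSup_le fun s => ?_
  rw [ENNReal.orderIsoRpow_apply]
  set 𝒜 : Finset (Cube d) := s.map (Function.Embedding.subtype _) with h𝒜
  have hmem : ∀ R ∈ 𝒜, R ∈ S.grid ∧ Q.toSet ⊆ R.toSet := fun R hR => by
    obtain ⟨R', -, rfl⟩ := Finset.mem_map.1 hR
    exact ⟨R'.2.1, R'.2.2.subset⟩
  refine le_trans ?_ (h 𝒜 (fun R hR => (hmem R hR).1)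
    (S.isDyadicGrid.isSparse_of_subset hd hmem))
  rw [← setLIntegral_const]
  refine le_trans (setLIntegral_mono' Q.measurableSet_toSet fun x hx => ?_)
    (setLIntegral_le_lintegral Q.toSet _)
  refine ENNReal.rpow_le_rpow ?_ hp.le
  rw [h𝒜, Finset.sum_map]
  refine Finset.sum_le_sum fun R _ => ?_
  rw [Function.Embedding.subtype_apply, Set.indicator_of_mem (R.2.2.subset hx)]

lemma SparseBound.tailAvg_ne_top (h : S.SparseBound p μ F H) (hd : 0 < d) (hp : 0 < p)
    (hH : H ≠ ∞) {Q : Cube d} (hμ : μ Q.toSet ≠ 0) : S.tailAvg F Q ≠ ∞ := by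
  intro ht
  have h1 := h.tailAvg_rpow_mul_le hd hp Q
  rw [ht, ENNReal.top_rpow_of_pos hp, ENNReal.top_mul hμ] at h1
  exact (ENNReal.rpow_lt_top_of_nonneg hp.le hH).not_ge h1

lemma integrableOn_partialSum (S : HaarShift 𝕜 d) {Q : Cube d} (hQ : Q ∈ S.grid) (j : ℕ)
    (F : (Fin d → ℝ) → 𝕜) : IntegrableOn (S.partialSum Q j F) Q.toSet := by
  have h1 : IntegrableOn (fun y => ∑ l ∈ Finset.range (j + 1),
      ∑ R ∈ S.gen l Q, S.component R F y) Q.toSet := by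
    refine Integrable.integrableOn (integrable_finsetSum _ fun l _ =>
      integrable_finsetSum _ fun R hR => ?_)
    exact S.integrable_component ((S.mem_gen hQ).1 hR).1 F
  refine h1.congr_fun (fun y hy => ?_) Q.measurableSet_toSet
  exact Finset.sum_congr rfl fun l _ => (S.component_gridCube_eq_sum hQ l F hy).symm

lemma SparseBound.lintegral_iSup_partialSum_le (h : S.SparseBound p μ F H) (hd : 0 < d)
    (hp : 0 < p) (hμ : μ ≪ volume)
    {T : Lp 𝕜 2 (volume : Measure (Fin d → ℝ)) →L[𝕜] Lp 𝕜 2 (volume : Measure (Fin d → ℝ))}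
    (hT : S.Represents T) {Q : Cube d} (hQ : Q ∈ S.grid) (hF : IntegrableOn F Q.toSet) :
    ∫⁻ x in Q.toSet, (⨆ j, ‖S.partialSum Q j F x‖ₑ) ^ p ∂μ ≤
      ((S.m + 2) * S.stoppingConst ‖T‖ₑ * H) ^ p := by
  have hm : ∀ j, AEMeasurable (fun x => ‖S.partialSum Q j F x‖ₑ) (μ.restrict Q.toSet) := fun j =>
    ((S.integrableOn_partialSum hQ j F).aestronglyMeasurable.mono_ac (hμ.restrict _)).enorm
  have hsup : ∀ x, (⨆ j, ‖S.partialSum Q j F x‖ₑ) ^ p =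
      ⨆ k : ℕ, (⨆ j : Fin (k + 1), ‖S.partialSum Q j F x‖ₑ) ^ p := by
    intro x
    have h1 : ⨆ j, ‖S.partialSum Q j F x‖ₑ =
        ⨆ k : ℕ, ⨆ j : Fin (k + 1), ‖S.partialSum Q j F x‖ₑ :=
      le_antisymm (iSup_le fun j => le_iSup_of_le j (le_iSup_of_le (Fin.last j) (by simp)))
        (iSup_le fun k => iSup_le fun j => le_iSup (fun j => ‖S.partialSum Q j F x‖ₑ) (j : ℕ))
    rw [h1, ← ENNReal.orderIsoRpow_apply p hp, OrderIso.map_iSup]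
    simp only [ENNReal.orderIsoRpow_apply]
  simp only [hsup]
  rw [lintegral_iSup']
  · refine iSup_le fun k => ?_
    obtain ⟨𝒮, h1, h2, h3⟩ := S.exists_sparse_domination hd hT F k Q hQ hF
    calc ∫⁻ x in Q.toSet, (⨆ j : Fin (k + 1), ‖S.partialSum Q j F x‖ₑ) ^ p ∂μ
        ≤ ∫⁻ x in Q.toSet, ((S.m + 2) * S.stoppingConst ‖T‖ₑ) ^ p *
          (∑ P ∈ 𝒮, P.toSet.indicator (fun _ => cubeAvg F P) x) ^ p ∂μ := by
          refine setLIntegral_mono' Q.measurableSet_toSet fun x hx => ?_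
          rw [← ENNReal.mul_rpow_of_nonneg _ _ hp.le]
          exact ENNReal.rpow_le_rpow (iSup_le fun j => h3 x hx j (by omega)) hp.le
      _ ≤ ∫⁻ x, ((S.m + 2) * S.stoppingConst ‖T‖ₑ) ^ p *
          (∑ P ∈ 𝒮, P.toSet.indicator (fun _ => cubeAvg F P) x) ^ p ∂μ :=
          setLIntegral_le_lintegral _ _
      _ = ((S.m + 2) * S.stoppingConst ‖T‖ₑ) ^ p *
          ∫⁻ x, (∑ P ∈ 𝒮, P.toSet.indicator (fun _ => cubeAvg F P) x) ^ p ∂μ :=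
          lintegral_const_mul _ ((Finset.measurable_fun_sum _ fun P _ =>
            measurable_const.indicator P.measurableSet_toSet).pow_const p)
      _ ≤ _ := by
          rw [ENNReal.mul_rpow_of_nonneg ((S.m + 2) * S.stoppingConst ‖T‖ₑ) H hp.le]
          gcongr
          exact h 𝒮 (fun P hP => (h1 P hP).1) h2
  · exact fun k => (AEMeasurable.iSup fun j => hm _).pow_const p
  · refine Eventually.of_forall fun x k k' hk => ENNReal.rpow_le_rpow ?_ hp.le
    exact iSup_le fun j => le_iSup_of_le (Fin.castLE (by omega) j) le_rfl

/-- The bound for the maximal truncation on a cube of the grid. -/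
lemma SparseBound.lintegral_maximalTruncation_le (h : S.SparseBound p μ F H) (hd : 0 < d)
    (hp : 1 ≤ p) (hμ : μ ≪ volume)
    {T : Lp 𝕜 2 (volume : Measure (Fin d → ℝ)) →L[𝕜] Lp 𝕜 2 (volume : Measure (Fin d → ℝ))}
    (hT : S.Represents T) {Q : Cube d} (hQ : Q ∈ S.grid) (hF : IntegrableOn F Q.toSet) :
    ∫⁻ x in Q.toSet, S.maximalTruncation F x ^ p ∂μ ≤
      (2 * ((S.m + 2) * S.stoppingConst ‖T‖ₑ) * H) ^ p := by
  have hp0 : 0 < p := by linarith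
  set C := (S.m + 2) * S.stoppingConst ‖T‖ₑ with hC
  have hC1 : 1 ≤ C := one_le_mul (le_add_left one_le_two) (S.one_le_stoppingConst _)
  calc ∫⁻ x in Q.toSet, S.maximalTruncation F x ^ p ∂μ
      ≤ ∫⁻ x in Q.toSet, 2 ^ (p - 1) *
          (S.tailAvg F Q ^ p + (⨆ j, ‖S.partialSum Q j F x‖ₑ) ^ p) ∂μ :=
        setLIntegral_mono' Q.measurableSet_toSet fun x hx =>
          (ENNReal.rpow_le_rpow (S.maximalTruncation_le hd F hQ hx) hp0.le).trans
            (ENNReal.rpow_add_le_mul_rpow_add_rpow _ _ hp)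
    _ = 2 ^ (p - 1) * (S.tailAvg F Q ^ p * μ Q.toSet +
          ∫⁻ x in Q.toSet, (⨆ j, ‖S.partialSum Q j F x‖ₑ) ^ p ∂μ) := by
        rw [lintegral_const_mul' _ _ (ENNReal.rpow_ne_top_of_nonneg (by linarith) (by simp)),
          lintegral_add_left measurable_const, setLIntegral_const]
    _ ≤ 2 ^ (p - 1) * ((C * H) ^ p + (C * H) ^ p) := by
        gcongr
        · refine (h.tailAvg_rpow_mul_le hd hp0 Q).trans ?_
          exact ENNReal.rpow_le_rpow (le_mul_of_one_le_left zero_le hC1) hp0.le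
        · exact h.lintegral_iSup_partialSum_le hd hp0 hμ hT hQ hF
    _ = (2 * C * H) ^ p := by
        rw [← two_mul, ← mul_assoc, ENNReal.rpow_sub _ _ (by norm_num) (by norm_num), ENNReal.rpow_one,
          ENNReal.div_mul_cancel (by norm_num) (by norm_num), mul_assoc 2 C H,
          ENNReal.mul_rpow_of_nonneg 2 _ hp0.le]

end HaarShift

/-! ### Summation over the components of the grid -/

section Hull

variable {d : ℕ} {D : Set (Cube d)}

/-- The union of all cubes of the grid that contain `Q`. Two points lie in the same hull exactly
when some cube of the grid contains both, so the hulls partition space, like the quadrants for the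
standard grid. -/
def gridHull (D : Set (Cube d)) (Q : Cube d) : Set (Fin d → ℝ) :=
  ⋃ R : {R | R ∈ D ∧ Q.toSet ⊆ R.toSet}, (R : Cube d).toSet

lemma IsDyadicGrid.subset_or_subset (hd : 0 < d) (h : IsDyadicGrid D) {Q R : Cube d} (hQ : Q ∈ D)
    (hR : R ∈ D) {x : Fin d → ℝ} (hxQ : x ∈ Q.toSet) (hxR : x ∈ R.toSet) :
    Q.toSet ⊆ R.toSet ∨ R.toSet ⊆ Q.toSet :=
  (le_total Q.side R.side).imp (fun hs => h.subset_of_side_le hd hQ hR hs hxQ hxR)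
    fun hs => h.subset_of_side_le hd hR hQ hs hxR hxQ

lemma subset_gridHull {Q R : Cube d} (hR : R ∈ D) (hQR : Q.toSet ⊆ R.toSet) :
    R.toSet ⊆ gridHull D Q :=
  Set.subset_iUnion (fun R : {R | R ∈ D ∧ Q.toSet ⊆ R.toSet} => (R : Cube d).toSet) ⟨R, hR, hQR⟩

lemma IsDyadicGrid.subset_gridHull_of_mem (hd : 0 < d) (h : IsDyadicGrid D) {Q R : Cube d}
    (hR : R ∈ D) {x : Fin d → ℝ} (hx : x ∈ gridHull D Q) (hxR : x ∈ R.toSet) :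
    R.toSet ⊆ gridHull D Q := by
  obtain ⟨⟨P, hP, hQP⟩, hxP⟩ := Set.mem_iUnion.1 hx
  rcases h.subset_or_subset hd hR hP hxR hxP with h1 | h1
  · exact h1.trans (subset_gridHull hP hQP)
  · exact subset_gridHull hR (hQP.trans h1)

lemma IsDyadicGrid.gridHull_subset (hd : 0 < d) (h : IsDyadicGrid D) {Q Q' : Cube d}
    {x : Fin d → ℝ} (hx : x ∈ gridHull D Q) (hx' : x ∈ gridHull D Q') :
    gridHull D Q ⊆ gridHull D Q' := by
  obtain ⟨⟨P, hP, hQP⟩, hxP⟩ := Set.mem_iUnion.1 hx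
  have h1 := h.subset_gridHull_of_mem hd hP hx' hxP
  refine Set.iUnion_subset fun ⟨R, hR, hQR⟩ => ?_
  exact h.subset_gridHull_of_mem hd hR (h1 (hQP Q.corner_mem)) (hQR Q.corner_mem)

lemma IsDyadicGrid.measurableSet_gridHull (hd : 0 < d) (h : IsDyadicGrid D) {Q : Cube d}
    (hQ : Q ∈ D) : MeasurableSet (gridHull D Q) := by
  have := (h.countable_superset hd hQ).to_subtype
  exact MeasurableSet.iUnion fun R => (R : Cube d).measurableSet_toSet

lemma IsDyadicGrid.directed_superset (hd : 0 < d) (h : IsDyadicGrid D) (Q : Cube d) :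
    Directed (· ⊆ ·) fun R : {R | R ∈ D ∧ Q.toSet ⊆ R.toSet} => (R : Cube d).toSet := by
  intro R R'
  rcases h.subset_or_subset hd R.2.1 R'.2.1 (R.2.2 Q.corner_mem) (R'.2.2 Q.corner_mem) with h1 | h1
  · exact ⟨R', h1, subset_rfl⟩
  · exact ⟨R, subset_rfl, h1⟩

/-- An inequality between integrals that holds on every hull holds on the whole space. -/
lemma IsDyadicGrid.lintegral_le_of_gridHull (hd : 0 < d) (h : IsDyadicGrid D) (hne : D.Nonempty)
    {μ ν : Measure (Fin d → ℝ)} {f g : (Fin d → ℝ) → ℝ≥0∞}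
    (hfg : ∀ Q ∈ D, ∫⁻ x in gridHull D Q, f x ∂μ ≤ ∫⁻ x in gridHull D Q, g x ∂ν) :
    ∫⁻ x, f x ∂μ ≤ ∫⁻ x, g x ∂ν := by
  obtain ⟨Q₀, hQ₀⟩ := hne
  set 𝒵 := gridHull D '' {Q | Q ∈ D ∧ Q.side = Q₀.side} with h𝒵
  have hc : 𝒵.Countable := (h.countable_of_side_eq _).image _
  have := hc.to_subtype
  have hU : ⋃ Z : 𝒵, (Z : Set (Fin d → ℝ)) = Set.univ := by
    refine Set.eq_univ_of_forall fun x => ?_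
    obtain ⟨Q, ⟨hQ, hs, hx⟩, -⟩ := h.partition Q₀ hQ₀ x
    exact Set.mem_iUnion.2 ⟨⟨_, Set.mem_image_of_mem _ ⟨hQ, hs⟩⟩, subset_gridHull hQ subset_rfl hx⟩
  have hm : ∀ Z : 𝒵, MeasurableSet (Z : Set (Fin d → ℝ)) := by
    rintro ⟨_, Q, ⟨hQ, -⟩, rfl⟩
    exact h.measurableSet_gridHull hd hQ
  have hdisj : Pairwise (Function.onFun Disjoint fun Z : 𝒵 => (Z : Set (Fin d → ℝ))) := by
    intro Z Z' hZ
    obtain ⟨Q, -, hQ⟩ := Z.2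
    obtain ⟨Q', -, hQ'⟩ := Z'.2
    refine Set.disjoint_left.2 fun x hx hx' => hZ (Subtype.ext ?_)
    have hx₁ : x ∈ gridHull D Q := by rw [hQ]; exact hx
    have hx₂ : x ∈ gridHull D Q' := by rw [hQ']; exact hx'
    rw [← hQ, ← hQ']
    exact subset_antisymm (h.gridHull_subset hd hx₁ hx₂) (h.gridHull_subset hd hx₂ hx₁)
  rw [← setLIntegral_univ, ← setLIntegral_univ g, ← hU, lintegral_iUnion hm hdisj,
    lintegral_iUnion hm hdisj]
  refine ENNReal.tsum_le_tsum ?_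
  rintro ⟨_, Q, ⟨hQ, -⟩, rfl⟩
  exact hfg Q hQ

end Hull

namespace HaarShift

variable {𝕜 : Type*} [RCLike 𝕜] {d : ℕ} (S : HaarShift 𝕜 d)

/-- The maximal truncation at a point depends only on the restriction of the function to the hull
that contains the point. -/
lemma maximalTruncation_indicator_gridHull (hd : 0 < d) {F : (Fin d → ℝ) → 𝕜}
    (hF : ∀ R : Cube d, IntegrableOn F R.toSet) {Q : Cube d} {x : Fin d → ℝ}
    (hx : x ∈ gridHull S.grid Q) :
    S.maximalTruncation ((gridHull S.grid Q).indicator F) x = S.maximalTruncation F x := by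
  rw [maximalTruncation, maximalTruncation]
  refine iSup_congr fun ε => iSup_congr fun _ => ?_
  rw [truncation, truncation]
  congr 1
  refine tsum_congr fun R => ?_
  by_cases hxR : x ∈ (R : Cube d).toSet
  · refine (S.component_congr_on R.2.1 (hF R) (fun y hy => ?_) x).symm
    rw [Set.indicator_of_mem (S.isDyadicGrid.subset_gridHull_of_mem hd R.2.1 hx hxR hy)]
  · rw [S.component_eq_zero R.2.1 _ hxR, S.component_eq_zero R.2.1 _ hxR]

lemma maximalTruncation_eq_zero_of_grid_eq_empty (h : S.grid = ∅) (F : (Fin d → ℝ) → 𝕜)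
    (x : Fin d → ℝ) : S.maximalTruncation F x = 0 := by
  refine le_antisymm (iSup₂_le fun ε _ => ?_) zero_le
  have : IsEmpty (S.largeCubes ε) := ⟨fun R => by simpa [h] using R.2.1⟩
  rw [truncation, tsum_empty, enorm_zero]

/-- A bound for sparse operators in terms of `ν` transfers to the maximal truncation of `F` when
`‖F‖ dx = h dν`. -/
lemma lintegral_maximalTruncation_le_of_sparseOp (hd : 0 < d) {p : ℝ} (hp : 1 ≤ p)
    {μ ν : Measure (Fin d → ℝ)} (hμ : μ ≪ volume)
    {T : Lp 𝕜 2 (volume : Measure (Fin d → ℝ)) →L[𝕜] Lp 𝕜 2 (volume : Measure (Fin d → ℝ))}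
    (hT : S.Represents T) {F : (Fin d → ℝ) → 𝕜} (hF : ∀ R : Cube d, IntegrableOn F R.toSet)
    {h : (Fin d → ℝ) → ℝ≥0∞}
    (hFh : ∀ A, MeasurableSet A → ∫⁻ y in A, ‖F y‖ₑ = ∫⁻ y in A, h y ∂ν) {B : ℝ≥0∞}
    (hB : ∀ Z, MeasurableSet Z → ∀ 𝒮 : Finset (Cube d), (∀ Q ∈ 𝒮, Q ∈ S.grid) → IsSparse 𝒮 →
      ∫⁻ x, sparseOp ν 𝒮 (Z.indicator h) x ^ p ∂μ ≤ B ^ p * ∫⁻ x in Z, h x ^ p ∂ν) :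
    ∫⁻ x, S.maximalTruncation F x ^ p ∂μ ≤
      (2 * ((S.m + 2) * S.stoppingConst ‖T‖ₑ) * B) ^ p * ∫⁻ x, h x ^ p ∂ν := by
  have hp0 : 0 < p := by linarith
  rcases S.grid.eq_empty_or_nonempty with he | hne
  · simp only [S.maximalTruncation_eq_zero_of_grid_eq_empty he, ENNReal.zero_rpow_of_pos hp0,
      lintegral_zero]
    exact zero_le
  set C := (2 * ((S.m + 2) * S.stoppingConst ‖T‖ₑ) * B) ^ p with hC
  have hloc : ∀ Q ∈ S.grid, ∫⁻ x in gridHull S.grid Q, S.maximalTruncation F x ^ p ∂μ ≤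
      C * ∫⁻ x in gridHull S.grid Q, h x ^ p ∂ν := by
    intro Q hQ
    set Z := gridHull S.grid Q with hZ
    have hZm : MeasurableSet Z := S.isDyadicGrid.measurableSet_gridHull hd hQ
    have havg : ∀ R : Cube d, cubeAvg (Z.indicator F) R =
        (∫⁻ y in R.toSet, Z.indicator h y ∂ν) / volume R.toSet := by
      intro R
      simp only [cubeAvg, enorm_indicator_eq_indicator_enorm]
      rw [lintegral_indicator hZm, lintegral_indicator hZm, Measure.restrict_restrict hZm,
        Measure.restrict_restrict hZm, hFh _ (hZm.inter R.measurableSet_toSet)]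
    have hsp : S.SparseBound p μ (Z.indicator F)
        (B * (∫⁻ x in Z, h x ^ p ∂ν) ^ p⁻¹) := by
      intro 𝒮 h1 h2
      rw [ENNReal.mul_rpow_of_nonneg _ _ hp0.le, ENNReal.rpow_inv_rpow hp0.ne']
      simp only [havg]
      exact hB Z hZm 𝒮 h1 h2
    have := (S.isDyadicGrid.countable_superset hd hQ).to_subtype
    rw [hZ, gridHull, setLIntegral_iUnion_of_directed _ (S.isDyadicGrid.directed_superset hd Q),
      ← gridHull, ← hZ]
    refine iSup_le fun R => ?_
    calc ∫⁻ x in (R : Cube d).toSet, S.maximalTruncation F x ^ p ∂μ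
        = ∫⁻ x in (R : Cube d).toSet, S.maximalTruncation (Z.indicator F) x ^ p ∂μ := by
          refine setLIntegral_congr_fun (R : Cube d).measurableSet_toSet fun x hx => ?_
          rw [S.maximalTruncation_indicator_gridHull hd hF (subset_gridHull R.2.1 R.2.2 hx)]
      _ ≤ _ := hsp.lintegral_maximalTruncation_le hd hp hμ hT R.2.1 ((hF R).indicator hZm)
      _ = _ := by
          rw [hC, ← mul_assoc, ENNReal.mul_rpow_of_nonneg _ (_ ^ p⁻¹) hp0.le,
            ENNReal.rpow_inv_rpow hp0.ne']
  refine (S.isDyadicGrid.lintegral_le_of_gridHull (ν := C • ν) hd hne fun Q hQ => ?_).trans_eq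
    (lintegral_smul_measure _ _)
  rw [Measure.restrict_smul, lintegral_smul_measure]
  exact hloc Q hQ

/-- The series of the shift converges absolutely at almost every point. -/
lemma SparseBound.ae_summable {S : HaarShift 𝕜 d} {p : ℝ} {μ : Measure (Fin d → ℝ)}
    {F : (Fin d → ℝ) → 𝕜} {H : ℝ≥0∞} (h : S.SparseBound p μ F H) (hd : 0 < d) (hp : 0 < p)
    (hH : H ≠ ∞) (hF : ∀ R : Cube d, IntegrableOn F R.toSet) :
    ∀ᵐ x ∂μ, ∀ ε : ℝ, 0 < ε → Summable fun Q : S.largeCubes ε => S.component Q F x := by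
  rcases S.grid.eq_empty_or_nonempty with he | ⟨Q₀, hQ₀⟩
  · refine Eventually.of_forall fun x ε _ => ?_
    have : IsEmpty (S.largeCubes ε) := ⟨fun R => by simpa [he] using R.2.1⟩
    exact (hasSum_empty).summable
  have hgrid := S.isDyadicGrid
  have hnull : ∀ᵐ x ∂μ, ∀ k : ℕ, ∀ Q ∈ {Q | Q ∈ S.grid ∧ Q.side = Q₀.side / 2 ^ k},
      x ∈ Q.toSet → μ Q.toSet ≠ 0 := by
    rw [ae_all_iff]
    intro k
    rw [ae_ball_iff (hgrid.countable_of_side_eq _)]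
    intro Q _
    by_cases h0 : μ Q.toSet = 0
    · filter_upwards [measure_eq_zero_iff_ae_notMem.1 h0] with x hx hx'
      exact absurd hx' hx
    · exact Eventually.of_forall fun x _ => h0
  filter_upwards [hnull] with x hx ε hε
  obtain ⟨k, hk⟩ := pow_unbounded_of_one_lt (Q₀.side / ε) (one_lt_two)
  obtain ⟨Q', hQ', -⟩ := hgrid.exists_subcubes_mem hQ₀ Q₀.corner_mem k
  obtain ⟨Q, ⟨hQ, hs, hxQ⟩, -⟩ := hgrid.partition Q' hQ'.1 x
  have hside : Q.side = Q₀.side / 2 ^ k := hs.trans hQ'.2.2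
  have hle : Q.side ≤ ε := by
    rw [hside, div_le_iff₀ (by positivity)]
    rw [div_lt_iff₀ hε] at hk
    linarith
  refine summable_of_tsum_enorm_ne_top (ne_top_of_le_ne_top ?_ (S.tsum_large_le hd F hQ hle hxQ))
  exact ENNReal.add_ne_top.2 ⟨ENNReal.div_ne_top (hF Q).2.ne Q.volume_ne_zero,
    h.tailAvg_ne_top hd hp hH (hx k Q ⟨hQ, hside⟩ hxQ)⟩

end HaarShift

/-! ### Degenerate weights -/

section Degenerate

variable {d : ℕ}

lemma exists_cube_measure_ne_zero (μ ν : Measure (Fin d → ℝ)) (hμ : μ ≠ 0) (hν : ν ≠ 0) :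
    ∃ Q : Cube d, μ Q.toSet ≠ 0 ∧ ν Q.toSet ≠ 0 := by
  set C : ℕ → Cube d := fun n =>
    ⟨fun _ => -((n : ℝ) + 1), 2 * ((n : ℝ) + 1), by positivity⟩ with hC
  have hmono : Monotone fun n => (C n).toSet := by
    intro a b hab x hx i
    have h1 := hx i
    have h2 : (a : ℝ) ≤ b := by exact_mod_cast hab
    simp only [hC, Set.mem_Ico] at h1 ⊢
    constructor <;> linarith
  have hU : ⋃ n, (C n).toSet = Set.univ := by
    refine Set.eq_univ_of_forall fun x => ?_
    obtain ⟨n, hn⟩ := exists_nat_ge ‖x‖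
    refine Set.mem_iUnion.2 ⟨n, fun i => ?_⟩
    have h1 := (norm_le_pi_norm x i).trans hn
    rw [Real.norm_eq_abs, abs_le] at h1
    simp only [hC, Set.mem_Ico]
    constructor <;> linarith
  have hex : ∀ ρ : Measure (Fin d → ℝ), ρ ≠ 0 → ∃ n, ρ (C n).toSet ≠ 0 := by
    intro ρ hρ
    by_contra! h
    exact hρ (Measure.measure_univ_eq_zero.1 (by rw [← hU]; exact measure_iUnion_null h))
  obtain ⟨a, ha⟩ := hex μ hμ
  obtain ⟨b, hb⟩ := hex ν hν
  exact ⟨C (max a b), fun h => ha (measure_mono_null (hmono (le_max_left a b)) h),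
    fun h => hb (measure_mono_null (hmono (le_max_right a b)) h)⟩

lemma one_div_conjExponent {p : ℝ} (hp : 1 < p) : 1 / p.conjExponent = 1 - p⁻¹ := by
  have : p ≠ 0 := by linarith
  rw [Real.conjExponent]
  field_simp

lemma weightMeasure_eq_zero_of_twoWeightAp_eq_zero {p : ℝ} (hp : 1 < p) {w σ : (Fin d → ℝ) → ℝ}
    (h : twoWeightAp p w σ = 0) : weightMeasure w = 0 ∨ weightMeasure σ = 0 := by
  by_contra! hne
  obtain ⟨Q, hw, hs⟩ := exists_cube_measure_ne_zero _ _ hne.1 hne.2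
  have h1 := (ENNReal.iSup_eq_zero.1 h) Q
  have hp0 : 0 < 1 / p := by positivity
  have hp1 : 0 < 1 / p.conjExponent := by
    rw [one_div_conjExponent hp, sub_pos]; exact inv_lt_one_of_one_lt₀ hp
  rcases mul_eq_zero.1 h1 with h2 | h2
  · rw [ENNReal.rpow_eq_zero_iff_of_pos hp0, ENNReal.div_eq_zero_iff] at h2
    exact h2.elim hw Q.volume_ne_top
  · rw [ENNReal.rpow_eq_zero_iff_of_pos hp1, ENNReal.div_eq_zero_iff] at h2
    exact h2.elim hs Q.volume_ne_top

lemma weightMeasure_eq_zero_of_aInfty_eq_zero {w : (Fin d → ℝ) → ℝ} (hw : IsWeight w)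
    (h : aInfty w = 0) : weightMeasure w = 0 := by
  by_contra hne
  obtain ⟨Q, hQ, -⟩ := exists_cube_measure_ne_zero _ _ hne hne
  have h1 := (ENNReal.iSup_eq_zero.1 h) Q
  rw [ENNReal.div_eq_zero_iff] at h1
  rcases h1 with h1 | h1
  · have h2 : weightMeasure w Q.toSet / volume Q.toSet * volume Q.toSet ≤
        2 ^ d * ∫⁻ x in Q.toSet, cubeMaximal (Q.toSet.indicator fun y => ENNReal.ofReal (w y)) x := by
      rw [← setLIntegral_const, ← lintegral_const_mul' _ _ (by simp)]
      exact setLIntegral_mono' Q.measurableSet_toSet fun x hx => le_cubeMaximal w subset_rfl hx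
    rw [h1, mul_zero, ENNReal.div_mul_cancel Q.volume_ne_zero Q.volume_ne_top] at h2
    exact hQ (le_antisymm h2 zero_le)
  · exact hw.weightMeasure_ne_top Q h1

end Degenerate

/-! ### The weighted estimate -/

section WeightedInput

variable {𝕜 : Type*} [RCLike 𝕜] {d : ℕ}

/-- The density `‖σ f‖` with respect to Lebesgue measure is the density `‖f‖` with respect to
`σ`. -/
lemma IsWeight.exists_density {σ : (Fin d → ℝ) → ℝ} (hσ : IsWeight σ) {p : ℝ} (hp : 1 < p)
    {f : (Fin d → ℝ) → 𝕜} (hf : MemLp f (ENNReal.ofReal p) (weightMeasure σ)) :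
    ∃ h : (Fin d → ℝ) → ℝ≥0∞, Measurable h ∧ h =ᵐ[weightMeasure σ] (fun y => ‖f y‖ₑ) ∧
      (∀ A, MeasurableSet A → ∫⁻ y in A, ‖(σ y : 𝕜) * f y‖ₑ = ∫⁻ y in A, h y ∂weightMeasure σ) ∧
      ∀ Q : Cube d, IntegrableOn (fun y => (σ y : 𝕜) * f y) Q.toSet := by
  have hσm : AEMeasurable (fun y => ENNReal.ofReal (σ y)) volume :=
    hσ.locallyIntegrable.aestronglyMeasurable.aemeasurable.ennreal_ofReal
  have hfm : AEMeasurable (fun y => ‖f y‖ₑ) (weightMeasure σ) := hf.1.enorm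
  have heq : ∀ A, MeasurableSet A → ∫⁻ y in A, ‖(σ y : 𝕜) * f y‖ₑ =
      ∫⁻ y in A, ‖f y‖ₑ ∂weightMeasure σ := by
    intro A hA
    rw [weightMeasure, restrict_withDensity hA,
      lintegral_withDensity_eq_lintegral_mul₀' hσm.restrict
        (by rw [← restrict_withDensity hA]; exact hfm.restrict)]
    refine lintegral_congr_ae (ae_restrict_of_ae ?_)
    filter_upwards [hσ.nonneg] with y hy
    rw [enorm_mul, Pi.mul_apply, ← ofReal_norm, RCLike.norm_ofReal, abs_of_nonneg hy]
  refine ⟨hfm.mk _, hfm.measurable_mk, hfm.ae_eq_mk.symm, fun A hA => ?_, fun Q => ⟨?_, ?_⟩⟩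
  · rw [heq A hA]
    exact lintegral_congr_ae (ae_restrict_of_ae hfm.ae_eq_mk)
  · refine AEStronglyMeasurable.restrict ⟨fun y =>
      ((hσ.locallyIntegrable.aestronglyMeasurable.mk σ y : ℝ) : 𝕜) * hf.1.mk f y, ?_, ?_⟩
    · exact (RCLike.continuous_ofReal.comp_stronglyMeasurable
        hσ.locallyIntegrable.aestronglyMeasurable.stronglyMeasurable_mk).mul
        hf.1.stronglyMeasurable_mk
    · have h1 := (ae_withDensity_iff' hσm).1 hf.1.ae_eq_mk
      filter_upwards [h1, hσ.nonneg, hσ.locallyIntegrable.aestronglyMeasurable.ae_eq_mk]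
        with y hy1 hy2 hy3
      rw [← hy3]
      rcases hy2.eq_or_lt with h0 | h0
      · rw [← h0]; simp
      · rw [hy1 (by simpa using h0)]
  · rw [HasFiniteIntegral, heq _ Q.measurableSet_toSet, ← eLpNorm_one_eq_lintegral_enorm]
    have : IsFiniteMeasure ((weightMeasure σ).restrict Q.toSet) :=
      ⟨by rw [Measure.restrict_apply_univ]; exact (hσ.weightMeasure_ne_top Q).lt_top⟩
    exact (hf.restrict Q.toSet |>.mono_exponent
      (by rw [← ENNReal.ofReal_one]; exact ENNReal.ofReal_le_ofReal hp.le)).2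

lemma HaarShift.maximalTruncation_eq_zero (S : HaarShift 𝕜 d) {F : (Fin d → ℝ) → 𝕜}
    (hF : ∀ Q, cubeAvg F Q = 0) (x : Fin d → ℝ) : S.maximalTruncation F x = 0 := by
  refine le_antisymm (iSup₂_le fun ε _ => ?_) zero_le
  have h1 : ∀ Q : S.largeCubes ε, S.component Q F x = 0 := fun Q => by
    have := S.enorm_component_le_avg Q.2.1 F x
    rw [hF, nonpos_iff_eq_zero, enorm_eq_zero] at this
    exact this
  rw [truncation, tsum_congr h1, tsum_zero, enorm_zero]

end WeightedInput

lemma HaarShift.stoppingConst_le {𝕜 : Type*} [RCLike 𝕜] {d : ℕ} (S : HaarShift 𝕜 d) (hd : 0 < d)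
    {N : ℝ} {Λ : ℝ≥0∞} (hN : 0 ≤ N) (hΛ : Λ ≤ ENNReal.ofReal N) :
    2 * ((S.m + 2) * S.stoppingConst Λ) ≤
      ENNReal.ofReal (4 * ((9 + 5 * N) * (2 ^ d * 8) + 16) * 2 ^ d *
        Real.exp ((d + 1) * S.complexity)) := by
  have hm : S.m ≤ S.complexity := le_max_left _ _
  have hn : S.n ≤ S.complexity := le_max_right _ _
  set κ := S.complexity
  set X : ℝ := 2 ^ ((κ + 1) * d) with hX
  have h1 : 2 * ((S.m + 2) * S.stoppingConst Λ) ≤ ENNReal.ofReal (2 * ((S.m + 2) *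
      ((4 * (N + 1) + (N * 2 ^ ((S.m + 1) * d) + 5)) * (2 ^ d * 8) + 16 * (S.n + 1)))) := by
    rw [stoppingConst]
    have h2 : ∀ k : ℕ, ENNReal.ofReal (2 ^ k : ℝ) = 2 ^ k := fun k => by
      rw [ENNReal.ofReal_pow (by norm_num)]; simp
    rw [ENNReal.ofReal_mul (by norm_num), ENNReal.ofReal_mul (by positivity),
      ENNReal.ofReal_add (by positivity) (by positivity),
      ENNReal.ofReal_add (by positivity) (by positivity),
      ENNReal.ofReal_mul (by positivity), ENNReal.ofReal_add (by positivity) (by positivity),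
      ENNReal.ofReal_mul (by positivity), ENNReal.ofReal_add (by positivity) (by positivity),
      ENNReal.ofReal_add (by positivity) (by positivity), ENNReal.ofReal_mul (by positivity),
      ENNReal.ofReal_mul (by positivity), ENNReal.ofReal_mul (by positivity),
      ENNReal.ofReal_add (by positivity) (by positivity), h2, h2]
    simp only [ENNReal.ofReal_natCast, ENNReal.ofReal_ofNat, ENNReal.ofReal_one]
    gcongr
  refine h1.trans (ENNReal.ofReal_le_ofReal ?_)
  have hX1 : (2 : ℝ) ^ ((S.m + 1) * d) ≤ X := pow_le_pow_right₀ (by norm_num) (by gcongr)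
  have hX2 : (1 : ℝ) ≤ X := one_le_pow₀ (by norm_num)
  have hpow : ∀ k : ℕ, (k : ℝ) + 1 ≤ 2 ^ k := fun k => by exact_mod_cast Nat.lt_two_pow_self
  have hX3 : (S.n : ℝ) + 1 ≤ X := by
    calc (S.n : ℝ) + 1 ≤ 2 ^ S.n := hpow _
      _ ≤ X := pow_le_pow_right₀ (by norm_num) (by nlinarith)
  have hm2 : (S.m : ℝ) + 2 ≤ 2 * 2 ^ κ := by
    have h2 := hpow κ
    have h3 : (S.m : ℝ) ≤ κ := by exact_mod_cast hm
    have h4 : (1 : ℝ) ≤ 2 ^ κ := one_le_pow₀ (by norm_num)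
    linarith
  have hexp : (2 : ℝ) ^ κ * X ≤ 2 ^ d * Real.exp ((d + 1) * κ) := by
    have h2 : (2 : ℝ) ≤ Real.exp 1 := by linarith [Real.add_one_le_exp 1]
    have h3 : (2 : ℝ) ^ κ * X = 2 ^ d * 2 ^ ((d + 1) * κ) := by
      rw [hX, ← pow_add, ← pow_add]; congr 1; ring
    rw [h3, show ((d : ℝ) + 1) * κ = (((d + 1) * κ : ℕ) : ℝ) * 1 by push_cast; ring,
      Real.exp_nat_mul]
    gcongr
  set M : ℝ := (9 + 5 * N) * (2 ^ d * 8) + 16 with hM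
  have hin : (4 * (N + 1) + (N * 2 ^ ((S.m + 1) * d) + 5)) * (2 ^ d * 8) + 16 * (S.n + 1) ≤
      M * X := by
    have h2 : 4 * (N + 1) + (N * 2 ^ ((S.m + 1) * d) + 5) ≤ (9 + 5 * N) * X := by
      have h3 : N * 2 ^ ((S.m + 1) * d) ≤ N * X := by gcongr
      have h4 : N * 1 ≤ N * X := by gcongr
      linarith
    calc _ ≤ (9 + 5 * N) * X * (2 ^ d * 8) + 16 * X := by gcongr
      _ = M * X := by rw [hM]; ring
  calc _ ≤ 2 * (2 * 2 ^ κ * (M * X)) := by gcongr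
    _ = 4 * M * (2 ^ κ * X) := by ring
    _ ≤ 4 * M * (2 ^ d * Real.exp ((d + 1) * κ)) := by gcongr
    _ = _ := by ring

lemma eLpNorm_ofReal_eq {α ε : Type*} [MeasurableSpace α] [ENorm ε] {p : ℝ} (hp : 0 < p)
    (u : α → ε) (μ : Measure α) :
    eLpNorm u (ENNReal.ofReal p) μ = (∫⁻ x, ‖u x‖ₑ ^ p ∂μ) ^ p⁻¹ := by
  rw [eLpNorm_eq_lintegral_rpow_enorm_toReal (by simpa using hp) ENNReal.ofReal_ne_top,
    ENNReal.toReal_ofReal hp.le, one_div]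

theorem theorem2p4 {𝕜 : Type*} [RCLike 𝕜] (d : ℕ) (hd : 0 < d) (p : ℝ) (hp : 1 < p) (N : ℝ) :
    ∃ A c : ℝ, ∀ (S : HaarShift 𝕜 d)
      (T : Lp 𝕜 2 (volume : Measure (Fin d → ℝ)) →L[𝕜] Lp 𝕜 2 (volume : Measure (Fin d → ℝ))),
      S.Represents T → ‖T‖ ≤ N →
      ∀ w σ : (Fin d → ℝ) → ℝ, IsWeight w → IsWeight σ →
      ∀ f : (Fin d → ℝ) → 𝕜, MemLp f (ENNReal.ofReal p) (weightMeasure σ) →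
        (twoWeightAp p w σ ≠ ∞ → aInfty w ≠ ∞ → aInfty σ ≠ ∞ →
          ∀ᵐ x ∂(weightMeasure w), ∀ ε : ℝ, 0 < ε →
            Summable fun Q : S.largeCubes ε => S.component Q (fun y => (σ y : 𝕜) * f y) x) ∧
        eLpNorm (S.maximalTruncation fun y => (σ y : 𝕜) * f y) (ENNReal.ofReal p)
            (weightMeasure w) ≤
          ENNReal.ofReal (A * Real.exp (c * S.complexity)) * twoWeightAp p w σ *
            (aInfty w ^ (1 / p.conjExponent) + aInfty σ ^ (1 / p)) *
            eLpNorm f (ENNReal.ofReal p) (weightMeasure σ) := by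
  have hp0 : 0 < p := by linarith
  have hp1 : p⁻¹ < 1 := inv_lt_one_of_one_lt₀ hp
  set M : ℝ := 4 * ((9 + 5 * max N 0) * (2 ^ d * 8) + 16) * 2 ^ d with hM
  have hM0 : 0 < M := by positivity
  have hs0 : 0 ≤ sparseConst d p := sparseConst_nonneg hp
  refine ⟨M * (sparseConst d p + 1), d + 1, fun S T hT hTN w σ hw hσ f hf => ?_⟩
  obtain ⟨h, hhm, hhf, hFh, hFi⟩ := hσ.exists_density hp hf
  set F : (Fin d → ℝ) → 𝕜 := fun y => (σ y : 𝕜) * f y with hF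
  have hfh : ∫⁻ x, ‖f x‖ₑ ^ p ∂weightMeasure σ = ∫⁻ x, h x ^ p ∂weightMeasure σ :=
    lintegral_congr_ae (hhf.mono fun x hx => by simp only [hx])
  have hnorm : ∫⁻ x, h x ^ p ∂weightMeasure σ ≠ ∞ := by
    have h1 := hf.2.ne
    rw [eLpNorm_ofReal_eq hp0, hfh] at h1
    exact fun h2 => h1 (by rw [h2, ENNReal.top_rpow_of_pos (by positivity)])
  have hhQ : ∀ Q : Cube d, ∫⁻ y in Q.toSet, h y ∂weightMeasure σ ≠ ∞ := fun Q => by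
    rw [← hFh _ Q.measurableSet_toSet]
    exact (hFi Q).2.ne
  rw [one_div_conjExponent hp, one_div, eLpNorm_ofReal_eq hp0, eLpNorm_ofReal_eq hp0, hfh]
  simp only [enorm_eq_self]
  set K := twoWeightAp p w σ with hK
  set V := aInfty w ^ (1 - p⁻¹) + aInfty σ ^ p⁻¹ with hV
  set B := ENNReal.ofReal (sparseConst d p) * K * V with hB
  have hbound : K ≠ ∞ → aInfty w ≠ ∞ → aInfty σ ≠ ∞ → ∀ Z, MeasurableSet Z →
      ∀ 𝒮 : Finset (Cube d), (∀ Q ∈ 𝒮, Q ∈ S.grid) → IsSparse 𝒮 →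
      ∫⁻ x, sparseOp (weightMeasure σ) 𝒮 (Z.indicator h) x ^ p ∂weightMeasure w ≤
        B ^ p * ∫⁻ x in Z, h x ^ p ∂weightMeasure σ := by
    intro hKt hwt hst Z hZ 𝒮 h𝒮 hsp
    have hle : ∀ y, Z.indicator h y ≤ h y := fun y => Set.indicator_le_self _ _ _
    have hind : ∫⁻ x, Z.indicator h x ^ p ∂weightMeasure σ =
        ∫⁻ x in Z, h x ^ p ∂weightMeasure σ := by
      rw [← lintegral_indicator hZ]
      refine lintegral_congr fun x => ?_
      by_cases hx : x ∈ Z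
      · simp [hx]
      · simp [hx, hp0]
    have h1 := sparseOp_bound hd hp hw hσ hKt hwt hst (S.isDyadicGrid.isNested hd h𝒮) hsp
      (hhm.indicator hZ)
      (ne_top_of_le_ne_top hnorm (lintegral_mono fun y => ENNReal.rpow_le_rpow (hle y) hp0.le))
      fun Q _ => ne_top_of_le_ne_top (hhQ Q) (lintegral_mono hle)
    rw [hind, ENNReal.rpow_inv_le_iff hp0, ENNReal.mul_rpow_of_nonneg _ _ hp0.le,
      ENNReal.rpow_inv_rpow hp0.ne'] at h1
    exact h1
  have hBt : K ≠ ∞ → aInfty w ≠ ∞ → aInfty σ ≠ ∞ → B ≠ ∞ := fun hKt hwt hst =>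
    ENNReal.mul_ne_top (ENNReal.mul_ne_top ENNReal.ofReal_ne_top hKt)
      (ENNReal.add_ne_top.2 ⟨ENNReal.rpow_ne_top_of_nonneg (by linarith) hwt,
        ENNReal.rpow_ne_top_of_nonneg (by positivity) hst⟩)
  have havg : ∀ Q, cubeAvg F Q = (∫⁻ y in Q.toSet, h y ∂weightMeasure σ) / volume Q.toSet :=
    fun Q => by rw [cubeAvg, hFh _ Q.measurableSet_toSet]
  refine ⟨fun hKt hwt hst => ?_, ?_⟩
  · have hsp : S.SparseBound p (weightMeasure w) F
        (B * (∫⁻ x, h x ^ p ∂weightMeasure σ) ^ p⁻¹) := by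
      intro 𝒮 h𝒮 hsp
      have h1 := hbound hKt hwt hst Set.univ MeasurableSet.univ 𝒮 h𝒮 hsp
      rw [Set.indicator_univ, Measure.restrict_univ] at h1
      rw [ENNReal.mul_rpow_of_nonneg _ _ hp0.le, ENNReal.rpow_inv_rpow hp0.ne']
      refine le_of_eq_of_le ?_ h1
      simp only [havg]
      rfl
    exact hsp.ae_summable hd hp0 (ENNReal.mul_ne_top (hBt hKt hwt hst)
      (ENNReal.rpow_ne_top_of_nonneg (by positivity) hnorm)) hFi
  -- If `f`, `w` or `σ` vanishes, so does the left side. Otherwise all factors on the right are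
  -- nonzero, so that an infinite characteristic makes the right side infinite: here `0 * ∞ = 0`.
  · by_cases hn0 : ∫⁻ x, h x ^ p ∂weightMeasure σ = 0
    · have h0 : h =ᵐ[weightMeasure σ] 0 := by
        filter_upwards [(lintegral_eq_zero_iff (hhm.pow_const p)).1 hn0] with x hx
        simpa [hp0, hp0.not_gt] using hx
      have hF0 : ∀ Q, cubeAvg F Q = 0 := fun Q => by
        rw [havg, lintegral_congr_ae (ae_restrict_of_ae h0)]
        simp
      simp [S.maximalTruncation_eq_zero hF0, hp0]
    by_cases hw0 : weightMeasure w = 0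
    · simp [hw0, hp0]
    have hσ0 : weightMeasure σ ≠ 0 := fun hs => hn0 (by rw [hs, lintegral_zero_measure])
    have hK0 : K ≠ 0 := fun hK0 =>
      (weightMeasure_eq_zero_of_twoWeightAp_eq_zero hp hK0).elim hw0 hσ0
    have hV0 : V ≠ 0 := by
      have h1 : aInfty w ≠ 0 := fun h => hw0 (weightMeasure_eq_zero_of_aInfty_eq_zero hw h)
      have h2 : 0 < 1 - p⁻¹ := by linarith
      simp [hV, h1, h2, h2.not_gt]
    set E := ENNReal.ofReal (M * (sparseConst d p + 1) * Real.exp ((d + 1) * S.complexity)) with hE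
    have hE0 : E ≠ 0 := by
      rw [hE, Ne, ENNReal.ofReal_eq_zero, not_le]
      positivity
    have hN0 : (∫⁻ x, h x ^ p ∂weightMeasure σ) ^ p⁻¹ ≠ 0 := by
      simp [hn0, hp0, hp0.not_gt]
    by_cases hfin : K ≠ ∞ ∧ aInfty w ≠ ∞ ∧ aInfty σ ≠ ∞
    · obtain ⟨hKt, hwt, hst⟩ := hfin
      have h1 := S.lintegral_maximalTruncation_le_of_sparseOp hd hp.le
        (weightMeasure_absolutelyContinuous w) hT hFi hFh (hbound hKt hwt hst)
      have h2 := ENNReal.rpow_le_rpow h1 (inv_nonneg.2 hp0.le)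
      rw [ENNReal.mul_rpow_of_nonneg _ _ (inv_nonneg.2 hp0.le), ENNReal.rpow_rpow_inv hp0.ne'] at h2
      refine h2.trans ?_
      gcongr ?_ * _
      have hΛ : ‖T‖ₑ ≤ ENNReal.ofReal (max N 0) := by
        rw [← ofReal_norm]
        exact ENNReal.ofReal_le_ofReal (hTN.trans (le_max_left _ _))
      calc 2 * ((S.m + 2) * S.stoppingConst ‖T‖ₑ) * B
          ≤ ENNReal.ofReal (M * Real.exp ((d + 1) * S.complexity)) *
            (ENNReal.ofReal (sparseConst d p + 1) * K * V) := by
            refine mul_le_mul' (S.stoppingConst_le hd (le_max_right _ _) hΛ) ?_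
            rw [hB]
            gcongr
            linarith
        _ = E * K * V := by
            rw [hE, mul_right_comm M, ENNReal.ofReal_mul (p := M * _) (by positivity)]
            ring
    · have htop : E * K * V = ∞ := by
        rw [not_and_or, not_and_or] at hfin
        simp only [not_not] at hfin
        rcases hfin with h1 | h1 | h1
        · rw [h1, ENNReal.mul_top hE0, ENNReal.top_mul hV0]
        · rw [hV, h1, ENNReal.top_rpow_of_pos (by linarith), top_add,
            ENNReal.mul_top (mul_ne_zero hE0 hK0)]
        · rw [hV, h1, ENNReal.top_rpow_of_pos (by positivity), add_top,
            ENNReal.mul_top (mul_ne_zero hE0 hK0)]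
      rw [htop, ENNReal.top_mul hN0]
      exact le_top
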